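/- **Notation.** Let $n, N\ge 1$ be integers and $S=\mathbb Z[q,q^{-1}]$. All permutations act from the right, and $\ell$ denotes the Coxeter length. *The algebra.* The braids and ties algebra $\mathcal E_n(q)$ is the associative unital $S$-algebra with generators $g_1,\dots,g_{n-1},e_1,\dots,e_{n-1}$ and relations $g_ig_j=g_jg_i$ and $g_ie_j=e_jg_i$ for $|i-j|>1$; $g_ie_i=e_ig_i$; $e_ie_j=e_je_i$ for all $i,j$; $e_i^2=e_i$; $g_i^2=1+(q-q^{-1})e_ig_i$; and, for $|i-j|=1$, $g_ig_jg_i=g_jg_ig_j$, $e_ig_jg_i=g_jg_ie_j$, $e_ie_jg_j=e_ig_je_i=g_je_ie_j$. Let $*$ be the $S$-linear anti-automorphism that fixes all $g_i$ and $e_i$, and put $g_w=g_{i_1}\cdots g_{i_k}$ for a reduced expression $w=s_{i_1}\cdots s_{i_k}\in\mathfrak S_n$. Put $E_{i,i+1}=e_i$ and $E_{ij}=g_iE_{i+1,j}g_i^{-1}$ for $j>i+1$. For a set partition $A$ of $\{1,\dots,n\}$ let $E_A$ be the product of the (commuting) $E_{ij}$ over the pairs $i<j$ in a common block of $A$, and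 let $\mathbb E_A=\sum_{B\ge A}\mu(A,B)E_B$, where $A\le B$ means that $A$ refines $B$ and $\mu$ is the Möbius function of this order. For a partition $\alpha$ of $n$ let $\mathbb E_\alpha=\sum_A\mathbb E_A$ over the set partitions $A$ whose block sizes are the parts of $\alpha$. Put $\mathcal E_n^\alpha(q)=\mathbb E_\alpha\mathcal E_n(q)$. *Labels.* Let $r$ be the number of parts of $\alpha$, and fix a total order on the set of all partitions that extends the dominance order. $\mathcal L_n(\alpha)$ is the set of pairs $\Lambda=(\lambda\mid\mu)$ as follows. First, $\lambda=(\lambda^{(1)},\dots,\lambda^{(r)})$ is a multipartition of $n$ with $\lambda^{(1)}\le\dots\le\lambda^{(r)}$ in the total order, such that the sizes $|\lambda^{(k)}|$ are, up to order, the parts of $\alpha$. Second, if the distinct components of $\lambda$, in increasing order, have multiplicities $m_1,\dots,m_s$, then $\mu=(\mu^{(1)},\dots,\mu^{(s)})$ with $\mu^{(j)}$ a partition of $m_j$. Let $\mathcal L_{n,\le N}(\alpha)$ be the subset of the $\Lambda$ for which every $\lambda^{(k)}$ has at most $N$ columns. *Tableaux.* For a multipartition $\lambda$ of $n$, a $\lambda$-multitableau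 is a filling of the nodes of $\lambda$ with $1,\dots,n$, each used once; $t^\lambda$ is the one with entries in order along the rows of the first component, then of the second, and so on. It is standard if its entries increase along rows and down columns in each component. For a $\lambda$-multitableau $t$, $d(t)\in\mathfrak S_n$ is given by $t=t^\lambda d(t)$. Let $\mathrm{Std}(\Lambda)$ be the set of pairs $(t\mid u)$ in which $t$ is a standard $\lambda$-multitableau such that whenever $\lambda^{(i)}=\lambda^{(j)}$ with $i<j$ the smallest entry of the $i$-th component of $t$ is less than that of the $j$-th, and $u$ is a standard $\mu$-multitableau (with entries $1,\dots,r$) in which every number lies in the same component as in $t^\mu$. *The elements $n_{\mathfrak s\mathfrak t}$.* Let $\mathfrak S_\lambda\le\mathfrak S_n$ be the row stabilizer of $t^\lambda$, let $A_\lambda$ be the set partition whose blocks are the sets of entries of the components of $t^\lambda$, and put $\mathbb E_\lambda=\mathbb E_{A_\lambda}$ and $y_\lambda=\sum_{w\in\mathfrak S_\lambda}(-q)^{-\ell(w)}g_w$. If $\lambda^{(i)}=\lambda^{(i+1)}$ let $B_i\in\mathfrak S_n$ be the permutation that exchanges the $i$-th and $(i+1)$-st blocks of $A_\lambda$, preserving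 the order within each of them, and fixes all other points; put $\mathbb B_i=\mathbb E_\lambda g_{B_i}$. For $w=s_{i_1}\cdots s_{i_k}$ (reduced) in $\mathfrak S_{m_1}\times\dots\times\mathfrak S_{m_s}\le\mathfrak S_r$ put $\mathbb B_w=\mathbb E_\lambda\mathbb B_{i_1}\cdots\mathbb B_{i_k}$. Let $\mathfrak S_\mu\le\mathfrak S_r$ be the row stabilizer of $t^\mu$ and $c_\mu=\sum_{w\in\mathfrak S_\mu}(-1)^{\ell(w)}\mathbb B_w$. For $\mathfrak s=(s\mid u)$ and $\mathfrak t=(t\mid v)$ in $\mathrm{Std}(\Lambda)$ put $$n_{\mathfrak s\mathfrak t}=g_{d(s)}^*\,\mathbb E_\lambda\, y_\lambda\,\mathbb B_{d(u)}^*\,c_\mu\,\mathbb B_{d(v)}\,g_{d(t)} .$$ *Tensor space.* Let $V$ be the free $S$-module with basis $v_i^s$, $1\le i\le N$, $1\le s\le r$. The algebra $\mathcal E_n(q)$ acts on $V^{\otimes n}$ from the right: $e_k$ and $g_k$ act in the tensor factors $k,k+1$ by the operators $\mathbf E$ and $\mathbf G$, where $(v_i^s\otimes v_j^t)\mathbf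 E$ is $v_i^s\otimes v_j^t$ if $s=t$ and $0$ otherwise, and $(v_i^s\otimes v_j^t)\mathbf G$ is $v_j^t\otimes v_i^s$ if $s\ne t$ or if $s=t$, $i<j$; is $q\,v_i^s\otimes v_i^s$ if $s=t$, $i=j$; and is $(q-q^{-1})v_i^s\otimes v_j^s+v_j^s\otimes v_i^s$ if $s=t$, $i>j$. Let $\mathcal I=\mathcal I_{n,N}^\alpha$ be the annihilator of $\mathbb E_\alpha V^{\otimes n}$ in $\mathcal E_n^\alpha(q)$, and $\mathcal{ETL}_{n,N}^\alpha(q)=\mathcal E_n^\alpha(q)/\mathcal I$. For a field $\mathcal K$ with a chosen nonzero element $q$, regarded as an $S$-algebra, let $\mathcal E_n^{\mathcal K,\alpha}(q)=\mathcal K\otimes_S\mathcal E_n^\alpha(q)$, let $V_{\mathcal K}$ be the $\mathcal K$-vector space with basis $v_i^s$ and the action given by the same formulas, and let $\mathcal{ETL}_{n,N}^{\mathcal K,\alpha}(q)$ be the quotient of $\mathcal E_n^{\mathcal K,\alpha}(q)$ by the annihilator of $\mathbb E_\alpha V_{\mathcal K}^{\otimes n}$. **Statement.** For all $n,N\ge1$,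 every partition $\alpha$ of $n$ and every total order as above: 1. $\mathcal I$ is a two-sided ideal of $\mathcal E_n^\alpha(q)$; the elements $n_{\mathfrak s\mathfrak t}$ with $\mathfrak s,\mathfrak t\in\mathrm{Std}(\Lambda)$, $\Lambda\in\mathcal L_{n,\le N}(\alpha)$, lie in $\mathcal E_n^\alpha(q)$; and $\mathcal{ETL}_{n,N}^\alpha(q)$ is free over $S$ with basis the images of these elements, indexed by the triples $(\Lambda,\mathfrak s,\mathfrak t)$. 2. For every field $\mathcal K$ and nonzero $q\in\mathcal K$, the annihilator of $\mathbb E_\alpha V_{\mathcal K}^{\otimes n}$ is a two-sided ideal of $\mathcal E_n^{\mathcal K,\alpha}(q)$, and the images of the $1\otimes n_{\mathfrak s\mathfrak t}$, indexed by the same triples, form a $\mathcal K$-basis of $\mathcal{ETL}_{n,N}^{\mathcal K,\alpha}(q)$. The number of these triples is finite, and $$\dim_{\mathcal K}\mathcal{ETL}_{n,N}^{\mathcal K,\alpha}(q)=\sum_{\Lambda\in\mathcal L_{n,\le N}(\alpha)}|\mathrm{Std}(\Lambda)|^2 .$$ -/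

import Mathlib

open scoped TensorProduct LaurentPolynomial

noncomputable section

namespace BraidsTies

/-- The ground ring `S = ℤ[q, q⁻¹]`. -/
abbrev GroundRing : Type := ℤ[T;T⁻¹]

/-- The indeterminate `q`. -/
def qVar : GroundRing := LaurentPolynomial.T 1

/-- The inverse `q⁻¹` of the indeterminate. -/
def qInv : GroundRing := LaurentPolynomial.T (-1)

theorem qVar_mul_qInv : qVar * qInv = 1 := by
  rw [qVar, qInv, ← LaurentPolynomial.T_add]; simp

/-! ### The symmetric group, acting from the right -/

/-- The point `i` as an element of the set on which `𝔖_n` acts. -/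
def lo {n : ℕ} (i : Fin (n - 1)) : Fin n := ⟨i, by omega⟩

/-- The point `i + 1`. -/
def hi {n : ℕ} (i : Fin (n - 1)) : Fin n := ⟨i + 1, by omega⟩

/-- The simple transposition `s_i = (i, i + 1)`. -/
def adjSwap {n : ℕ} (i : Fin (n - 1)) : Equiv.Perm (Fin n) := Equiv.swap (lo i) (hi i)

/-- The permutation `s_{i_1} s_{i_2} ⋯ s_{i_k}`; permutations act from the right, so `s_{i_1}`
is applied first. -/
def wordPerm {n : ℕ} : List (Fin (n - 1)) → Equiv.Perm (Fin n)
  | [] => Equiv.refl _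
  | i :: l => (adjSwap i).trans (wordPerm l)

theorem wordPerm_append {n : ℕ} (l l' : List (Fin (n - 1))) :
    wordPerm (l ++ l') = (wordPerm l).trans (wordPerm l') := by
  induction l with
  | nil => rfl
  | cons i l ih => simp [wordPerm, ih, Equiv.trans_assoc]

theorem exists_wordPerm {n : ℕ} (w : Equiv.Perm (Fin n)) : ∃ l, wordPerm l = w := by
  cases n with
  | zero => exact ⟨[], Subsingleton.elim _ _⟩
  | succ m =>
    have hw : w ∈ Submonoid.closure
        (Set.range fun i : Fin m ↦ Equiv.swap i.castSucc i.succ) := by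
      rw [Equiv.Perm.mclosure_swap_castSucc_succ]; trivial
    induction hw using Submonoid.closure_induction with
    | mem x hx =>
      obtain ⟨i, rfl⟩ := hx
      exact ⟨[i], rfl⟩
    | one => exact ⟨[], rfl⟩
    | mul x y _ _ hx hy =>
      obtain ⟨l, rfl⟩ := hx
      obtain ⟨l', rfl⟩ := hy
      exact ⟨l' ++ l, wordPerm_append _ _⟩

theorem exists_reducedWord {n : ℕ} (w : Equiv.Perm (Fin n)) :
    ∃ l, wordPerm l = w ∧ ∀ l', wordPerm l' = w → l.length ≤ l'.length := by
  classical
  have h : ∃ k, ∃ l, wordPerm l = w ∧ l.length = k :=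
    (exists_wordPerm w).elim fun l hl ↦ ⟨_, l, hl, rfl⟩
  obtain ⟨l, hl, hk⟩ := Nat.find_spec h
  exact ⟨l, hl, fun l' hl' ↦ hk.trans_le (Nat.find_min' h ⟨l', hl', rfl⟩)⟩

/-- A reduced expression of `w`, that is an expression of minimal length. -/
def reducedWord {n : ℕ} (w : Equiv.Perm (Fin n)) : List (Fin (n - 1)) :=
  (exists_reducedWord w).choose

/-- The Coxeter length `ℓ(w)`. -/
def len {n : ℕ} (w : Equiv.Perm (Fin n)) : ℕ := (reducedWord w).length

/-! ### The braids and ties algebra -/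

/-- `|i - j| = 1`. -/
def Adjacent {m : ℕ} (i j : Fin m) : Prop := (i : ℕ) + 1 = j ∨ (j : ℕ) + 1 = i

/-- `|i - j| > 1`. -/
def Far {m : ℕ} (i j : Fin m) : Prop := (i : ℕ) + 1 < j ∨ (j : ℕ) + 1 < i

/-- The free algebra on the letters `g_i` (left summand) and `e_i` (right summand). -/
abbrev FreeGE (n : ℕ) : Type := FreeAlgebra GroundRing (Fin (n - 1) ⊕ Fin (n - 1))

/-- The letter `g_i`. -/
def fg {n : ℕ} (i : Fin (n - 1)) : FreeGE n := FreeAlgebra.ι _ (Sum.inl i)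

/-- The letter `e_i`. -/
def fe {n : ℕ} (i : Fin (n - 1)) : FreeGE n := FreeAlgebra.ι _ (Sum.inr i)

/-- The defining relations of the braids and ties algebra. -/
inductive Rel (n : ℕ) : FreeGE n → FreeGE n → Prop
  | gg_far (i j : Fin (n - 1)) : Far i j → Rel n (fg i * fg j) (fg j * fg i)
  | ge (i : Fin (n - 1)) : Rel n (fg i * fe i) (fe i * fg i)
  | braid (i j : Fin (n - 1)) : Adjacent i j →
      Rel n (fg i * fg j * fg i) (fg j * fg i * fg j)
  | egg (i j : Fin (n - 1)) : Adjacent i j →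
      Rel n (fe i * fg j * fg i) (fg j * fg i * fe j)
  | eeg (i j : Fin (n - 1)) : Adjacent i j →
      Rel n (fe i * fe j * fg j) (fe i * fg j * fe i)
  | ege (i j : Fin (n - 1)) : Adjacent i j →
      Rel n (fe i * fg j * fe i) (fg j * fe i * fe j)
  | ee (i j : Fin (n - 1)) : Rel n (fe i * fe j) (fe j * fe i)
  | ge_far (i j : Fin (n - 1)) : Far i j → Rel n (fg i * fe j) (fe j * fg i)
  | e_sq (i : Fin (n - 1)) : Rel n (fe i * fe i) (fe i)
  | g_sq (i : Fin (n - 1)) : Rel n (fg i * fg i) (1 + (qVar - qInv) • (fe i * fg i))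

/-- The braids and ties algebra `𝓔_n(q)` over `S`. -/
def BT (n : ℕ) : Type := RingQuot (Rel n)

instance (n : ℕ) : Ring (BT n) := inferInstanceAs (Ring (RingQuot (Rel n)))

instance (n : ℕ) : Algebra GroundRing (BT n) :=
  inferInstanceAs (Algebra GroundRing (RingQuot (Rel n)))

/-- The quotient map from the free algebra. -/
def mkBT (n : ℕ) : FreeGE n →ₐ[GroundRing] BT n := RingQuot.mkAlgHom GroundRing (Rel n)

/-- The universal property of `𝓔_n(q)`. -/
def liftBT {n : ℕ} {A : Type*} [Semiring A] [Algebra GroundRing A] (f : FreeGE n →ₐ[GroundRing] A)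
    (hf : ∀ ⦃x y⦄, Rel n x y → f x = f y) : BT n →ₐ[GroundRing] A :=
  RingQuot.liftAlgHom GroundRing ⟨f, hf⟩

theorem liftBT_mk {n : ℕ} {A : Type*} [Semiring A] [Algebra GroundRing A]
    (f : FreeGE n →ₐ[GroundRing] A) (hf : ∀ ⦃x y⦄, Rel n x y → f x = f y) (x : FreeGE n) :
    liftBT f hf (mkBT n x) = f x :=
  RingQuot.liftAlgHom_mkAlgHom_apply GroundRing f hf x

/-- The generator `g_i` of `𝓔_n(q)`. -/
def g {n : ℕ} (i : Fin (n - 1)) : BT n := mkBT n (fg i)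

/-- The generator `e_i` of `𝓔_n(q)`. -/
def e {n : ℕ} (i : Fin (n - 1)) : BT n := mkBT n (fe i)

theorem rel_eq {n : ℕ} {x y : FreeGE n} (h : Rel n x y) :
    mkBT n x = mkBT n y :=
  RingQuot.mkAlgHom_rel GroundRing h

theorem g_sq {n : ℕ} (i : Fin (n - 1)) : g i * g i = 1 + (qVar - qInv) • (e i * g i) := by
  simpa [g, e] using rel_eq (Rel.g_sq i)

theorem g_mul_e {n : ℕ} (i : Fin (n - 1)) : g i * e i = e i * g i := by
  simpa [g, e] using rel_eq (Rel.ge i)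

theorem e_sq {n : ℕ} (i : Fin (n - 1)) : e i * e i = e i := by
  simpa [g, e] using rel_eq (Rel.e_sq i)

/-- The generator `g_i` as a unit, with inverse `g_i + (q⁻¹ - q) e_i`. -/
def gUnit {n : ℕ} (i : Fin (n - 1)) : (BT n)ˣ where
  val := g i
  inv := g i + (qInv - qVar) • e i
  val_inv := by
    rw [mul_add, g_sq, mul_smul_comm, g_mul_e, add_assoc, ← add_smul]; simp
  inv_val := by
    rw [add_mul, g_sq, smul_mul_assoc, add_assoc, ← add_smul]; simp

/-- The `S`-linear anti-automorphism `*` of `𝓔_n(q)` that fixes every `g_i` and every `e_i`,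
as an algebra homomorphism to the opposite algebra. -/
def starHom (n : ℕ) : BT n →ₐ[GroundRing] (BT n)ᵐᵒᵖ :=
  liftBT
    (FreeAlgebra.lift GroundRing (Sum.elim (fun i ↦ MulOpposite.op (g i))
      (fun i ↦ MulOpposite.op (e i)))) (by
      have hadj : ∀ {i j : Fin (n - 1)}, Adjacent i j → Adjacent j i := fun h ↦ h.symm
      have hee : ∀ i j : Fin (n - 1), e i * e j = e j * e i := fun i j ↦ by
        simpa [g, e] using rel_eq (Rel.ee i j)
      intro x y h
      apply MulOpposite.unop_injective
      induction h with
      | gg_far i j h => simpa [fg, fe, g, e] using (rel_eq (Rel.gg_far i j h)).symm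
      | ge i => simpa [fg, fe] using (g_mul_e i).symm
      | braid i j h =>
        simpa [fg, fe, g, e, mul_assoc] using rel_eq (Rel.braid i j h)
      | egg i j h =>
        simpa [fg, fe, g, e, mul_assoc] using (rel_eq (Rel.egg j i (hadj h))).symm
      | eeg i j h =>
        have h1 := rel_eq (Rel.ege i j h)
        simp only [map_mul] at h1
        have := hee i j
        simp only [e] at this
        rw [mul_assoc _ _ (mkBT n (fe j)), this] at h1
        simpa [fg, fe, g, e, mul_assoc] using h1.symm
      | ege i j h =>
        have h1 := rel_eq (Rel.eeg i j h)
        simp only [map_mul] at h1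
        have := hee i j
        simp only [e] at this
        rw [this] at h1
        simpa [fg, fe, g, e, mul_assoc] using h1.symm
      | ee i j => simpa [fg, fe] using (hee i j).symm
      | ge_far i j h => simpa [fg, fe, g, e] using (rel_eq (Rel.ge_far i j h)).symm
      | e_sq i => simpa [fg, fe] using e_sq i
      | g_sq i => simpa [fg, fe, g_mul_e] using g_sq i)

/-- `x ↦ x^*`. -/
def star {n : ℕ} (x : BT n) : BT n := (starHom n x).unop


/-! ### Set partitions and the idempotents -/

/-- Set partitions of `{1, …, n}`, ordered by refinement: `A ≤ B` if every block of `B` is a union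
of blocks of `A`. -/
abbrev SetPartition (n : ℕ) : Type := Finpartition (Finset.univ : Finset (Fin n))

/-- The multiset of block sizes of a set partition. -/
def blockSizes {n : ℕ} (A : SetPartition n) : Multiset ℕ := A.parts.val.map Finset.card

/-- `eSpan k i` is the element `E_{i, i + 1 + k}`: one has `E_{i, i + 1} = e_i` and
`E_{i, j} = g_i E_{i + 1, j} g_i⁻¹` for `j > i + 1`. The value is `1` when `i + 1 + k` is not one
of the `n` points. -/
def eSpan (n : ℕ) : ℕ → ℕ → BT n
  | 0, i => if h : i < n - 1 then e ⟨i, h⟩ else 1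
  | k + 1, i => if h : i < n - 1 then
      (gUnit ⟨i, h⟩ : BT n) * eSpan n k (i + 1) * ((gUnit ⟨i, h⟩)⁻¹ : (BT n)ˣ) else 1

/-- The element `E_{i j}` for `i < j`. -/
def ePair {n : ℕ} (i j : Fin n) : BT n := eSpan n (j - i - 1) i

open Classical in
/-- The pairs `i < j` of points in the same block of `A`. -/
def blockPairs {n : ℕ} (A : SetPartition n) : List (Fin n × Fin n) :=
  (List.finRange n ×ˢ List.finRange n).filter
    fun p ↦ p.1 < p.2 ∧ A.part p.1 = A.part p.2

/-- The element `E_A`, the product of the (commuting) `E_{i j}` over the pairs `i < j` of points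
in the same block of `A`. -/
def eSet {n : ℕ} (A : SetPartition n) : BT n :=
  ((blockPairs A).map fun p ↦ ePair p.1 p.2).prod

open Classical in
/-- The Möbius function of the lattice of set partitions. -/
def moebius {n : ℕ} (A B : SetPartition n) : ℤ :=
  letI : LocallyFiniteOrder (SetPartition n) := Fintype.toLocallyFiniteOrder
  IncidenceAlgebra.mu ℤ A B

open Classical in
/-- The idempotent `𝔼_A = ∑_{A ≤ B} μ(A, B) E_B`. -/
def idem {n : ℕ} (A : SetPartition n) : BT n :=
  ∑ B : SetPartition n with A ≤ B, moebius A B • eSet B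

open Classical in
/-- The central idempotent `𝔼_α`, the sum of the `𝔼_A` over the set partitions `A` of type `α`. -/
def idemType {n : ℕ} (α : n.Partition) : BT n :=
  ∑ A : SetPartition n with blockSizes A = α.parts, idem A

/-- The summand `𝓔_n^α(q) = 𝔼_α 𝓔_n(q)`. -/
def BTType {n : ℕ} (α : n.Partition) : NonUnitalSubalgebra GroundRing (BT n) where
  carrier := {x | ∃ y, x = idemType α * y}
  add_mem' := by
    rintro _ _ ⟨x, rfl⟩ ⟨y, rfl⟩
    exact ⟨x + y, (mul_add _ _ _).symm⟩
  zero_mem' := ⟨0, (mul_zero _).symm⟩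
  mul_mem' := by
    rintro _ _ ⟨x, rfl⟩ ⟨y, rfl⟩
    exact ⟨x * (idemType α * y), by simp [mul_assoc]⟩
  smul_mem' := by
    rintro c _ ⟨x, rfl⟩
    exact ⟨c • x, (mul_smul_comm _ _ _).symm⟩

/-- The element `g_w`, a product of generators along a reduced expression of `w`. -/
def gPerm {n : ℕ} (w : Equiv.Perm (Fin n)) : BT n := ((reducedWord w).map g).prod

/-! ### Multipartitions and tableaux -/

/-- An `r`-multipartition of `n`; a partition is given by its Young diagram. -/
@[ext]
structure Multipartition (r n : ℕ) where
  /-- The components. -/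
  comp : Fin r → YoungDiagram
  sum_card : ∑ k, (comp k).card = n

namespace Multipartition

variable {r n : ℕ} (lam : Multipartition r n)

/-- The nodes of the Young diagram of a multipartition: a component number together with a pair
(row, column) in that component. -/
abbrev Node : Type := Σ k : Fin r, {c : ℕ × ℕ // c ∈ lam.comp k}

/-- The key by which nodes are ordered: first component, then row, then column. -/
def key (x : lam.Node) : Fin r ×ₗ (ℕ ×ₗ ℕ) := toLex (x.1, toLex x.2.1)

theorem key_injective : Function.Injective lam.key := by
  rintro ⟨k, c, hc⟩ ⟨k', c', hc'⟩ h
  simp only [key, EmbeddingLike.apply_eq_iff_eq, Prod.mk.injEq] at h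
  obtain ⟨rfl, rfl⟩ := h
  rfl

instance : Fintype lam.Node :=
  letI (k : Fin r) : Fintype {c : ℕ × ℕ // c ∈ lam.comp k} :=
    Fintype.subtype (lam.comp k).cells fun _ ↦ Iff.rfl
  inferInstanceAs (Fintype (Σ k : Fin r, {c : ℕ × ℕ // c ∈ lam.comp k}))

theorem card_node : Fintype.card lam.Node = n := by
  letI (k : Fin r) : Fintype {c : ℕ × ℕ // c ∈ lam.comp k} :=
    Fintype.subtype (lam.comp k).cells fun _ ↦ Iff.rfl
  refine Eq.trans ?_ lam.sum_card
  refine (Fintype.card_congr (Equiv.refl lam.Node)).trans (Fintype.card_sigma.trans ?_)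
  refine Finset.sum_congr rfl fun k _ ↦ ?_
  exact Fintype.card_of_subtype (lam.comp k).cells fun _ ↦ Iff.rfl

/-- A `λ`-multitableau: a bijection from `{1, …, n}` to the nodes. The entry of `t` at the node `x`
is `t.symm x`. -/
abbrev Tab : Type := Fin n ≃ lam.Node

/-- The multitableau `t^λ`, with the entries in order along the rows of the first component, then
along the rows of the second component, and so on. -/
def initial : lam.Tab :=
  letI : LinearOrder lam.Node := LinearOrder.lift' lam.key lam.key_injective
  (Fintype.orderIsoFinOfCardEq lam.Node lam.card_node).toEquiv

/-- Standard multitableaux: the entries increase along rows and down columns. -/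
def IsStd (t : lam.Tab) : Prop :=
  ∀ x y : lam.Node, x.1 = y.1 →
    (x.2.1.1 = y.2.1.1 → x.2.1.2 < y.2.1.2 → t.symm x < t.symm y) ∧
    (x.2.1.2 = y.2.1.2 → x.2.1.1 < y.2.1.1 → t.symm x < t.symm y)

/-- Multitableaux of the initial kind: every number has the same position (component number) as in
`t^λ`. -/
def IsInitialKind (t : lam.Tab) : Prop := ∀ j, (t j).1 = (lam.initial j).1

/-- The smallest entry of the `k`-th component of `t`. -/
def minEntry (t : lam.Tab) (k : Fin r) : ℕ := sInf {m | ∃ x : lam.Node, x.1 = k ∧ (t.symm x : ℕ) = m}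

/-- Increasing multitableaux: components of equal shape are ordered by their smallest entries. -/
def IsIncreasing (t : lam.Tab) : Prop :=
  ∀ i j, lam.comp i = lam.comp j → (i < j ↔ lam.minEntry t i < lam.minEntry t j)

/-- The permutation `d(t)` with `t = t^λ d(t)`: it maps the entry of `t^λ` at a node to the entry of
`t` at the same node. -/
def dPerm (t : lam.Tab) : Equiv.Perm (Fin n) := lam.initial.trans t.symm

open Classical in
/-- The Young subgroup `𝔖_λ`, the row stabilizer of `t^λ`. -/
def youngSubgroup : Finset (Equiv.Perm (Fin n)) :=
  {w | ∀ i, (lam.initial (w i)).1 = (lam.initial i).1 ∧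
    (lam.initial (w i)).2.1.1 = (lam.initial i).2.1.1}

open Classical in
/-- The set partition `A_λ`, whose blocks are the sets of entries of the non-empty components
of `t^λ`. -/
def setPartition : SetPartition n :=
  Finpartition.ofSetoid (Setoid.ker fun i ↦ (lam.initial i).1)

/-- The element `y_λ = ∑_{w ∈ 𝔖_λ} (-q)^{-ℓ(w)} g_w`. -/
def yElt : BT n := ∑ w ∈ lam.youngSubgroup, (-qInv) ^ len w • gPerm w

theorem comp_adjSwap {i : Fin (r - 1)} (h : lam.comp (lo i) = lam.comp (hi i)) (k : Fin r) :
    lam.comp (adjSwap i k) = lam.comp k := by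
  unfold adjSwap
  rcases eq_or_ne k (lo i) with rfl | h1
  · rw [Equiv.swap_apply_left, h]
  rcases eq_or_ne k (hi i) with rfl | h2
  · rw [Equiv.swap_apply_right, h]
  rw [Equiv.swap_apply_of_ne_of_ne h1 h2]

/-- Interchange of the (equal) components `i` and `i + 1` of the Young diagram. -/
def nodeSwap {i : Fin (r - 1)} (h : lam.comp (lo i) = lam.comp (hi i)) : Equiv.Perm lam.Node where
  toFun x := ⟨adjSwap i x.1, x.2.1, by rw [lam.comp_adjSwap h]; exact x.2.2⟩
  invFun x := ⟨adjSwap i x.1, x.2.1, by rw [lam.comp_adjSwap h]; exact x.2.2⟩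
  left_inv x := by
    apply lam.key_injective
    simp [key, adjSwap]
  right_inv x := by
    apply lam.key_injective
    simp [key, adjSwap]

/-- The permutation `B_i` of minimal length that interchanges the consecutive blocks `I_i` and
`I_{i + 1}` of `A_λ`, when the components `i` and `i + 1` of `λ` are equal: it maps the `j`-th
element of either block to the `j`-th element of the other one, and fixes all other points. -/
def blockSwap {i : Fin (r - 1)} (h : lam.comp (lo i) = lam.comp (hi i)) : Equiv.Perm (Fin n) :=
  lam.initial.trans ((lam.nodeSwap h).trans lam.initial.symm)

open Classical in
/-- The element `𝔹_i = 𝔼_λ g_{B_i}`, when the components `i` and `i + 1` of `λ` are equal. -/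
def bGen (i : Fin (r - 1)) : BT n :=
  if h : lam.comp (lo i) = lam.comp (hi i) then
    idem lam.setPartition * gPerm (lam.blockSwap h) else 1

/-- The element `𝔹_w`, the image of `w` under the embedding of the group algebra of
`𝔖_{m_1} × ⋯ × 𝔖_{m_s} ≤ 𝔖_r` that maps the simple transposition `(i, i + 1)`
to `𝔹_i`. -/
def bPerm (w : Equiv.Perm (Fin r)) : BT n :=
  idem lam.setPartition * ((reducedWord w).map lam.bGen).prod

open Classical in
/-- The list `λ^{(i_1)}, …, λ^{(i_s)}` of the distinct components of `λ`; if `λ` is increasing, then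
they are listed in increasing order. -/
def shapes : List YoungDiagram := (List.ofFn lam.comp).dedup

open Classical in
/-- The multiplicity `m_j` of the `j`-th distinct component among the components of `λ`. -/
def mult (j : Fin lam.shapes.length) : ℕ := (List.ofFn lam.comp).count (lam.shapes.get j)

end Multipartition

/-! ### The labels `Λ`, their tableaux and the elements `n_{𝔰𝔱}` -/

/-- The dominance order on partitions of the same number. -/
def Dominates (nu mu : YoungDiagram) : Prop :=
  mu.card = nu.card ∧ ∀ k, ∑ i ∈ Finset.range k, mu.rowLen i ≤ ∑ i ∈ Finset.range k, nu.rowLen i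

/-- A total order on the set of all partitions that extends the dominance order. -/
structure IsDominanceExtension (le : YoungDiagram → YoungDiagram → Prop) : Prop where
  linear : IsLinearOrder YoungDiagram le
  extends_dominance : ∀ mu nu, Dominates nu mu → le mu nu

/-- The set `𝓛_n(α)` of pairs `Λ = (λ ∣ μ)`. Here `λ` is an increasing `r`-multipartition of `n` of
type `α`, where `r` is the length of `α`, and, if `λ` has `s` distinct components, with
multiplicities `m_1, …, m_s`, then `μ` is an `s`-multipartition of `r` with `μ^{(j)}` a partition
of `m_j`. -/
@[ext]
structure Label (le : YoungDiagram → YoungDiagram → Prop) {n : ℕ} (α : n.Partition) where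
  /-- The multipartition `λ`. -/
  lam : Multipartition α.parts.card n
  type_eq : blockSizes lam.setPartition = α.parts
  increasing : ∀ i j, i ≤ j → le (lam.comp i) (lam.comp j)
  /-- The multipartition `μ`. -/
  mu : Multipartition lam.shapes.length α.parts.card
  card_mu : ∀ j, (mu.comp j).card = lam.mult j

namespace Label

variable {le : YoungDiagram → YoungDiagram → Prop} {n : ℕ} {α : n.Partition} (L : Label le α)

/-- The pairs whose components `λ^{(k)}` all have at most `N` columns. -/
def ColumnsLE (N : ℕ) : Prop := ∀ k, (L.lam.comp k).rowLen 0 ≤ N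

/-- The set `Std(Λ)` of standard `Λ`-tableaux `𝔱 = (t ∣ u)`. -/
@[ext]
structure StdTab where
  /-- The first ingredient, a `λ`-multitableau. -/
  t : L.lam.Tab
  t_std : L.lam.IsStd t
  t_increasing : L.lam.IsIncreasing t
  /-- The second ingredient, a `μ`-multitableau. -/
  u : L.mu.Tab
  u_std : L.mu.IsStd u
  u_initial : L.mu.IsInitialKind u

/-- The element `c_μ = ∑_{w ∈ 𝔖_μ} (-1)^{ℓ(w)} 𝔹_w`. -/
def cElt : BT n := ∑ w ∈ L.mu.youngSubgroup, (-1 : ℤ) ^ len w • L.lam.bPerm w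

/-- The element
`n_{𝔰𝔱} = g_{d(s)}^* 𝔼_λ y_λ 𝔹_{d(u)}^* c_μ 𝔹_{d(v)} g_{d(t)}`, where
`𝔰 = (s ∣ u)` and `𝔱 = (t ∣ v)`. -/
def nElt (s t : L.StdTab) : BT n :=
  star (gPerm (L.lam.dPerm s.t)) * idem L.lam.setPartition * L.lam.yElt *
    star (L.lam.bPerm (L.mu.dPerm s.u)) * L.cElt * L.lam.bPerm (L.mu.dPerm t.u) *
    gPerm (L.lam.dPerm t.t)

end Label

/-- The triples `(Λ, 𝔰, 𝔱)` with `Λ ∈ 𝓛_{n, ≤ N}(α)` and `𝔰, 𝔱 ∈ Std(Λ)`. -/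
abbrev BasisIndex (le : YoungDiagram → YoungDiagram → Prop) {n : ℕ} (α : n.Partition) (N : ℕ) :
    Type :=
  Σ L : {L : Label le α // L.ColumnsLE N}, L.1.StdTab × L.1.StdTab

/-- The element `n_{𝔰𝔱}` for a triple `(Λ, 𝔰, 𝔱)`. -/
def BasisIndex.elt {le : YoungDiagram → YoungDiagram → Prop} {n : ℕ} {α : n.Partition} {N : ℕ}
    (x : BasisIndex le α N) : BT n := x.1.1.nElt x.2.1 x.2.2


/-! ### Tensor space -/

section TensorSpace

variable (R : Type*) [CommRing R] [Algebra GroundRing R] (N r n : ℕ)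

/-- The free `R`-module `V` with basis `v_i^s`, where `1 ≤ i ≤ N` and `1 ≤ s ≤ r`. The basis is
indexed by the pairs `(i, s)`. -/
abbrev VSpace : Type _ := (Fin N × Fin r) →₀ R

/-- The tensor power `V^{⊗ n}`. -/
abbrev VTensor : Type _ := PiTensorProduct R fun _ : Fin n ↦ VSpace R N r

/-- The basis of `V^{⊗ n}` consisting of the `v_{i_1}^{s_1} ⊗ ⋯ ⊗ v_{i_n}^{s_n}`. -/
def vBasis : Module.Basis (Fin n → Fin N × Fin r) R (VTensor R N r n) :=
  Basis.piTensorProduct fun _ : Fin n ↦ Finsupp.basisSingleOne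

theorem vBasis_apply (f : Fin n → Fin N × Fin r) :
    vBasis R N r n f = PiTensorProduct.tprod R fun i ↦ Finsupp.single (f i) (1 : R) := by
  simp [vBasis]

/-- The image in `R` of the parameter `q`. -/
def qR : R := algebraMap GroundRing R qVar

/-- The image in `R` of `q⁻¹`. -/
def qInvR : R := algebraMap GroundRing R qInv

theorem qR_mul_qInvR : qR R * qInvR R = 1 := by
  rw [qR, qInvR, ← map_mul, qVar_mul_qInv, map_one]

variable {N r n}

/-- The operator `𝐄_k`: it maps a basis tensor to itself or to zero, according to whether the upper
indices in the tensor factors `k` and `k + 1` agree or not. -/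
def opE (k : Fin (n - 1)) : Module.End R (VTensor R N r n) :=
  (vBasis R N r n).constr R fun f ↦
    if (f (lo k)).2 = (f (hi k)).2 then vBasis R N r n f else 0

/-- The operator `𝐆_k`, given by `v_i^s ⊗ v_j^t ↦ v_j^t ⊗ v_i^s` if `s ≠ t`, by
`v_i^s ⊗ v_i^s ↦ q v_i^s ⊗ v_i^s`, by `v_i^s ⊗ v_j^s ↦ v_j^s ⊗ v_i^s` if `i < j`, and by
`v_i^s ⊗ v_j^s ↦ (q - q⁻¹) v_i^s ⊗ v_j^s + v_j^s ⊗ v_i^s` if `i > j`, in the tensor factors `k`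
and `k + 1`. -/
def opG (k : Fin (n - 1)) : Module.End R (VTensor R N r n) :=
  (vBasis R N r n).constr R fun f ↦
    if (f (lo k)).2 ≠ (f (hi k)).2 then vBasis R N r n (f ∘ adjSwap k)
    else if (f (lo k)).1 = (f (hi k)).1 then qR R • vBasis R N r n f
    else if (f (lo k)).1 < (f (hi k)).1 then vBasis R N r n (f ∘ adjSwap k)
    else (qR R - qInvR R) • vBasis R N r n f + vBasis R N r n (f ∘ adjSwap k)

theorem opE_basis (k : Fin (n - 1)) (f : Fin n → Fin N × Fin r) :
    opE R k (vBasis R N r n f) =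
      if (f (lo k)).2 = (f (hi k)).2 then vBasis R N r n f else 0 :=
  Module.Basis.constr_basis _ _ _ _

theorem opG_basis (k : Fin (n - 1)) (f : Fin n → Fin N × Fin r) :
    opG R k (vBasis R N r n f) =
    if (f (lo k)).2 ≠ (f (hi k)).2 then vBasis R N r n (f ∘ adjSwap k)
    else if (f (lo k)).1 = (f (hi k)).1 then qR R • vBasis R N r n f
    else if (f (lo k)).1 < (f (hi k)).1 then vBasis R N r n (f ∘ adjSwap k)
    else (qR R - qInvR R) • vBasis R N r n f + vBasis R N r n (f ∘ adjSwap k) :=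
  Module.Basis.constr_basis _ _ _ _

@[simp] theorem adjSwap_lo (k : Fin (n - 1)) : adjSwap k (lo k) = hi k := Equiv.swap_apply_left _ _

@[simp] theorem adjSwap_hi (k : Fin (n - 1)) : adjSwap k (hi k) = lo k := Equiv.swap_apply_right _ _

theorem adjSwap_of_ne {k : Fin (n - 1)} {x : Fin n} (h1 : x ≠ lo k) (h2 : x ≠ hi k) :
    adjSwap k x = x := Equiv.swap_apply_of_ne_of_ne h1 h2

theorem comp_adjSwap_twice {X : Type*} (f : Fin n → X) (k : Fin (n - 1)) :
    (f ∘ adjSwap k) ∘ adjSwap k = f := by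
  ext x; simp [adjSwap]

theorem comp_adjSwap_eq {X : Type*} {f : Fin n → X} {k : Fin (n - 1)}
    (h : f (lo k) = f (hi k)) : f ∘ adjSwap k = f := by
  ext x
  rcases eq_or_ne x (lo k) with rfl | h1
  · simp [h]
  rcases eq_or_ne x (hi k) with rfl | h2
  · simp [h]
  simp [adjSwap_of_ne h1 h2]

theorem opE_sq (k : Fin (n - 1)) : opE R k * opE R k = (opE R k : Module.End R (VTensor R N r n)) := by
  refine (vBasis R N r n).ext fun f ↦ ?_
  simp only [Module.End.mul_apply, opE_basis]
  split_ifs with h <;> simp [opE_basis, h]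

theorem opG_mul_opE (k : Fin (n - 1)) :
    opG R k * opE R k = (opE R k * opG R k : Module.End R (VTensor R N r n)) := by
  refine (vBasis R N r n).ext fun f ↦ ?_
  simp only [Module.End.mul_apply, opE_basis, opG_basis]
  by_cases h : (f (lo k)).2 = (f (hi k)).2
  · simp only [h]
    simp only [opG_basis, h, if_true]
    split_ifs <;> simp [opE_basis, h]  
  · simp [h, Ne.symm h, opE_basis, eq_comm]

theorem opG_sq (k : Fin (n - 1)) :
    opG R k * opG R k =
      (1 + (qR R - qInvR R) • (opE R k * opG R k) : Module.End R (VTensor R N r n)) := by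
  refine (vBasis R N r n).ext fun f ↦ ?_
  rw [← opG_mul_opE]
  have hq := qR_mul_qInvR R
  simp only [Module.End.mul_apply, opE_basis, opG_basis, LinearMap.add_apply, LinearMap.smul_apply,
    Module.End.one_apply]
  by_cases h : (f (lo k)).2 = (f (hi k)).2
  · rcases lt_trichotomy (f (lo k)).1 (f (hi k)).1 with h1 | h1 | h1
    · simp [h, h1, h1.ne, h1.ne', h1.not_gt, opG_basis, comp_adjSwap_twice]
      abel
    · have h2 : f (lo k) = f (hi k) := Prod.ext h1 h
      simp only [h2, opG_basis, map_smul, ne_eq, not_true_eq_false, if_false, if_true]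
      have h3 : qR R * qR R = 1 + (qR R - qInvR R) * qR R := by linear_combination hq
      rw [smul_smul, smul_smul, h3, add_smul, one_smul]
    · simp [h, h1, h1.ne, h1.ne', h1.not_gt, opG_basis, comp_adjSwap_twice]
      abel
  · simp [h, Ne.symm h, opG_basis, comp_adjSwap_twice]


theorem far_ne {i j : Fin (n - 1)} (h : Far i j) :
    lo i ≠ lo j ∧ lo i ≠ hi j ∧ hi i ≠ lo j ∧ hi i ≠ hi j := by
  simp only [Far] at h
  refine ⟨?_, ?_, ?_, ?_⟩ <;> simp only [lo, hi, ne_eq, Fin.mk.injEq] <;> omega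

theorem comp_adjSwap_far {X : Type*} (f : Fin n → X) {i j : Fin (n - 1)} (h : Far i j) :
    (f ∘ adjSwap i) ∘ adjSwap j = (f ∘ adjSwap j) ∘ adjSwap i := by
  obtain ⟨h1, h2, h3, h4⟩ := far_ne h
  have hd : (adjSwap i : Equiv.Perm (Fin n)).Disjoint (adjSwap j) := fun x ↦ by
    by_cases hx : x = lo i ∨ x = hi i
    · right
      rcases hx with rfl | rfl
      · exact adjSwap_of_ne h1 h2
      · exact adjSwap_of_ne h3 h4
    · left
      push Not at hx
      exact adjSwap_of_ne hx.1 hx.2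
  have := hd.commute.eq
  ext x
  exact congrArg f (DFunLike.congr_fun this x)

theorem opG_far {i j : Fin (n - 1)} (h : Far i j) :
    opG R i * opG R j = (opG R j * opG R i : Module.End R (VTensor R N r n)) := by
  refine (vBasis R N r n).ext fun f ↦ ?_
  obtain ⟨h1, h2, h3, h4⟩ := far_ne h
  have e1 := adjSwap_of_ne h1 h2
  have e2 := adjSwap_of_ne h3 h4
  have e3 := adjSwap_of_ne h1.symm h3.symm
  have e4 := adjSwap_of_ne h2.symm h4.symm
  have e5 := comp_adjSwap_far f h
  simp only [Module.End.mul_apply, opG_basis]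
  split_ifs <;> simp only [opG_basis, map_add, map_smul, Function.comp_apply, *, ne_eq,
    not_true_eq_false, not_false_eq_true, if_true, if_false] <;> module

theorem opG_opE_far {i j : Fin (n - 1)} (h : Far i j) :
    opG R i * opE R j = (opE R j * opG R i : Module.End R (VTensor R N r n)) := by
  refine (vBasis R N r n).ext fun f ↦ ?_
  obtain ⟨h1, h2, h3, h4⟩ := far_ne h
  have e3 := adjSwap_of_ne h1.symm h3.symm
  have e4 := adjSwap_of_ne h2.symm h4.symm
  simp only [Module.End.mul_apply, opG_basis, opE_basis]
  split_ifs <;> simp_all [opG_basis, opE_basis]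

theorem opE_comm (i j : Fin (n - 1)) :
    opE R i * opE R j = (opE R j * opE R i : Module.End R (VTensor R N r n)) := by
  refine (vBasis R N r n).ext fun f ↦ ?_
  simp only [Module.End.mul_apply, opE_basis]
  split_ifs <;> simp_all [opE_basis]

/-- Two adjacent generators involve three points `a`, `b`, `c`. -/
theorem adjacent_cases {i j : Fin (n - 1)} (h : Adjacent i j) :
    (lo j = hi i ∧ hi j ≠ lo i ∧ hi j ≠ hi i ∧ lo i ≠ hi i) ∨
    (lo i = hi j ∧ hi i ≠ lo j ∧ hi i ≠ hi j ∧ lo j ≠ hi j) := by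
  simp only [Adjacent] at h
  simp only [lo, hi, ne_eq, Fin.mk.injEq]
  omega

theorem comp_adjSwap_braid {X : Type*} (f : Fin n → X) {i j : Fin (n - 1)} (h : lo j = hi i)
    (h1 : hi j ≠ lo i) (h2 : hi j ≠ hi i) (h3 : lo i ≠ hi i) :
    ((f ∘ adjSwap i) ∘ adjSwap j) ∘ adjSwap i = ((f ∘ adjSwap j) ∘ adjSwap i) ∘ adjSwap j := by
  have : (adjSwap i * adjSwap j * adjSwap i : Equiv.Perm (Fin n)) =
      adjSwap j * adjSwap i * adjSwap j := by
    ext x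
    simp only [adjSwap, h, Equiv.Perm.mul_apply, Equiv.swap_apply_def]
    split_ifs <;> simp_all
  ext x
  exact congrArg f (DFunLike.congr_fun this x)

/-- The coefficient of `x ⊗ y` in `𝐆 (x ⊗ y)`. -/
def coefC (x y : Fin N × Fin r) : R :=
  if x.2 ≠ y.2 then 0 else if x.1 = y.1 then qR R else if x.1 < y.1 then 0 else qR R - qInvR R

/-- The coefficient of `y ⊗ x` in `𝐆 (x ⊗ y)`, when `x ≠ y`. -/
def coefD (x y : Fin N × Fin r) : R := if x = y then 0 else 1

theorem opG_basis' (k : Fin (n - 1)) (f : Fin n → Fin N × Fin r) :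
    opG R k (vBasis R N r n f) = coefC R (f (lo k)) (f (hi k)) • vBasis R N r n f +
      coefD R (f (lo k)) (f (hi k)) • vBasis R N r n (f ∘ adjSwap k) := by
  rw [opG_basis, coefC, coefD]
  split_ifs <;> simp_all [Prod.ext_iff]

theorem coefD_comm (x y : Fin N × Fin r) : coefD R x y = coefD R y x := by
  simp [coefD, eq_comm]

theorem coef_braid1 (x y w : Fin N × Fin r) :
    coefC R x y * coefC R x y * coefC R y w + coefD R x y * coefD R x y * coefC R x w =
    coefC R y w * coefC R y w * coefC R x y + coefD R y w * coefD R y w * coefC R x w := by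
  have hz : qR R * qR R = 1 + (qR R - qInvR R) * qR R := by linear_combination qR_mul_qInvR R
  obtain ⟨x1, x2⟩ := x
  obtain ⟨y1, y2⟩ := y
  obtain ⟨w1, w2⟩ := w
  simp only [coefC, coefD, Prod.mk.injEq]
  generalize qR R - qInvR R = z at *
  by_cases c1 : x2 = y2 <;> by_cases c2 : y2 = w2 <;> by_cases c3 : x2 = w2 <;>
  simp only [c1, c2, c3, ne_eq, not_true_eq_false, not_false_eq_true, if_true, if_false,
    and_true, and_false, mul_zero, zero_mul, mul_one] <;>
  split_ifs <;> first | (exfalso; order) | (exfalso; simp_all; done) | linear_combination z * hz | linear_combination (-z) * hz | ring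

set_option maxHeartbeats 1000000 in
theorem coef_braid2 (x y w : Fin N × Fin r) :
    coefD R x y * (coefC R x y * coefC R y w + coefC R x w * coefC R y x) =
    coefD R x y * (coefC R y w * coefC R x w) := by
  obtain ⟨x1, x2⟩ := x
  obtain ⟨y1, y2⟩ := y
  obtain ⟨w1, w2⟩ := w
  simp only [coefC, coefD, Prod.mk.injEq]
  generalize qR R - qInvR R = z at *
  by_cases c1 : x2 = y2 <;> by_cases c2 : y2 = w2 <;> by_cases c3 : x2 = w2 <;>
  simp only [c1, c2, c3, eq_comm, ne_eq, not_true_eq_false, not_false_eq_true, if_true, if_false,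
    and_true, and_false, mul_zero, zero_mul, mul_one] <;>
  (try split_ifs) <;> first | (exfalso; order) | (exfalso; simp_all; done) | ring

set_option maxHeartbeats 1000000 in
theorem coef_braid3 (x y w : Fin N × Fin r) :
    coefD R y w * (coefC R x y * coefC R x w) =
    coefD R y w * (coefC R y w * coefC R x y + coefC R x w * coefC R w y) := by
  obtain ⟨x1, x2⟩ := x
  obtain ⟨y1, y2⟩ := y
  obtain ⟨w1, w2⟩ := w
  simp only [coefC, coefD, Prod.mk.injEq]
  generalize qR R - qInvR R = z at *
  by_cases c1 : x2 = y2 <;> by_cases c2 : y2 = w2 <;> by_cases c3 : x2 = w2 <;>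
  simp only [c1, c2, c3, eq_comm, ne_eq, not_true_eq_false, not_false_eq_true, if_true, if_false,
    and_true, and_false, mul_zero, zero_mul, mul_one] <;>
  (try split_ifs) <;> first | (exfalso; order) | (exfalso; simp_all; done) | ring

theorem opG_braid' {i j : Fin (n - 1)} (h : lo j = hi i)
    (h1 : hi j ≠ lo i) (h2 : hi j ≠ hi i) (h3 : lo i ≠ hi i) :
    opG R i * opG R j * opG R i =
      (opG R j * opG R i * opG R j : Module.End R (VTensor R N r n)) := by
  refine (vBasis R N r n).ext fun f ↦ ?_
  have s1 : adjSwap i (hi j) = hi j := adjSwap_of_ne h1 h2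
  have s2 : adjSwap j (lo i) = lo i := adjSwap_of_ne (h ▸ h3) h1.symm
  have s3 : adjSwap j (hi i) = hi j := h ▸ adjSwap_lo j
  have s4 : adjSwap j (hi j) = hi i := h ▸ adjSwap_hi j
  have hb := comp_adjSwap_braid f h h1 h2 h3
  simp only [Module.End.mul_apply, opG_basis', h, map_add, map_smul, Function.comp_apply,
    adjSwap_lo, adjSwap_hi, s1, s2, s3, s4, comp_adjSwap_twice, hb]
  generalize f (lo i) = x
  generalize f (hi i) = y
  generalize f (hi j) = w
  have e1 := coef_braid1 R x y w
  have e2 := coef_braid2 R x y w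
  have e3 := coef_braid3 R x y w
  rw [coefD_comm R y x, coefD_comm R w y]
  letI : AddCommGroup (VTensor R N r n) := Module.addCommMonoidToAddCommGroup R
  linear_combination (norm := module) e1 • vBasis R N r n f + e2 • vBasis R N r n (f ∘ adjSwap i) +
    e3 • vBasis R N r n (f ∘ adjSwap j)


theorem opE_basis' (k : Fin (n - 1)) (f : Fin n → Fin N × Fin r) :
    opE R k (vBasis R N r n f) =
      (if (f (lo k)).2 = (f (hi k)).2 then (1 : R) else 0) • vBasis R N r n f := by
  rw [opE_basis, ite_smul, one_smul, zero_smul]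

theorem coefC_ne {x y : Fin N × Fin r} (h : x.2 ≠ y.2) : coefC R x y = 0 := if_pos h

/-- The relations between adjacent generators that involve ties. -/
theorem opE_opG_adj' {i j : Fin (n - 1)} (h : lo j = hi i)
    (h1 : hi j ≠ lo i) (h2 : hi j ≠ hi i) (h3 : lo i ≠ hi i) :
    (opG R i * opG R j * opE R i =
      (opE R j * opG R i * opG R j : Module.End R (VTensor R N r n)) ∧
    opG R j * opE R j * opE R i =
      (opE R i * opG R j * opE R i : Module.End R (VTensor R N r n)) ∧
    opE R i * opG R j * opE R i =
      (opE R j * opE R i * opG R j : Module.End R (VTensor R N r n))) ∧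
    (opG R j * opG R i * opE R j =
      (opE R i * opG R j * opG R i : Module.End R (VTensor R N r n)) ∧
    opG R i * opE R i * opE R j =
      (opE R j * opG R i * opE R j : Module.End R (VTensor R N r n)) ∧
    opE R j * opG R i * opE R j =
      (opE R i * opE R j * opG R i : Module.End R (VTensor R N r n))) := by
  refine ⟨⟨(vBasis R N r n).ext fun f ↦ ?_, (vBasis R N r n).ext fun f ↦ ?_,
    (vBasis R N r n).ext fun f ↦ ?_⟩, (vBasis R N r n).ext fun f ↦ ?_,
    (vBasis R N r n).ext fun f ↦ ?_, (vBasis R N r n).ext fun f ↦ ?_⟩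
  all_goals
    have s1 : adjSwap i (hi j) = hi j := adjSwap_of_ne h1 h2
    have s2 : adjSwap j (lo i) = lo i := adjSwap_of_ne (h ▸ h3) h1.symm
    have s3 : adjSwap j (hi i) = hi j := h ▸ adjSwap_lo j
    have s4 : adjSwap j (hi j) = hi i := h ▸ adjSwap_hi j
    have a1 := adjSwap_lo i
    have a2 := adjSwap_hi i
    simp only [Module.End.mul_apply, opE_basis', opG_basis', h, map_add, map_smul,
      Function.comp_apply, a1, a2, s1, s2, s3, s4]
    by_cases c1 : (f (lo i)).2 = (f (hi i)).2
    · by_cases c2 : (f (hi i)).2 = (f (hi j)).2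
      · have c3 := c1.trans c2
        simp [c1, c2, c3]
      · have c3 : (f (lo i)).2 ≠ (f (hi j)).2 := fun h ↦ c2 (c1.symm.trans h)
        simp [c1, c2, c3, Ne.symm c2, Ne.symm c3, coefC_ne]
    · by_cases c2 : (f (hi i)).2 = (f (hi j)).2
      · have c3 : (f (lo i)).2 ≠ (f (hi j)).2 := fun h ↦ c1 (h.trans c2.symm)
        simp [c1, c2, c3, Ne.symm c1, Ne.symm c3, coefC_ne]
      · by_cases c3 : (f (lo i)).2 = (f (hi j)).2
        · simp [c1, c2, c3, Ne.symm c1, Ne.symm c2, coefC_ne]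
        · simp [c1, c2, c3, Ne.symm c1, Ne.symm c2, Ne.symm c3, coefC_ne]

variable (N r n)

/-- The right action of `𝓔_n(q)` on `V^{⊗ n}` given by `e_i ↦ 𝐄_i` and `g_i ↦ 𝐆_i`, as an algebra
homomorphism to the opposite of the endomorphism ring. -/
def tensorRep : BT n →ₐ[GroundRing] (Module.End R (VTensor R N r n))ᵐᵒᵖ :=
  liftBT
    (FreeAlgebra.lift GroundRing (Sum.elim (fun i ↦ MulOpposite.op (opG R i))
      (fun i ↦ MulOpposite.op (opE R i)))) (by
      have hadj : ∀ {i j : Fin (n - 1)}, Adjacent i j →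
          opG R i * opG R j * opG R i =
            (opG R j * opG R i * opG R j : Module.End R (VTensor R N r n)) ∧
          opG R i * opG R j * opE R i =
            (opE R j * opG R i * opG R j : Module.End R (VTensor R N r n)) ∧
          opG R j * opE R j * opE R i =
            (opE R i * opG R j * opE R i : Module.End R (VTensor R N r n)) ∧
          opE R i * opG R j * opE R i =
            (opE R j * opE R i * opG R j : Module.End R (VTensor R N r n)) := by
        intro i j h
        obtain ⟨h, h1, h2, h3⟩ | ⟨h, h1, h2, h3⟩ := adjacent_cases h
        · exact ⟨opG_braid' R h h1 h2 h3, (opE_opG_adj' R h h1 h2 h3).1⟩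
        · exact ⟨(opG_braid' R h h1 h2 h3).symm, (opE_opG_adj' R h h1 h2 h3).2⟩
      intro x y h
      apply MulOpposite.unop_injective
      induction h with
      | gg_far i j h => simpa [fg, fe] using (opG_far R h).symm
      | ge i => simpa [fg, fe] using (opG_mul_opE R i).symm
      | braid i j h => simpa [fg, fe, mul_assoc] using (hadj h).1
      | egg i j h => simpa [fg, fe, mul_assoc] using (hadj h).2.1
      | eeg i j h => simpa [fg, fe, mul_assoc] using (hadj h).2.2.1
      | ege i j h => simpa [fg, fe, mul_assoc] using (hadj h).2.2.2
      | ee i j => simpa [fg, fe] using opE_comm R j i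
      | ge_far i j h => simpa [fg, fe] using (opG_opE_far R h).symm
      | e_sq i => simpa [fg, fe] using opE_sq R i
      | g_sq i =>
        have h1 := opG_sq (R := R) (N := N) (r := r) i
        have h2 : (qVar - qInv) • (opE R i * opG R i : Module.End R (VTensor R N r n)) =
            (qR R - qInvR R) • (opE R i * opG R i) := by
          rw [qR, qInvR, ← map_sub, algebraMap_smul]
        simpa [fg, fe, opG_mul_opE, h2] using h1)


/-- The operator `v ↦ v · x`, as a linear function of `x`. -/
def actLin : BT n →ₗ[GroundRing] Module.End R (VTensor R N r n) :=
  (MulOpposite.opLinearEquiv GroundRing).symm.toLinearMap ∘ₗ (tensorRep R N r n).toLinearMap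

end TensorSpace

/-! ### The quotient algebras -/

section Quotient

variable {n : ℕ} (α : n.Partition) (N : ℕ)

/-- The submodule `𝔼_α V^{⊗ n}` of `V^{⊗ n}`, where the upper indices of the basis vectors of `V`
run from `1` to the length of `α`. -/
def typeSpace (R : Type*) [CommRing R] [Algebra GroundRing R] :
    Submodule R (VTensor R N α.parts.card n) :=
  LinearMap.range (actLin R N α.parts.card n (idemType α))

/-- The annihilator `𝓘` of `𝔼_α V^{⊗ n}` in `𝓔_n^α(q)`. -/
def annIdeal : Submodule GroundRing (BTType α) where
  carrier := {x | ∀ v ∈ typeSpace α N GroundRing, actLin GroundRing N α.parts.card n x v = 0}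
  add_mem' hx hy v hv := by simp [hx v hv, hy v hv]
  zero_mem' v hv := by simp
  smul_mem' c x hx v hv := by simp [hx v hv]

/-- The quotient `𝓔𝓣𝓛_{n, N}^α(q) = 𝓔_n^α(q) / 𝓘`. -/
abbrev ETL : Type := BTType α ⧸ annIdeal α N

variable (K : Type*) [CommRing K] [Algebra GroundRing K]

/-- The specialization `𝓔_n^{K, α}(q) = K ⊗_S 𝓔_n^α(q)`. -/
abbrev BTTypeK : Type _ := K ⊗[GroundRing] BTType α

/-- The right action of `𝓔_n^{K, α}(q)` on the tensor power `V^{⊗ n}` over `K`. -/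
def actK : BTTypeK α K →ₗ[K] Module.End K (VTensor K N α.parts.card n) :=
  ((actLin K N α.parts.card n) ∘ₗ (BTType α).toSubmodule.subtype).liftBaseChange K

/-- The annihilator of `𝔼_α V^{⊗ n}` in `𝓔_n^{K, α}(q)`. -/
def annIdealK : Submodule K (BTTypeK α K) where
  carrier := {x | ∀ v ∈ typeSpace α N K, actK α N K x v = 0}
  add_mem' hx hy v hv := by simp [hx v hv, hy v hv]
  zero_mem' v hv := by simp
  smul_mem' c x hx v hv := by simp [hx v hv]

/-- The quotient `𝓔𝓣𝓛_{n, N}^{K, α}(q)` of `𝓔_n^{K, α}(q)` by the annihilator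
of `𝔼_α V^{⊗ n}`. -/
abbrev ETLK : Type _ := BTTypeK α K ⧸ annIdealK α N K

end Quotient

end BraidsTies

namespace BraidsTies

/-! ### Inversions and reduced words -/

section Coxeter

variable {n : ℕ}

/-- The number of inversions of a permutation. -/
def inv (w : Equiv.Perm (Fin n)) : ℕ :=
  (Finset.univ.filter fun p : Fin n × Fin n ↦ p.1 < p.2 ∧ w p.2 < w p.1).card

theorem lo_lt_hi (i : Fin (n - 1)) : lo i < hi i := Nat.lt_succ_self i

theorem adjSwap_lt {i : Fin (n - 1)} {x y : Fin n} (h : x < y) (hne : ¬(x = lo i ∧ y = hi i)) :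
    adjSwap i x < adjSwap i y := by
  simp only [adjSwap, Equiv.swap_apply_def]
  split_ifs <;> simp only [lo, hi, Fin.lt_def, Fin.ext_iff] at * <;> omega

@[simp] theorem adjSwap_adjSwap (i : Fin (n - 1)) (x : Fin n) : adjSwap i (adjSwap i x) = x := by
  simp [adjSwap]

@[simp] theorem adjSwap_trans_self (i : Fin (n - 1)) (w : Equiv.Perm (Fin n)) :
    (adjSwap i).trans ((adjSwap i).trans w) = w := by
  ext x; simp

@[simp] theorem adjSwap_symm (i : Fin (n - 1)) : (adjSwap i).symm = adjSwap i := by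
  simp [adjSwap]

/-- Applying `s_i` to both entries carries the inversions of `w` to inversions of `s_i w`, because
`s_i` reverses the order of the pair `(i, i + 1)` only; that pair is the one new inversion. -/
theorem inv_adjSwap_trans {i : Fin (n - 1)} {w : Equiv.Perm (Fin n)} (h : w (lo i) < w (hi i)) :
    inv ((adjSwap i).trans w) = inv w + 1 := by
  classical
  have h0 : (Finset.univ.filter fun p : Fin n × Fin n ↦
        p.1 < p.2 ∧ ((adjSwap i).trans w) p.2 < ((adjSwap i).trans w) p.1) =
      insert (lo i, hi i) ((Finset.univ.filter fun p : Fin n × Fin n ↦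
        p.1 < p.2 ∧ w p.2 < w p.1).map
        ((adjSwap i).prodCongr (adjSwap i)).toEmbedding) := by
    ext ⟨x, y⟩
    simp only [Finset.mem_insert, Finset.mem_map, Finset.mem_filter_univ, Prod.exists]
    simp only [Equiv.trans_apply, Prod.mk.injEq, Equiv.coe_toEmbedding,
      Equiv.prodCongr_apply, Prod.map_apply]
    constructor
    · rintro ⟨h1, h2⟩
      by_cases hc : x = lo i ∧ y = hi i
      · exact Or.inl hc
      · exact Or.inr ⟨_, _, ⟨adjSwap_lt h1 hc, h2⟩, by simp, by simp⟩
    · rintro (⟨rfl, rfl⟩ | ⟨a, b, ⟨h1, h2⟩, rfl, rfl⟩)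
      · exact ⟨lo_lt_hi i, by simpa using h⟩
      · refine ⟨adjSwap_lt h1 ?_, by simpa using h2⟩
        rintro ⟨rfl, rfl⟩
        exact absurd h2 h.not_gt
  rw [inv, h0, Finset.card_insert_of_notMem, Finset.card_map, inv]
  simp only [Finset.mem_map, Finset.mem_filter, Finset.mem_univ, true_and, Prod.exists,
    Equiv.coe_toEmbedding, Equiv.prodCongr_apply, Prod.map_apply, Prod.mk.injEq, not_exists,
    not_and]
  intro a b h1 h2 h3
  have ha : a = hi i := by rw [← adjSwap_adjSwap i a, h2, adjSwap_lo]
  have hb : b = lo i := by rw [← adjSwap_adjSwap i b, h3, adjSwap_hi]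
  rw [ha, hb] at h1
  exact absurd h1.1 (lo_lt_hi i).not_gt

theorem inv_adjSwap_trans' {i : Fin (n - 1)} {w : Equiv.Perm (Fin n)} (h : w (hi i) < w (lo i)) :
    inv ((adjSwap i).trans w) + 1 = inv w := by
  rw [← inv_adjSwap_trans (i := i) (w := (adjSwap i).trans w) (by simpa using h)]
  simp

theorem apply_lo_ne_hi (w : Equiv.Perm (Fin n)) (i : Fin (n - 1)) : w (lo i) ≠ w (hi i) :=
  fun h ↦ (lo_lt_hi i).ne (w.injective h)

@[simp] theorem inv_refl : inv (Equiv.refl (Fin n)) = 0 := by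
  simp only [inv, Finset.card_eq_zero, Finset.filter_eq_empty_iff]
  intro x _ h
  exact absurd h.1 h.2.not_gt

theorem inv_wordPerm_le (l : List (Fin (n - 1))) : inv (wordPerm l) ≤ l.length := by
  induction l with
  | nil => simp [wordPerm]
  | cons i l ih =>
    rcases lt_or_gt_of_ne (apply_lo_ne_hi (wordPerm l) i) with h | h
    · simp only [wordPerm, inv_adjSwap_trans h, List.length_cons]; omega
    · have := inv_adjSwap_trans' h
      simp only [wordPerm, List.length_cons]; omega

theorem exists_descent {w : Equiv.Perm (Fin n)} (h : w ≠ Equiv.refl _) :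
    ∃ i, w (hi i) < w (lo i) := by
  by_contra! hc
  apply h
  cases n with
  | zero => exact Subsingleton.elim _ _
  | succ m =>
    have : Monotone w := Fin.monotone_iff_le_succ.2 fun i ↦ hc i
    exact (Equiv.Perm.monotone_iff w).1 this

theorem exists_word_inv (w : Equiv.Perm (Fin n)) :
    ∃ l, wordPerm l = w ∧ l.length = inv w := by
  induction h : inv w generalizing w with
  | zero =>
    refine ⟨[], ?_, rfl⟩
    by_contra hc
    obtain ⟨i, hi⟩ := exists_descent (w := w) (fun h ↦ hc (by simp [wordPerm, h]))
    have := inv_adjSwap_trans' hi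
    omega
  | succ k ih =>
    obtain ⟨i, hi⟩ := exists_descent (w := w) (by rintro rfl; simp at h)
    have := inv_adjSwap_trans' hi
    obtain ⟨l, hl, hk⟩ := ih ((adjSwap i).trans w) (by omega)
    exact ⟨i :: l, by simp [wordPerm, hl], by simp [hk]⟩

theorem wordPerm_reducedWord (w : Equiv.Perm (Fin n)) : wordPerm (reducedWord w) = w :=
  (exists_reducedWord w).choose_spec.1

theorem len_eq_inv (w : Equiv.Perm (Fin n)) : len w = inv w := by
  apply le_antisymm
  · obtain ⟨l, hl, hk⟩ := exists_word_inv w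
    exact hk ▸ (exists_reducedWord w).choose_spec.2 l hl
  · conv_lhs => rw [← wordPerm_reducedWord w]
    exact inv_wordPerm_le _

/-- A word of minimal length. -/
def IsReduced (l : List (Fin (n - 1))) : Prop := inv (wordPerm l) = l.length

theorem isReduced_reducedWord (w : Equiv.Perm (Fin n)) : IsReduced (reducedWord w) := by
  rw [IsReduced, wordPerm_reducedWord, ← len_eq_inv, len]

theorem IsReduced.of_cons {i : Fin (n - 1)} {l : List (Fin (n - 1))} (h : IsReduced (i :: l)) :
    IsReduced l ∧ wordPerm l (lo i) < wordPerm l (hi i) := by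
  have h1 := inv_wordPerm_le l
  simp only [IsReduced, wordPerm, List.length_cons] at h ⊢
  rcases lt_or_gt_of_ne (apply_lo_ne_hi (wordPerm l) i) with h2 | h2
  · rw [inv_adjSwap_trans h2] at h
    exact ⟨by omega, h2⟩
  · have := inv_adjSwap_trans' h2
    omega

/-- Matsumoto's theorem for the symmetric group. -/
theorem prod_eq_of_isReduced {M : Type*} [Monoid M] (a : Fin (n - 1) → M)
    (hfar : ∀ i j, Far i j → a i * a j = a j * a i)
    (hbraid : ∀ i j, Adjacent i j → a i * a j * a i = a j * a i * a j)
    {l l' : List (Fin (n - 1))} (hl : IsReduced l) (hl' : IsReduced l')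
    (h : wordPerm l = wordPerm l') : (l.map a).prod = (l'.map a).prod := by
  induction hk : l.length generalizing l l' with
  | zero =>
    have h1 : l = [] := List.length_eq_zero_iff.1 hk
    have h2 : l'.length = 0 := by rw [← hl', ← h, hl, hk]
    rw [h1, List.length_eq_zero_iff.1 h2]
  | succ k ih =>
    have hk' : l'.length = k + 1 := by rw [← hl', ← h, hl, hk]
    obtain _ | ⟨i, t⟩ := l
    · simp at hk
    obtain _ | ⟨j, t'⟩ := l'
    · simp at hk'
    have hd : ∀ {i : Fin (n - 1)} {t}, IsReduced (i :: t) → 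
        wordPerm (i :: t) (hi i) < wordPerm (i :: t) (lo i) := fun h ↦ by
      simpa [wordPerm] using h.of_cons.2
    have di := hd hl
    have dj := hd hl'
    rw [← h] at dj
    have hlen : inv (wordPerm (i :: t)) = k + 1 := by rw [hl, hk]
    simp only [List.length_cons, Nat.add_right_cancel_iff] at hk hk'
    -- The induction hypothesis for the tails settles words with the same first letter. So each
    -- given word may be exchanged for any reduced word that starts in the same way.
    have key : ∀ {i : Fin (n - 1)} {t m : List (Fin (n - 1))}, t.length = k →
        IsReduced (i :: t) → wordPerm (i :: t) = wordPerm (i :: m) → m.length = k →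
        ((i :: t).map a).prod = ((i :: m).map a).prod := fun {i t m} h0 h1 h2 h3 ↦ by
      have h4 : wordPerm t = wordPerm m := by
        have := congrArg (fun w ↦ (adjSwap i).trans w) h2
        simpa [wordPerm] using this
      have h5 : IsReduced m := by
        rw [IsReduced, ← h4, h1.of_cons.1, h0, h3]
      simp [ih h1.of_cons.1 h5 h4 h0]
    by_cases hij : i = j
    · subst hij
      exact key hk hl h hk'
    set w := wordPerm (i :: t) with hw
    by_cases hf : Far i j
    -- Both letters are descents of `w` and they commute, so `w = s_i s_j m` with `m` shorter by
    -- two; the given words are exchanged for `i j m` and `j i m`.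
    · obtain ⟨h1, h2, h3, h4⟩ := far_ne hf
      have e1 := inv_adjSwap_trans' di
      have e2 : inv ((adjSwap j).trans ((adjSwap i).trans w)) + 1 = _ := inv_adjSwap_trans' (by
        simpa [adjSwap_of_ne h1.symm h3.symm, adjSwap_of_ne h2.symm h4.symm] using dj)
      obtain ⟨m, hm, hmk⟩ := exists_word_inv ((adjSwap j).trans ((adjSwap i).trans w))
      have hc : (adjSwap j).trans (adjSwap i) = (adjSwap i).trans (adjSwap j) := by
        ext x
        exact congrArg Fin.val (congrFun (comp_adjSwap_far (fun x ↦ x) hf) x)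
      rw [key (m := j :: m) hk hl (by simp [wordPerm, hm]; simp [hw, wordPerm])
        (by simp only [List.length_cons]; omega),
        key (m := i :: m) hk' hl' (by
          rw [← h]; simp only [wordPerm, hm]
          rw [← Equiv.trans_assoc (adjSwap j) (adjSwap i), hc, Equiv.trans_assoc]; simp)
        (by simp only [List.length_cons]; omega)]
      simp only [List.map_cons, List.prod_cons]
      rw [← mul_assoc, hfar i j hf, mul_assoc]
    · have had : Adjacent i j := by
        simp only [Far, Adjacent] at hf ⊢
        have : (i : ℕ) ≠ j := fun h ↦ hij (Fin.ext h)
        omega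
      -- For adjacent letters the two descents force `w = s_i s_j s_i m = s_j s_i s_j m`, and the
      -- braid relation joins these words. Here `j` is the right neighbour of `i`; the other case is
      -- symmetric.
      have main : ∀ {i j : Fin (n - 1)} {t t' : List (Fin (n - 1))}, t.length = k →
          IsReduced (i :: t) → t'.length = k → IsReduced (j :: t') →
          wordPerm (i :: t) = wordPerm (j :: t') →
          wordPerm (i :: t) (hi i) < wordPerm (i :: t) (lo i) →
          wordPerm (i :: t) (hi j) < wordPerm (i :: t) (lo j) →
          inv (wordPerm (i :: t)) = k + 1 → Adjacent i j →
          (lo j = hi i ∧ hi j ≠ lo i ∧ hi j ≠ hi i ∧ lo i ≠ hi i) →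
          ((i :: t).map a).prod = ((j :: t').map a).prod := by
        intro i j t t' hk hl hk' hl' h di dj hlen had ⟨h1, h2, h3, h4⟩
        set w := wordPerm (i :: t) with hw
        have s1 : adjSwap i (hi j) = hi j := adjSwap_of_ne h2 h3
        have s2 : adjSwap j (lo i) = lo i := adjSwap_of_ne (h1 ▸ h4) h2.symm
        have s3 : adjSwap j (hi i) = hi j := h1 ▸ adjSwap_lo j
        have e1 := inv_adjSwap_trans' di
        have e2 : inv ((adjSwap j).trans ((adjSwap i).trans w)) + 1 = _ := inv_adjSwap_trans' (by
          simp only [Equiv.trans_apply, h1, s1, adjSwap_hi]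
          rw [h1] at dj
          exact dj.trans di)
        have e3 : inv ((adjSwap i).trans ((adjSwap j).trans ((adjSwap i).trans w))) + 1 = _ :=
          inv_adjSwap_trans' (by
            simp only [Equiv.trans_apply, s2, s3, s1, adjSwap_lo]
            rwa [h1] at dj)
        obtain ⟨m, hm, hmk⟩ :=
          exists_word_inv ((adjSwap i).trans ((adjSwap j).trans ((adjSwap i).trans w)))
        have hb : (adjSwap i).trans ((adjSwap j).trans (adjSwap i)) =
            (adjSwap j).trans ((adjSwap i).trans (adjSwap j)) := by
          ext x
          exact congrArg Fin.val (congrFun (comp_adjSwap_braid (fun x ↦ x) h1 h2 h3 h4) x)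
        have hb' : (adjSwap i).trans ((adjSwap j).trans ((adjSwap i).trans w)) =
            (adjSwap j).trans ((adjSwap i).trans ((adjSwap j).trans w)) := by
          simpa [Equiv.trans_assoc] using congrArg (fun u ↦ Equiv.trans u w) hb
        rw [key (m := j :: i :: m) hk hl (by simp [wordPerm, hm]; simp [hw, wordPerm])
          (by simp only [List.length_cons]; omega),
          key (m := i :: j :: m) hk' hl' (by
            rw [← h]; simp only [wordPerm, hm, hb']; simp)
          (by simp only [List.length_cons]; omega)]
        simp only [List.map_cons, List.prod_cons]
        rw [← mul_assoc, ← mul_assoc, hbraid i j had]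
        simp only [mul_assoc]
      obtain hc | hc := adjacent_cases had
      · exact main hk hl hk' hl' h di dj hlen had hc
      · exact (main hk' hl' hk hl h.symm (by rwa [← h]) (by rwa [← h]) (by rwa [← h])
          had.symm hc).symm

theorem prod_map_g_eq {l : List (Fin (n - 1))} {w : Equiv.Perm (Fin n)} (hl : IsReduced l)
    (h : wordPerm l = w) : (l.map g).prod = gPerm w := by
  refine prod_eq_of_isReduced g (fun i j hij ↦ ?_) (fun i j hij ↦ ?_) hl (isReduced_reducedWord w)
    (h.trans (wordPerm_reducedWord w).symm)
  · simpa [g] using rel_eq (Rel.gg_far i j hij)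
  · simpa [g] using rel_eq (Rel.braid i j hij)

theorem gPerm_adjSwap_trans {i : Fin (n - 1)} {w : Equiv.Perm (Fin n)} (h : w (lo i) < w (hi i)) :
    gPerm ((adjSwap i).trans w) = g i * gPerm w := by
  rw [← prod_map_g_eq (l := i :: reducedWord w)]
  · simp [gPerm]
  · rw [IsReduced, wordPerm, wordPerm_reducedWord, inv_adjSwap_trans h, List.length_cons,
      ← len_eq_inv, len]
  · simp [wordPerm, wordPerm_reducedWord]

@[simp] theorem gPerm_refl : gPerm (Equiv.refl (Fin n)) = 1 :=
  (prod_map_g_eq (l := []) (by simp [IsReduced, wordPerm]) rfl).symm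

theorem inv_symm (w : Equiv.Perm (Fin n)) : inv w.symm = inv w := by
  refine Finset.card_bij (fun p _ ↦ (w.symm p.2, w.symm p.1)) ?_ ?_ ?_
  · rintro ⟨x, y⟩ h; simpa [and_comm] using h
  · rintro ⟨x, y⟩ _ ⟨x', y'⟩ _ h; simp_all
  · rintro ⟨x, y⟩ h
    exact ⟨(w y, w x), by simpa [and_comm] using h, by simp⟩

theorem wordPerm_reverse (l : List (Fin (n - 1))) : wordPerm l.reverse = (wordPerm l).symm := by
  induction l with
  | nil => rfl
  | cons i l ih =>
    rw [List.reverse_cons, wordPerm_append, ih]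
    ext x
    simp [wordPerm]

theorem star_mul (x y : BT n) : star (x * y) = star y * star x := by simp [star]

theorem star_one : star (1 : BT n) = 1 := by simp [star]

theorem star_g (i : Fin (n - 1)) : star (g i) = g i := by
  simp [star, g, starHom, liftBT_mk, fg]

theorem star_e (i : Fin (n - 1)) : star (e i) = e i := by
  simp [star, e, starHom, liftBT_mk, fe]

theorem star_list_prod (l : List (BT n)) : star l.prod = (l.reverse.map star).prod := by
  induction l with
  | nil => simp [star_one]
  | cons x l ih => simp [star_mul, ih]

/-- The reverse of a reduced word of `w` is a reduced word of the inverse, since both permutations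
have the same number of inversions. -/
theorem star_gPerm (w : Equiv.Perm (Fin n)) : star (gPerm w) = gPerm w.symm := by
  rw [← prod_map_g_eq (l := (reducedWord w).reverse) (w := w.symm)]
  · rw [gPerm, star_list_prod, ← List.map_reverse, List.map_map]
    congr 2
    ext i
    exact star_g i
  · rw [IsReduced, wordPerm_reverse, inv_symm, List.length_reverse, isReduced_reducedWord]
  · rw [wordPerm_reverse, wordPerm_reducedWord]

/-- This is `gPerm_adjSwap_trans` for the inverse permutation, read through `*`. -/
theorem gPerm_trans_adjSwap {i : Fin (n - 1)} {w : Equiv.Perm (Fin n)}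
    (h : w.symm (lo i) < w.symm (hi i)) :
    gPerm (w.trans (adjSwap i)) = gPerm w * g i := by
  have h1 := congrArg star (gPerm_adjSwap_trans h)
  rw [star_mul, star_gPerm, star_gPerm, star_g] at h1
  simpa using h1

/-- A reduced word of a permutation that preserves the classes of a monotone function uses only
simple transpositions inside the classes. -/
theorem IsReduced.class_eq {X : Type*} [LinearOrder X] {c : Fin n → X} (hc : Monotone c)
    {l : List (Fin (n - 1))} (hl : IsReduced l) (h : ∀ x, c (wordPerm l x) = c x) :
    ∀ i ∈ l, c (lo i) = c (hi i) := by
  induction l with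
  | nil => simp
  | cons i l ih =>
    obtain ⟨h1, h2⟩ := hl.of_cons
    -- The tail of the word keeps `i` and `i + 1` in order, but sends them to the classes of `i + 1`
    -- and `i` respectively; monotonicity gives the missing inequality.
    have hi' : c (lo i) = c (hi i) := by
      apply le_antisymm (hc (lo_lt_hi i).le)
      have h3 := h (lo i)
      have h4 := h (hi i)
      simp only [wordPerm, Equiv.trans_apply, adjSwap_lo, adjSwap_hi] at h3 h4
      rw [← h3, ← h4]
      exact hc h2.le
    have hs : ∀ x, c (adjSwap i x) = c x := fun x ↦ by
      rcases eq_or_ne x (lo i) with rfl | h3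
      · simp [hi']
      rcases eq_or_ne x (hi i) with rfl | h4
      · simp [hi']
      rw [adjSwap_of_ne h3 h4]
    intro j hj
    rcases List.mem_cons.1 hj with rfl | hj
    · exact hi'
    · refine ih h1 (fun x ↦ ?_) j hj
      have := h (adjSwap i x)
      simp only [wordPerm, Equiv.trans_apply, adjSwap_adjSwap] at this
      rw [this, hs]

end Coxeter

/-! ### The elements `E_{i j}` -/

section Ties

variable {n : ℕ}

/-- The unit `g_i`, indexed by a natural number; `1` if out of range. -/
def gNat (n i : ℕ) : (BT n)ˣ := if h : i < n - 1 then gUnit ⟨i, h⟩ else 1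

theorem gNat_val {i : ℕ} (h : i < n - 1) : (gNat n i : BT n) = g ⟨i, h⟩ := by
  simp [gNat, h, gUnit]

theorem eSpan_succ {k i : ℕ} (h : i < n - 1) :
    eSpan n (k + 1) i = gNat n i * eSpan n k (i + 1) * ((gNat n i)⁻¹ : (BT n)ˣ) := by
  simp [eSpan, gNat, h]

theorem eSpan_zero {i : ℕ} (h : i < n - 1) : eSpan n 0 i = e ⟨i, h⟩ := by simp [eSpan, h]

theorem e_mul_comm (i j : Fin (n - 1)) : e i * e j = e j * e i := by
  simpa [g, e] using rel_eq (Rel.ee i j)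

theorem g_mul_e_far {i j : Fin (n - 1)} (h : Far i j) : g i * e j = e j * g i := by
  simpa [g, e] using rel_eq (Rel.ge_far i j h)

theorem e_mul_g_mul_g {i j : Fin (n - 1)} (h : Adjacent i j) : e i * g j * g i = g j * g i * e j := by
  simpa [g, e] using rel_eq (Rel.egg i j h)

theorem e_mul_e_mul_g {i j : Fin (n - 1)} (h : Adjacent i j) : e i * e j * g j = g j * e i * e j := by
  have h1 := (rel_eq (Rel.eeg i j h)).trans (rel_eq (Rel.ege i j h))
  simpa [g, e] using h1

/-- Write `a⁻¹ = a (a a)⁻¹`. This makes up for `g_i` not being an involution: conjugation by `g_i`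
and by `g_i⁻¹` agree on a tie as soon as `g_i²` commutes with it. -/
theorem _root_.SemiconjBy.inv_of_commute_sq {M : Type*} [Monoid M] {a : Mˣ} {y z : M}
    (h : SemiconjBy (a : M) y z) (hsq : Commute (a * a : M) y) :
    SemiconjBy ((a⁻¹ : Mˣ) : M) y z := by
  have h1 : Commute (((a * a)⁻¹ : Mˣ) : M) y := Commute.units_inv_left (by simpa using hsq)
  simpa using h.mul_left h1

theorem commute_gNat_gNat {i j : ℕ} (h : i + 1 < j) : Commute (gNat n i : BT n) (gNat n j) := by
  by_cases hj : j < n - 1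
  · rw [gNat_val (show i < n - 1 by omega), gNat_val hj]
    have := rel_eq (Rel.gg_far (n := n) ⟨i, by omega⟩ ⟨j, hj⟩ (Or.inl h))
    simpa [g, Commute, SemiconjBy] using this
  · simp [gNat, hj]

theorem commute_gNat_eSpan {m k i : ℕ} (hi : i + k < n - 1)
    (hm : m + 1 < i ∨ i + 1 + k < m) : Commute (gNat n m : BT n) (eSpan n k i) := by
  induction k generalizing i with
  | zero =>
    rw [eSpan_zero (by omega)]
    by_cases hm' : m < n - 1
    · rw [gNat_val hm']
      exact g_mul_e_far (by simp only [Far]; omega)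
    · simp [gNat, hm']
  | succ k ih =>
    rw [eSpan_succ (by omega)]
    have h1 : Commute (gNat n m : BT n) (gNat n i) := by
      rcases hm with h | h
      · exact commute_gNat_gNat h
      · exact (commute_gNat_gNat (by omega)).symm
    exact (h1.mul_right (ih (by omega) (by omega))).mul_right h1.units_inv_right

/-- All three conjugations produce `E_{i, i+2}`, which is `g_i e_{i+1} g_i⁻¹` by definition; the
relations `e_i g_j g_i = g_j g_i e_j` express it through `e_i` and `g_{i+1}` as well. -/
theorem semiconj_top_zero {i : ℕ} (hi : i + 1 < n - 1) :
    SemiconjBy (gNat n (i + 1) : BT n) (eSpan n 0 i) (eSpan n 1 i) ∧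
    SemiconjBy (((gNat n (i + 1))⁻¹ : (BT n)ˣ) : BT n) (eSpan n 0 i) (eSpan n 1 i) ∧
    SemiconjBy (((gNat n i)⁻¹ : (BT n)ˣ) : BT n) (eSpan n 0 (i + 1)) (eSpan n 1 i) := by
  have ha : Adjacent (⟨i, by omega⟩ : Fin (n - 1)) ⟨i + 1, hi⟩ := Or.inl rfl
  have h1 := e_mul_g_mul_g ha
  have h2 := e_mul_g_mul_g ha.symm
  have h3 := e_mul_e_mul_g ha.symm
  have hc := e_mul_comm (n := n) ⟨i, by omega⟩ ⟨i + 1, hi⟩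
  have hq := g_sq (n := n) ⟨i, by omega⟩
  rw [← eSpan_zero, ← eSpan_zero] at hc
  rw [← eSpan_zero, ← gNat_val, ← gNat_val, ← eSpan_zero] at h1 h2
  rw [← eSpan_zero, ← eSpan_zero, ← gNat_val] at h3
  rw [← gNat_val, ← eSpan_zero] at hq
  rw [eSpan_succ (by omega)]
  set a := gNat n i
  set b := gNat n (i + 1)
  set x := eSpan n 0 i
  set y := eSpan n 0 (i + 1)
  have hxa : (a : BT n) * x = x * a := by
    have := g_mul_e (n := n) ⟨i, by omega⟩
    rwa [← gNat_val, ← eSpan_zero] at this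
  -- By the quadratic relation it suffices that `e_i g_i` commutes with `e_{i+1}`, which comes from
  -- `e_{i+1} e_i g_i = g_i e_{i+1} e_i`.
  have hsq : Commute (a * a : BT n) y := by
    rw [hq]
    refine (Commute.one_left _).add_left (Commute.smul_left ?_ _)
    rw [Commute, SemiconjBy, ← hxa, mul_assoc, hc, ← mul_assoc, ← h3, mul_assoc, ← hxa]
  have e1 : SemiconjBy (a : BT n) y (a * y * (a⁻¹ : (BT n)ˣ)) := by
    simp [SemiconjBy]
  have e3 := e1.inv_of_commute_sq hsq
  refine ⟨?_, ?_, e3⟩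
  · have h4 : SemiconjBy (a * b : BT n) x y := by rw [SemiconjBy, ← h2, mul_assoc]
    simpa using e3.mul_left h4
  · have h4 : SemiconjBy ((b * a : (BT n)ˣ) : BT n) y x := by
      rw [SemiconjBy, Units.val_mul, ← h1, mul_assoc]
    simpa using e1.mul_left h4.units_inv_symm_left

/-- Peeling off the lowest generator `g_i` leaves the same claim for a shorter span, because `g_i`
commutes with the generator at the upper end. -/
theorem semiconj_top {k i : ℕ} (hi : i + 1 + k < n - 1) :
    SemiconjBy (gNat n (i + 1 + k) : BT n) (eSpan n k i) (eSpan n (k + 1) i) ∧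
    SemiconjBy (((gNat n (i + 1 + k))⁻¹ : (BT n)ˣ) : BT n) (eSpan n k i) (eSpan n (k + 1) i) := by
  induction k generalizing i with
  | zero => exact ⟨(semiconj_top_zero hi).1, (semiconj_top_zero hi).2.1⟩
  | succ k ih =>
    rw [eSpan_succ (k := k) (by omega), eSpan_succ (k := k + 1) (by omega)]
    have h1 := commute_gNat_gNat (n := n) (show i + 1 < i + 1 + (k + 1) by omega)
    have h2 := ih (i := i + 1) (by omega)
    rw [show i + 1 + 1 + k = i + 1 + (k + 1) by omega] at h2
    exact ⟨(SemiconjBy.mul_right h1.symm h2.1).mul_right h1.symm.units_inv_right,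
      (SemiconjBy.mul_right h1.symm.units_inv_left h2.2).mul_right
        h1.symm.units_inv_right.units_inv_left⟩

/-- Conjugation by `g_i` is the recursive definition. For `g_i⁻¹` the upper end is moved down by
`semiconj_top`, the shorter span is treated by induction, and the upper end is moved back; the
generators at the two ends commute. -/
theorem semiconj_bot {k i : ℕ} (hi : i + 1 + k < n - 1) :
    SemiconjBy (gNat n i : BT n) (eSpan n k (i + 1)) (eSpan n (k + 1) i) ∧
    SemiconjBy (((gNat n i)⁻¹ : (BT n)ˣ) : BT n) (eSpan n k (i + 1)) (eSpan n (k + 1) i) := by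
  constructor
  · rw [eSpan_succ (by omega)]; simp [SemiconjBy]
  induction k with
  | zero => exact (semiconj_top_zero hi).2.2
  | succ k ih =>
    have h1 := (semiconj_top (n := n) (i := i + 1) (k := k) (by omega)).1.units_inv_symm_left
    have h2 := (semiconj_top (n := n) (i := i) (k := k + 1) (by omega)).1
    have h3 := commute_gNat_gNat (n := n) (show i + 1 < i + 1 + (k + 1) by omega)
    rw [show i + 1 + 1 + k = i + 1 + (k + 1) by omega] at h1
    have h4 := (h2.mul_left (ih (by omega))).mul_left h1
    rwa [mul_assoc, h3.units_inv_left.units_inv_right.eq, Units.mul_inv_cancel_left] at h4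

/-- The essential case is `m = i + 1`. There `E_{ij}` is the conjugate of `E_{i+2, j}` by `g_i
g_{i+1}`; the braid relation says that this conjugation takes `g_i` to `g_{i+1}`, and `g_i` commutes
with `E_{i+2, j}`. -/
theorem commute_mid {m k i : ℕ} (hi : i + k < n - 1) (h1 : i < m) (h2 : m < i + k) :
    Commute (gNat n m : BT n) (eSpan n k i) := by
  induction k generalizing i with
  | zero => omega
  | succ k ih =>
    rw [eSpan_succ (by omega)]
    rcases Nat.lt_or_ge (i + 1) m with h | h
    · have h3 := (commute_gNat_gNat (n := n) h).symm
      exact (h3.mul_right (ih (by omega) h (by omega))).mul_right h3.units_inv_right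
    · obtain rfl : m = i + 1 := by omega
      obtain ⟨k, rfl⟩ : ∃ k', k = k' + 1 := ⟨k - 1, by omega⟩
      rw [eSpan_succ (by omega)]
      have h3 := commute_gNat_eSpan (n := n) (m := i) (k := k) (i := i + 1 + 1) (by omega) (by omega)
      have hb : (gNat n i * gNat n (i + 1) : (BT n)ˣ) * gNat n i =
          gNat n (i + 1) * gNat n i * gNat n (i + 1) := by
        ext
        have := rel_eq (Rel.braid (n := n) ⟨i, by omega⟩ ⟨i + 1, by omega⟩ (Or.inl rfl))
        simp only [Units.val_mul, gNat_val (show i < n - 1 by omega),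
          gNat_val (show i + 1 < n - 1 by omega)]
        simpa [g] using this
      have h4 : SemiconjBy (gNat n i * gNat n (i + 1) : (BT n)ˣ) (gNat n i) (gNat n (i + 1)) := by
        rw [SemiconjBy, hb, mul_assoc]
      have h5 : SemiconjBy ((gNat n i * gNat n (i + 1) : (BT n)ˣ) : BT n)
          (gNat n i) (gNat n (i + 1)) := by
        have := congrArg Units.val h4.eq
        simpa [SemiconjBy] using this
      have h6 : SemiconjBy ((gNat n i * gNat n (i + 1) : (BT n)ˣ) : BT n)
          (eSpan n k (i + 1 + 1)) (gNat n i * (gNat n (i + 1) * eSpan n k (i + 1 + 1) *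
            ((gNat n (i + 1))⁻¹ : (BT n)ˣ)) * ((gNat n i)⁻¹ : (BT n)ˣ)) := by
        simp [SemiconjBy, mul_assoc]
      have h7 := (SemiconjBy.mul_right h5 h6).eq
      rw [show (gNat n i : BT n) * eSpan n k (i + 1 + 1) = _ from h3.eq,
        (SemiconjBy.mul_right h6 h5).eq] at h7
      exact ((Units.mul_left_inj _).1 h7).symm

/-- The element `E_{i j} = E_{j i}`; it is `1` if `i = j`. -/
def tie (i j : Fin n) : BT n := if i < j then ePair i j else if j < i then ePair j i else 1

theorem tie_comm (i j : Fin n) : tie i j = tie j i := by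
  unfold tie
  split_ifs <;> first | rfl | order

theorem tie_self (i : Fin n) : tie i i = 1 := by simp [tie]

theorem tie_of_lt {i j : Fin n} (h : i < j) : tie i j = ePair i j := by simp [tie, h]

theorem tie_lo_hi (i : Fin (n - 1)) : tie (lo i) (hi i) = e i := by
  rw [tie_of_lt (lo_lt_hi i), ePair, ← eSpan_zero i.2]
  simp [lo, hi]

/-- The cases follow the position of `k`. Moved endpoints are covered by `semiconj_bot` and
`semiconj_top`, whose versions for inverses account for the moves that shorten the span; an interior
`k` is covered by `commute_mid`, an exterior one by `commute_gNat_eSpan`. -/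
theorem g_mul_tie_of_lt (k : Fin (n - 1)) {i j : Fin n} (h : i < j) :
    SemiconjBy (g k) (tie i j) (tie (adjSwap k i) (adjSwap k j)) := by
  have hk := gNat_val k.2
  obtain ⟨i, hi⟩ := i
  obtain ⟨j, hj⟩ := j
  obtain ⟨k, hk'⟩ := k
  simp only [Fin.mk_lt_mk] at h
  obtain ⟨d, rfl⟩ : ∃ d, j = i + 1 + d := ⟨j - i - 1, by omega⟩
  have hE : ∀ {a b : ℕ} (ha : a < n) (hb : b < n), a < b →
      tie (⟨a, ha⟩ : Fin n) ⟨b, hb⟩ = eSpan n (b - a - 1) a := fun ha hb hab ↦ by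
    rw [tie_of_lt (by simpa using hab), ePair]
  have hE' : ∀ {a b : ℕ} (ha : a < n) (hb : b < n), b < a →
      tie (⟨a, ha⟩ : Fin n) ⟨b, hb⟩ = eSpan n (a - b - 1) b := fun ha hb hab ↦ by
    rw [tie_comm, hE _ _ hab]
  have hs : ∀ (a : ℕ) (ha : a < n), ∃ x hx, adjSwap (⟨k, hk'⟩ : Fin (n - 1)) ⟨a, ha⟩ =
      (⟨x, hx⟩ : Fin n) ∧ ((a = k ∧ x = k + 1) ∨ (a = k + 1 ∧ x = k) ∨
        (a ≠ k ∧ a ≠ k + 1 ∧ x = a)) := fun a ha ↦ by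
    refine ⟨_, (adjSwap (⟨k, hk'⟩ : Fin (n - 1)) ⟨a, ha⟩).2, rfl, ?_⟩
    simp only [adjSwap, Equiv.swap_apply_def, lo, BraidsTies.hi, Fin.ext_iff]
    split_ifs <;> simp_all
  obtain ⟨x, hx, h1, c1⟩ := hs i hi
  obtain ⟨y, hy, h2, c2⟩ := hs (i + 1 + d) hj
  rw [h1, h2, ← hk, hE _ _ h, show i + 1 + d - i - 1 = d by omega]
  change SemiconjBy (gNat n k : BT n) _ _
  clear h1 h2 hs hk
  obtain ⟨rfl, rfl⟩ | ⟨rfl, rfl⟩ | ⟨c1, c1', rfl⟩ := c1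
  · obtain rfl | ⟨d, rfl⟩ : d = 0 ∨ ∃ d', d = d' + 1 := by
      rcases d with _ | d
      exacts [Or.inl rfl, Or.inr ⟨d, rfl⟩]
    · obtain rfl : y = i := by omega
      rw [hE' _ _ (by omega), show y + 1 - y - 1 = 0 by omega, eSpan_zero hk', gNat_val hk']
      exact g_mul_e _
    · obtain rfl : y = i + 1 + (d + 1) := by omega
      rw [hE _ _ (by omega), show i + 1 + (d + 1) - (i + 1) - 1 = d by omega]
      have := (semiconj_bot (n := n) (i := i) (k := d) (by omega)).2.units_inv_symm_left
      rwa [inv_inv] at this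
  · obtain rfl : y = x + 1 + 1 + d := by omega
    rw [hE _ _ (by omega), show x + 1 + 1 + d - x - 1 = d + 1 by omega]
    exact (semiconj_bot (by omega)).1
  obtain ⟨rfl, rfl⟩ | ⟨c2, rfl⟩ | ⟨c2, c2', rfl⟩ := c2
  · rw [hE _ _ (by omega), show x + 1 + d + 1 - x - 1 = d + 1 by omega]
    exact (semiconj_top (by omega)).1
  · obtain ⟨d, rfl⟩ : ∃ d', d = d' + 1 := ⟨d - 1, by omega⟩
    obtain rfl : y = x + 1 + d := by omega
    rw [hE _ _ (by omega), show x + 1 + d - x - 1 = d by omega]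
    have := (semiconj_top (n := n) (i := x) (k := d) (by omega)).2.units_inv_symm_left
    rwa [inv_inv] at this
  · rw [hE _ _ (by omega), show x + 1 + d - x - 1 = d by omega]
    by_cases c5 : x < k ∧ k < x + d
    · exact commute_mid (by omega) c5.1 c5.2
    · exact commute_gNat_eSpan (by omega) (by omega)

theorem g_mul_tie (k : Fin (n - 1)) (i j : Fin n) :
    SemiconjBy (g k) (tie i j) (tie (adjSwap k i) (adjSwap k j)) := by
  rcases lt_trichotomy i j with h | rfl | h
  · exact g_mul_tie_of_lt k h
  · simp [tie_self]
  · rw [tie_comm i, tie_comm (adjSwap k i)]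
    exact g_mul_tie_of_lt k h

/-- Conjugation by a unit that lifts a permutation. -/
theorem exists_unit_semiconj (w : Equiv.Perm (Fin n)) :
    ∃ u : (BT n)ˣ, ∀ i j, SemiconjBy (u : BT n) (tie i j) (tie (w i) (w j)) := by
  obtain ⟨l, rfl⟩ := exists_wordPerm w
  induction l with
  | nil => exact ⟨1, fun i j ↦ by simp [wordPerm]⟩
  | cons k l ih =>
    obtain ⟨u, hu⟩ := ih
    exact ⟨u * gUnit k, fun i j ↦ by
      rw [Units.val_mul]; exact (hu _ _).mul_left (g_mul_tie k i j)⟩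

/-- A property of the elements `E_{i j}` that holds for the first points holds for all points. -/
theorem tie_induction {m : ℕ} (P : (Fin m → Fin n) → Prop)
    (hP : ∀ f (w : Equiv.Perm (Fin n)), P f → P (w ∘ f)) {f₀ f : Fin m → Fin n}
    (h₀ : Function.Injective f₀) (hf : Function.Injective f) (h : P f₀) : P f := by
  obtain ⟨w, hw⟩ := Equiv.Perm.exists_extending_pair f₀ f h₀ hf
  have : w ∘ f₀ = f := by ext x; simp [← hw]
  exact this ▸ hP _ w h

theorem unit_conj_eq {M : Type*} [Monoid M] (u : Mˣ) {a b c d : M} (h1 : SemiconjBy (u : M) a b)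
    (h2 : SemiconjBy (u : M) c d) (h : a = c) : b = d := by
  subst h
  exact (Units.mul_left_inj u).1 (h1.eq.symm.trans h2.eq)

theorem tie_sq (i j : Fin n) : tie i j * tie i j = tie i j := by
  by_cases hij : i = j
  · simp [hij, tie_self]
  have h2 : 1 < n := by
    have := i.2; have := j.2
    have : (i : ℕ) ≠ j := fun h ↦ hij (Fin.ext h)
    omega
  have := tie_induction (n := n) (m := 2)
    (fun f ↦ tie (f 0) (f 1) * tie (f 0) (f 1) = tie (f 0) (f 1)) (fun f w h ↦ by
      obtain ⟨u, hu⟩ := exists_unit_semiconj w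
      exact unit_conj_eq u ((hu _ _).mul_right (hu _ _)) (hu _ _) h)
    (f₀ := ![lo ⟨0, by omega⟩, hi ⟨0, by omega⟩]) (f := ![i, j])
    (by intro a b; fin_cases a <;> fin_cases b <;> simp [(lo_lt_hi _).ne, (lo_lt_hi _).ne'])
    (by intro a b; fin_cases a <;> fin_cases b <;> simp [hij, Ne.symm hij])
    (by simp [tie_lo_hi, e_sq])
  simpa using this

/-- For distinct points conjugation reduces the claim to the first three. There `E_{13} = g_1 e_2
g_1⁻¹`, and after multiplication by `g_1` on the right the claim is `e_1 e_2 g_1 = e_1 g_1 e_2`, a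
consequence of the defining relations. -/
theorem tie_triangle (i j k : Fin n) : tie i j * tie j k = tie i j * tie i k := by
  by_cases hij : i = j
  · simp [hij]
  by_cases hjk : j = k
  · simp [hjk, tie_self, tie_sq]
  by_cases hik : i = k
  · simp [hik, tie_self, tie_comm k j, tie_sq]
  have h2 : 2 < n := by
    simp only [Fin.ext_iff] at hij hjk hik
    omega
  have e1 : lo (⟨1, by omega⟩ : Fin (n - 1)) = hi ⟨0, by omega⟩ := rfl
  have h0 : lo (⟨0, by omega⟩ : Fin (n - 1)) ≠ hi ⟨1, by omega⟩ := by simp [lo, hi]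
  have := tie_induction (n := n) (m := 3)
    (fun f ↦ tie (f 0) (f 1) * tie (f 1) (f 2) = tie (f 0) (f 1) * tie (f 0) (f 2))
    (fun f w h ↦ by
      obtain ⟨u, hu⟩ := exists_unit_semiconj w
      exact unit_conj_eq u ((hu _ _).mul_right (hu _ _)) ((hu _ _).mul_right (hu _ _)) h)
    (f₀ := ![lo ⟨0, by omega⟩, hi ⟨0, by omega⟩, hi ⟨1, by omega⟩]) (f := ![i, j, k])
    (by 
      intro a b
      have := (lo_lt_hi (n := n) ⟨1, by omega⟩).ne
      rw [e1] at this
      fin_cases a <;> fin_cases b <;> 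
        simp [(lo_lt_hi _).ne, (lo_lt_hi _).ne', h0, h0.symm, this, this.symm])
    (by intro a b; fin_cases a <;> fin_cases b <;> simp [hij, Ne.symm hij, hjk, Ne.symm hjk, 
      hik, Ne.symm hik])
    (by
      simp only [Matrix.cons_val_zero, Matrix.cons_val_one, Matrix.cons_val]
      have h1 := g_mul_tie (n := n) ⟨0, by omega⟩ (lo ⟨1, by omega⟩) (hi ⟨1, by omega⟩)
      rw [adjSwap_of_ne h0.symm (by rw [← e1]; exact (lo_lt_hi _).ne'), e1, adjSwap_hi, ← e1,
        tie_lo_hi] at h1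
      rw [← e1, tie_lo_hi, e1, tie_lo_hi]
      have h3 := e_mul_e_mul_g (n := n) (i := ⟨1, by omega⟩) (j := ⟨0, by omega⟩) (Or.inr rfl)
      rw [e_mul_comm, mul_assoc _ (e _) (e _), e_mul_comm ⟨1, _⟩, ← mul_assoc] at h3
      refine (Units.mul_left_inj (gUnit (n := n) ⟨0, Nat.sub_pos_of_lt (by omega)⟩)).1 ?_
      change _ * g _ = _ * g _
      rw [mul_assoc _ (tie _ _), ← h1.eq, h3, ← mul_assoc, ← g_mul_e])
  simpa using this

/-- Two distinct pairs of points share one point or none, so conjugation carries the ties to `e_1,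
e_2` or to `e_1, e_3`, which commute by definition. -/
theorem tie_commute (i j k l : Fin n) : Commute (tie i j) (tie k l) := by
  have h3 : ∀ i j k : Fin n, Commute (tie i j) (tie j k) := by
    intro i j k
    by_cases hij : i = j
    · simp [hij, tie_self]
    by_cases hjk : j = k
    · simp [hjk, tie_self]
    by_cases hik : i = k
    · simp [hik, tie_comm k j]
    have h2 : 2 < n := by
      simp only [Fin.ext_iff] at hij hjk hik
      omega
    have := tie_induction (n := n) (m := 3)
      (fun f ↦ tie (f 0) (f 1) * tie (f 1) (f 2) = tie (f 1) (f 2) * tie (f 0) (f 1))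
      (fun f w h ↦ by
        obtain ⟨u, hu⟩ := exists_unit_semiconj w
        exact unit_conj_eq u ((hu _ _).mul_right (hu _ _)) ((hu _ _).mul_right (hu _ _)) h)
      (f₀ := fun a ↦ ⟨a, by omega⟩) (f := ![i, j, k])
      (fun a b h ↦ by simpa [Fin.ext_iff] using h)
      (by intro a b; fin_cases a <;> fin_cases b <;> simp [hij, Ne.symm hij, hjk, Ne.symm hjk, 
        hik, Ne.symm hik])
      (by
        have h4 := e_mul_comm (n := n) ⟨0, by omega⟩ ⟨1, by omega⟩
        rw [← tie_lo_hi, ← tie_lo_hi] at h4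
        exact h4)
    simpa [Commute, SemiconjBy] using this
  by_cases hij : i = j
  · simp [hij, tie_self]
  by_cases hkl : k = l
  · simp [hkl, tie_self]
  by_cases hik : i = k
  · rw [hik, tie_comm k j]; exact h3 _ _ _
  by_cases hil : i = l
  · rw [hil, tie_comm k l, tie_comm l j]; exact h3 _ _ _
  by_cases hjk : j = k
  · rw [hjk]; exact h3 _ _ _
  by_cases hjl : j = l
  · rw [hjl, tie_comm k l]; exact h3 _ _ _
  have h2 : 3 < n := by
    simp only [Fin.ext_iff] at hij hjk hik hkl hil hjl
    omega
  have := tie_induction (n := n) (m := 4)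
    (fun f ↦ tie (f 0) (f 1) * tie (f 2) (f 3) = tie (f 2) (f 3) * tie (f 0) (f 1))
    (fun f w h ↦ by
      obtain ⟨u, hu⟩ := exists_unit_semiconj w
      exact unit_conj_eq u ((hu _ _).mul_right (hu _ _)) ((hu _ _).mul_right (hu _ _)) h)
    (f₀ := fun a ↦ ⟨a, by omega⟩) (f := ![i, j, k, l])
    (fun a b h ↦ by simpa [Fin.ext_iff] using h)
    (by intro a b; fin_cases a <;> fin_cases b <;> simp [hij, Ne.symm hij, hjk, Ne.symm hjk, 
        hik, Ne.symm hik, hkl, Ne.symm hkl, hil, Ne.symm hil, hjl, Ne.symm hjl])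
    (by
      have h4 := e_mul_comm (n := n) ⟨0, by omega⟩ ⟨2, by omega⟩
      rw [← tie_lo_hi, ← tie_lo_hi] at h4
      exact h4)
  simpa [Commute, SemiconjBy] using this

end Ties

/-! ### The idempotents -/

section SetPartitions

variable {n : ℕ}

/-- The equivalence relation given by a set partition. -/
def SameBlock (A : SetPartition n) (i j : Fin n) : Prop := A.part i = A.part j

theorem sameBlock_equivalence (A : SetPartition n) : Equivalence (SameBlock A) :=
  ⟨fun _ ↦ rfl, fun h ↦ h.symm, fun h h' ↦ h.trans h'⟩

theorem mem_part_iff (A : SetPartition n) {i j : Fin n} : i ∈ A.part j ↔ SameBlock A i j :=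
  A.mem_part_iff_part_eq_part (Finset.mem_univ _) (Finset.mem_univ _)

theorem mem_parts_iff (A : SetPartition n) {b : Finset (Fin n)} :
    b ∈ A.parts ↔ ∃ i, A.part i = b := by
  constructor
  · intro hb
    obtain ⟨i, hi⟩ := A.nonempty_of_mem_parts hb
    exact ⟨i, A.part_eq_of_mem hb hi⟩
  · rintro ⟨i, rfl⟩
    exact A.part_mem.2 (Finset.mem_univ _)

theorem setPartition_le_iff {A B : SetPartition n} :
    A ≤ B ↔ ∀ i j, SameBlock A i j → SameBlock B i j := by
  constructor
  · intro h i j hij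
    obtain ⟨c, hc, hsub⟩ := h ((mem_parts_iff A).2 ⟨j, rfl⟩)
    have h1 : i ∈ c := hsub ((mem_part_iff A).2 hij)
    have h2 : j ∈ c := hsub ((mem_part_iff A).2 rfl)
    exact (B.part_eq_of_mem hc h1).trans (B.part_eq_of_mem hc h2).symm
  · intro h b hb
    obtain ⟨j, rfl⟩ := (mem_parts_iff A).1 hb
    refine ⟨B.part j, (mem_parts_iff B).2 ⟨j, rfl⟩, fun i hi ↦ ?_⟩
    exact (mem_part_iff B).2 (h _ _ ((mem_part_iff A).1 hi))

theorem setPartition_ext {A B : SetPartition n} (h : ∀ i j, SameBlock A i j ↔ SameBlock B i j) :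
    A = B :=
  le_antisymm (setPartition_le_iff.2 fun i j ↦ (h i j).1) (setPartition_le_iff.2 fun i j ↦ (h i j).2)

open Classical in
/-- The set partition given by an equivalence relation. -/
def ofRel (s : Setoid (Fin n)) : SetPartition n := Finpartition.ofSetoid s

theorem sameBlock_ofRel (s : Setoid (Fin n)) (i j : Fin n) : SameBlock (ofRel s) i j ↔ s i j := by
  classical
  rw [← mem_part_iff, ofRel, Finpartition.mem_part_ofSetoid_iff_rel]
  exact ⟨s.symm, s.symm⟩

/-- The set partition obtained by applying a permutation. -/
def permute (w : Equiv.Perm (Fin n)) (A : SetPartition n) : SetPartition n :=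
  ofRel (Setoid.comap w.symm ⟨SameBlock A, sameBlock_equivalence A⟩)

theorem sameBlock_permute (w : Equiv.Perm (Fin n)) (A : SetPartition n) (i j : Fin n) :
    SameBlock (permute w A) i j ↔ SameBlock A (w.symm i) (w.symm j) := by
  rw [permute, sameBlock_ofRel]; rfl

theorem blockSizes_eq_of_perm {A B : SetPartition n} (w : Equiv.Perm (Fin n))
    (h : ∀ i j, SameBlock B (w i) (w j) ↔ SameBlock A i j) : blockSizes B = blockSizes A := by
  have hp : ∀ i, B.part (w i) = (A.part i).map w.toEmbedding := fun i ↦ by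
    ext j
    obtain ⟨j, rfl⟩ := w.surjective j
    rw [mem_part_iff, h]
    simp [mem_part_iff]
  have : B.parts = A.parts.map ⟨Finset.map w.toEmbedding, Finset.map_injective _⟩ := by
    ext b
    rw [mem_parts_iff, Finset.mem_map]
    constructor
    · rintro ⟨i, rfl⟩
      obtain ⟨i, rfl⟩ := w.surjective i
      exact ⟨A.part i, (mem_parts_iff A).2 ⟨i, rfl⟩, (hp i).symm⟩
    · rintro ⟨a, ha, rfl⟩
      obtain ⟨i, rfl⟩ := (mem_parts_iff A).1 ha
      exact ⟨w i, hp i⟩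
  rw [blockSizes, this, Finset.map_val, Multiset.map_map, blockSizes]
  simp

theorem blockSizes_permute (w : Equiv.Perm (Fin n)) (A : SetPartition n) :
    blockSizes (permute w A) = blockSizes A :=
  blockSizes_eq_of_perm w fun i j ↦ by rw [sameBlock_permute]; simp

/-- Möbius inversion: after the sums are interchanged, the coefficient of `f C` is the sum of `μ(A,
B)` over the interval from `A` to `C`. -/
theorem sum_moebius_smul {M : Type*} [AddCommGroup M] (f F : SetPartition n → M)
    (h : ∀ A, open Classical in F A = ∑ B : SetPartition n with A ≤ B, f B) (A : SetPartition n) :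
    open Classical in ∑ B : SetPartition n with A ≤ B, moebius A B • F B = f A := by
  classical
  let : LocallyFiniteOrder (SetPartition n) := Fintype.toLocallyFiniteOrder
  simp_rw [h, Finset.smul_sum, Finset.sum_filter]
  simp_rw [← Finset.sum_filter]
  rw [Finset.sum_comm' (t' := Finset.univ.filter (A ≤ ·)) (s' := fun C ↦ Finset.Icc A C)
    (by
      intro B C
      simp only [Finset.mem_filter_univ, Finset.mem_Icc]
      exact ⟨fun h ↦ ⟨h, h.1.trans h.2⟩, fun h ↦ h.1⟩)]
  simp_rw [← Finset.sum_smul]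
  have : ∀ C, ∑ B ∈ Finset.Icc A C, moebius A B = if A = C then 1 else 0 := fun C ↦ by
    convert IncidenceAlgebra.sum_Icc_mu_right (𝕜 := ℤ) A C using 2 with B
    rw [moebius]
  simp_rw [this, ite_smul, one_smul, zero_smul]
  rw [Finset.sum_ite_eq]
  simp

/-! ### Orthogonal idempotents from ties in a commutative ring -/

section Abstract

variable {T : Type*} [CommRing T] (t : Fin n → Fin n → T)

open Classical in
/-- The product of the `t i j` over the pairs in a common block and of the `1 - t i j` over the
other pairs. -/
def blockIdem (A : SetPartition n) : T :=
  ∏ p : Fin n × Fin n, if SameBlock A p.1 p.2 then t p.1 p.2 else 1 - t p.1 p.2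

variable {t} (hself : ∀ i, t i i = 1) (hcomm : ∀ i j, t i j = t j i)
  (hsq : ∀ i j, t i j * t i j = t i j) (htri : ∀ i j k, t i j * t j k = t i j * t i k)

include hsq in
theorem blockIdem_mul (A : SetPartition n) (i j : Fin n) :
    open Classical in blockIdem t A * t i j = if SameBlock A i j then blockIdem t A else 0 := by
  classical
  rw [blockIdem, ← Finset.mul_prod_erase _ _ (Finset.mem_univ (i, j))]
  split_ifs with h
  · rw [mul_right_comm, hsq]
  · rw [mul_right_comm, sub_mul, hsq, one_mul, sub_self, zero_mul]

include hsq in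
theorem blockIdem_mul_blockIdem (A B : SetPartition n) :
    open Classical in blockIdem t A * blockIdem t B = if A = B then blockIdem t A else 0 := by
  classical
  have key : ∀ p : Fin n × Fin n,
      blockIdem t A * (if SameBlock B p.1 p.2 then t p.1 p.2 else 1 - t p.1 p.2) =
        if (SameBlock A p.1 p.2 ↔ SameBlock B p.1 p.2) then blockIdem t A else 0 := fun p ↦ by
    have := blockIdem_mul hsq A p.1 p.2
    by_cases h1 : SameBlock A p.1 p.2 <;> by_cases h2 : SameBlock B p.1 p.2 <;>
      simp [h1, h2, this, mul_sub]
  split_ifs with h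
  · subst h
    have : ∀ s : Finset (Fin n × Fin n), blockIdem t A *
        ∏ p ∈ s, (if SameBlock A p.1 p.2 then t p.1 p.2 else 1 - t p.1 p.2) = blockIdem t A := by
      intro s
      induction s using Finset.induction_on with
      | empty => simp
      | insert p s hp ih => rw [Finset.prod_insert hp, ← mul_assoc, key, if_pos Iff.rfl, ih]
    exact this _
  · have : ∃ i j, ¬(SameBlock A i j ↔ SameBlock B i j) := by
      by_contra! hc
      exact h (setPartition_ext hc)
    obtain ⟨i, j, hij⟩ := this
    rw [show blockIdem t B = _ from rfl, blockIdem.eq_1 t B, ← Finset.mul_prod_erase _ _ (Finset.mem_univ (i, j)), ← mul_assoc, key,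
      if_neg hij, zero_mul]

-- Expand `1` as the product of all `t i j + (1 - t i j)`. The term of a set of pairs vanishes
-- unless the set is an equivalence relation: any failure of reflexivity, symmetry or transitivity
-- puts a factor `1 - t i j` next to factors whose product it annihilates.
include hself hcomm hsq htri in
theorem sum_blockIdem : ∑ A, blockIdem t A = 1 := by
  classical
  have h1 : (1 : T) = ∏ p : Fin n × Fin n, (t p.1 p.2 + (1 - t p.1 p.2)) := by simp
  rw [h1, Finset.prod_add]
  refine Finset.sum_of_injOn
    (fun A ↦ Finset.univ.filter fun p : Fin n × Fin n ↦ SameBlock A p.1 p.2) ?_ ?_ ?_ ?_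
  · intro A _ B _ h
    refine setPartition_ext fun i j ↦ ?_
    simpa using congrArg ((i, j) ∈ ·) h
  · intro A _; simp
  · intro s _ hs
    by_contra hne
    have hmem : ∀ i j, (i, j) ∈ s → (∏ a ∈ s, t a.1 a.2) * t i j = ∏ a ∈ s, t a.1 a.2 :=
      fun i j hp ↦ by
        rw [← Finset.mul_prod_erase _ _ hp, mul_right_comm, hsq]
    have hnot : ∀ i j, (i, j) ∉ s → (∏ a ∈ s, t a.1 a.2) * (1 - t i j) ≠ 0 := fun i j hp h ↦ by
      apply hne
      rw [← Finset.mul_prod_erase (Finset.univ \ s) _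
        (show (i, j) ∈ Finset.univ \ s by simp [hp]), ← mul_assoc, h, zero_mul]
    have hrefl : ∀ i, (i, i) ∈ s := fun i ↦ by
      by_contra h
      exact hnot _ _ h (by simp [hself])
    have hsymm : ∀ i j, (i, j) ∈ s → (j, i) ∈ s := fun i j h ↦ by
      by_contra h'
      refine hnot _ _ h' ?_
      rw [hcomm j i, mul_sub, hmem _ _ h, mul_one, sub_self]
    have htrans : ∀ i j k, (i, j) ∈ s → (j, k) ∈ s → (i, k) ∈ s := fun i j k h h' ↦ by
      by_contra h''
      refine hnot _ _ h'' ?_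
      rw [← hmem _ _ h', ← hmem _ _ h, mul_assoc _ (t i j), htri, mul_assoc, mul_assoc, mul_sub,
        hsq, mul_one, sub_self, mul_zero, mul_zero]
    refine hs ⟨ofRel ⟨fun i j ↦ (i, j) ∈ s, ⟨hrefl, hsymm _ _, htrans _ _ _⟩⟩, by simp, ?_⟩
    ext p
    simp [sameBlock_ofRel]
  · intro A _
    rw [blockIdem, Finset.prod_ite, ← Finset.compl_filter, Finset.compl_eq_univ_sdiff]

include hsq in
theorem blockIdem_mul_prod (B : SetPartition n) (s : Finset (Fin n × Fin n)) :
    open Classical in blockIdem t B * ∏ p ∈ s, t p.1 p.2 =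
      if ∀ p ∈ s, SameBlock B p.1 p.2 then blockIdem t B else 0 := by
  classical
  induction s using Finset.induction_on with
  | empty => simp
  | insert p s hp ih =>
    rw [Finset.prod_insert hp, ← mul_assoc, blockIdem_mul hsq, ite_mul, ih, zero_mul]
    simp only [Finset.forall_mem_insert]
    by_cases h1 : SameBlock B p.1 p.2 <;> simp [h1]

end Abstract

theorem commute_of_mem_range_tie : ∀ a ∈ Set.range (fun p : Fin n × Fin n ↦ tie p.1 p.2),
    ∀ b ∈ Set.range (fun p : Fin n × Fin n ↦ tie p.1 p.2), a * b = b * a := by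
  rintro _ ⟨p, rfl⟩ _ ⟨p', rfl⟩
  exact (tie_commute _ _ _ _).eq

/-- The commutative algebra generated by the elements `E_{i j}`. -/
def tieAlg (n : ℕ) : Subalgebra GroundRing (BT n) :=
  Algebra.adjoin GroundRing (Set.range fun p : Fin n × Fin n ↦ tie p.1 p.2)

/-- Commutativity allows products over `Finset`s, so the abstract statements on `blockIdem` apply to
ties. -/
instance : CommRing (tieAlg n) where
  __ := (inferInstance : Ring (tieAlg n))
  mul_comm := (Algebra.isMulCommutative_adjoin GroundRing commute_of_mem_range_tie).is_comm.comm

/-- `E_{i j}` as an element of the algebra of ties. -/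
def tieT (i j : Fin n) : tieAlg n := ⟨tie i j, Algebra.subset_adjoin ⟨(i, j), rfl⟩⟩

theorem tieT_sq (i j : Fin n) : tieT i j * tieT i j = tieT i j := Subtype.ext (tie_sq i j)

theorem sum_blockIdem_tieT : ∑ A, blockIdem (tieT (n := n)) A = 1 :=
  sum_blockIdem (fun i ↦ Subtype.ext (tie_self i)) (fun i j ↦ Subtype.ext (tie_comm i j))
    tieT_sq (fun i j k ↦ Subtype.ext (tie_triangle i j k))

/-- Multiply the decomposition of `1` into the `blockIdem tieT B` by `E_A`: a term survives exactly
when every pair inside a block of `A` lies inside a block of `B`. -/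
theorem eSet_eq (A : SetPartition n) :
    open Classical in eSet A = ((∑ B : SetPartition n with A ≤ B, blockIdem tieT B : tieAlg n) :
      BT n) := by
  classical
  have h1 : eSet A = ((∏ p ∈ (blockPairs A).toFinset, tieT p.1 p.2 : tieAlg n) : BT n) := by
    rw [List.prod_toFinset, eSet]
    · rw [← Subalgebra.coe_val, map_list_prod, List.map_map]
      congr 1
      refine List.map_congr_left fun p hp ↦ ?_
      have : p.1 < p.2 := by
        simp only [blockPairs, List.mem_filter, decide_eq_true_eq] at hp
        exact hp.2.1
      exact (tie_of_lt this).symm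
    · exact ((List.nodup_finRange n).product (List.nodup_finRange n)).filter _
  rw [h1, ← one_mul (∏ p ∈ (blockPairs A).toFinset, tieT p.1 p.2), ← sum_blockIdem_tieT, Finset.sum_mul,
    Finset.sum_filter]
  congr 1
  refine Finset.sum_congr rfl fun B _ ↦ ?_
  rw [blockIdem_mul_prod tieT_sq]
  congr 1
  rw [eq_iff_iff, setPartition_le_iff]
  constructor
  · intro h i j hij
    have hmem : ∀ i j, i < j → SameBlock A i j → (i, j) ∈ (blockPairs A).toFinset :=
      fun i j h1 h2 ↦ by
        simp only [blockPairs, List.mem_toFinset, List.mem_filter, decide_eq_true_eq]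
        exact ⟨by simp, h1, h2⟩
    rcases lt_trichotomy i j with h1 | rfl | h1
    · exact h (i, j) (hmem _ _ h1 hij)
    · rfl
    · exact Eq.symm (h (j, i) (hmem _ _ h1 hij.symm))
  · rintro h p hp
    simp only [blockPairs, List.mem_toFinset, List.mem_filter, decide_eq_true_eq] at hp
    exact h _ _ hp.2.2

/-- Möbius inversion of `eSet_eq`. The product form makes orthogonality and the behaviour under
conjugation evident, which the alternating sum does not. -/
theorem idem_eq (A : SetPartition n) : idem A = (blockIdem tieT A : tieAlg n) := by
  classical
  rw [← sum_moebius_smul (fun A ↦ ((blockIdem tieT A : tieAlg n) : BT n)) eSet _ A, idem]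
  intro A
  rw [eSet_eq]
  simp

theorem idem_mul_idem (A B : SetPartition n) :
    open Classical in idem A * idem B = if A = B then idem A else 0 := by
  classical
  rw [idem_eq, idem_eq, ← Subalgebra.coe_mul, blockIdem_mul_blockIdem tieT_sq]
  split_ifs <;> simp

theorem idem_mul_tie (A : SetPartition n) (i j : Fin n) :
    open Classical in idem A * tie i j = if SameBlock A i j then idem A else 0 := by
  classical
  rw [idem_eq, show tie i j = (tieT i j : tieAlg n) from rfl, ← Subalgebra.coe_mul,
    blockIdem_mul tieT_sq]
  split_ifs <;> simp

theorem tie_mul_idem (A : SetPartition n) (i j : Fin n) : tie i j * idem A = idem A * tie i j := by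
  rw [idem_eq, show tie i j = (tieT i j : tieAlg n) from rfl, ← Subalgebra.coe_mul, mul_comm,
    Subalgebra.coe_mul]

theorem sum_idem : ∑ A, idem A = (1 : BT n) := by
  have := congrArg (fun x : tieAlg n ↦ (x : BT n)) sum_blockIdem_tieT
  simpa [idem_eq] using this

/-- In the product form, conjugation by `g_k` only reindexes the factors by `s_k`. -/
theorem g_mul_idem (k : Fin (n - 1)) (A : SetPartition n) :
    SemiconjBy (g k) (idem A) (idem (permute (adjSwap k) A)) := by
  classical
  have key : ∀ (s : Finset (Fin n × Fin n)) (f f' : Fin n × Fin n → tieAlg n),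
      (∀ p, SemiconjBy (g k) (f p : BT n) (f' p)) →
      SemiconjBy (g k) ((∏ p ∈ s, f p : tieAlg n) : BT n) (∏ p ∈ s, f' p : tieAlg n) := by
    intro s f f' h
    induction s using Finset.induction_on with
    | empty => simp
    | insert p s hp ih =>
      rw [Finset.prod_insert hp, Finset.prod_insert hp]
      exact (h p).mul_right ih
  rw [idem_eq, idem_eq, blockIdem, blockIdem,
    ← Equiv.prod_comp ((adjSwap k).prodCongr (adjSwap k)) (fun p : Fin n × Fin n ↦
      if SameBlock (permute (adjSwap k) A) p.1 p.2 then tieT p.1 p.2 else 1 - tieT p.1 p.2)]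
  refine key _ _ _ fun p ↦ ?_
  have h1 := g_mul_tie k p.1 p.2
  simp only [sameBlock_permute, adjSwap_symm, Equiv.prodCongr_apply, Prod.map_fst, Prod.map_snd,
    adjSwap_adjSwap]
  split_ifs
  · exact h1
  · exact (SemiconjBy.one_right _).sub_right h1

theorem gPerm_mul_tie (w : Equiv.Perm (Fin n)) (i j : Fin n) :
    SemiconjBy (gPerm w) (tie i j) (tie (w.symm i) (w.symm j)) := by
  have : ∀ l : List (Fin (n - 1)), SemiconjBy (l.map g).prod (tie i j)
      (tie ((wordPerm l).symm i) ((wordPerm l).symm j)) := fun l ↦ by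
    induction l with
    | nil => simp [wordPerm]
    | cons k l ih => exact (g_mul_tie k _ _).mul_left ih
  have h := this (reducedWord w)
  rwa [wordPerm_reducedWord] at h

/-- Induction on elements of the braids and ties algebra. -/
theorem BT_induction {P : BT n → Prop} (hg : ∀ i, P (g i)) (he : ∀ i, P (e i))
    (hc : ∀ c, P (algebraMap GroundRing _ c)) (hadd : ∀ x y, P x → P y → P (x + y))
    (hmul : ∀ x y, P x → P y → P (x * y)) (x : BT n) : P x := by
  obtain ⟨y, rfl⟩ : ∃ y, mkBT n y = x := RingQuot.mkAlgHom_surjective GroundRing (Rel n) x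
  induction y using FreeAlgebra.induction with
  | grade0 c => simpa using hc c
  | grade1 i => 
    rcases i with i | i
    exacts [hg i, he i]
  | mul a b ha hb => simpa using hmul _ _ ha hb
  | add a b ha hb => simpa using hadd _ _ ha hb

/-- Conjugation by `g_k` permutes the `𝔼_A` and preserves block sizes, and ties commute with every
`𝔼_A`. -/
theorem commute_idemType (α : n.Partition) (x : BT n) : Commute (idemType α) x := by
  classical
  induction x using BT_induction with
  | hg k =>
    rw [Commute, SemiconjBy, idemType, Finset.sum_mul, Finset.mul_sum]
    simp_rw [(g_mul_idem k _).eq, ← Finset.sum_mul]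
    congr 1
    refine Finset.sum_nbij' (permute (adjSwap k)) (permute (adjSwap k)) ?_ ?_ ?_ ?_ ?_
    · intro A; simp [blockSizes_permute]
    · intro A; simp [blockSizes_permute]
    · intro A _; exact setPartition_ext fun i j ↦ by simp [sameBlock_permute]
    · intro A _; exact setPartition_ext fun i j ↦ by simp [sameBlock_permute]
    · intro A _; congr 1; exact setPartition_ext fun i j ↦ by simp [sameBlock_permute]
  | he k =>
    rw [Commute, SemiconjBy, idemType, Finset.sum_mul, Finset.mul_sum, ← tie_lo_hi]
    simp_rw [tie_mul_idem]
  | hc c => exact (Algebra.commutes c _).symm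
  | hadd x y hx hy => exact hx.add_right hy
  | hmul x y hx hy => exact hx.mul_right hy

theorem idemType_mul_idem {α : n.Partition} {A : SetPartition n} (h : blockSizes A = α.parts) :
    idemType α * idem A = idem A := by
  classical
  rw [idemType, Finset.sum_mul]
  simp_rw [idem_mul_idem]
  rw [Finset.sum_ite_eq', if_pos (by simpa using h)]

theorem mul_idem_mul_mem {α : n.Partition} {A : SetPartition n} (h : blockSizes A = α.parts)
    (x y : BT n) : x * idem A * y ∈ BTType α :=
  ⟨x * idem A * y, by
    rw [mul_assoc x, ← mul_assoc (idemType α), (commute_idemType α x).eq, mul_assoc x (idemType α),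
      ← mul_assoc (idemType α), idemType_mul_idem h]⟩

/-- The elements `𝔼_A g_w` with `A` of type `α` span `𝓔_n^α(q)`. -/
theorem mem_span_idem_mul_gPerm (α : n.Partition) (y : BT n) :
    idemType α * y ∈ Submodule.span GroundRing (Set.range
      fun p : {A : SetPartition n // blockSizes A = α.parts} × Equiv.Perm (Fin n) ↦
        idem p.1.1 * gPerm p.2) := by
  classical
  set W := Submodule.span GroundRing (Set.range
      fun p : {A : SetPartition n // blockSizes A = α.parts} × Equiv.Perm (Fin n) ↦
        idem p.1.1 * gPerm p.2) with hW
  have hmem : ∀ A, blockSizes A = α.parts → ∀ w, idem A * gPerm w ∈ W := fun A hA w ↦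
    Submodule.subset_span ⟨(⟨A, hA⟩, w), rfl⟩
  have he : ∀ z ∈ W, ∀ i, z * e i ∈ W := fun z hz i ↦ by
    induction hz using Submodule.span_induction with
    | mem z hz =>
      obtain ⟨⟨⟨A, hA⟩, w⟩, rfl⟩ := hz
      dsimp only
      rw [← tie_lo_hi, mul_assoc, (gPerm_mul_tie w _ _).eq, ← mul_assoc, idem_mul_tie]
      split_ifs
      · exact hmem A hA w
      · simp
    | zero => simp
    | add x y _ _ hx hy => rw [add_mul]; exact W.add_mem hx hy
    | smul c x _ hx => rw [smul_mul_assoc]; exact W.smul_mem c hx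
  have hg : ∀ z ∈ W, ∀ i, z * g i ∈ W := fun z hz i ↦ by
    induction hz using Submodule.span_induction with
    | mem z hz =>
      obtain ⟨⟨⟨A, hA⟩, w⟩, rfl⟩ := hz
      dsimp only
      rcases lt_or_gt_of_ne (apply_lo_ne_hi w.symm i) with h | h
      · rw [mul_assoc, ← gPerm_trans_adjSwap h]
        exact hmem A hA _
      -- Here `w s_i` is shorter than `w`: the quadratic relation turns `g_w g_i` into `g_{w s_i} +
      -- (q - q⁻¹) g_w e_i`, and `he` absorbs the tie.
      · have h1 : gPerm w = gPerm (w.trans (adjSwap i)) * g i := by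
          rw [← gPerm_trans_adjSwap (by simpa using h), Equiv.trans_assoc]
          congr 1
          ext x; simp
        rw [h1, mul_assoc, mul_assoc, g_sq, mul_add, mul_one, mul_add, mul_smul_comm,
          mul_smul_comm, ← g_mul_e, ← mul_assoc (gPerm _), ← h1, ← mul_assoc]
        exact W.add_mem (hmem A hA _) (W.smul_mem _ (he _ (hmem A hA _) i))
    | zero => simp
    | add x y _ _ hx hy => rw [add_mul]; exact W.add_mem hx hy
    | smul c x _ hx => rw [smul_mul_assoc]; exact W.smul_mem c hx
  have hy : ∀ y z, z ∈ W → z * y ∈ W := fun y ↦ by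
    induction y using BT_induction with
    | hg i => exact fun z hz ↦ hg z hz i
    | he i => exact fun z hz ↦ he z hz i
    | hc c =>
      intro z hz
      rw [← Algebra.commutes, ← Algebra.smul_def]
      exact W.smul_mem c hz
    | hadd x y hx hy => exact fun z hz ↦ by rw [mul_add]; exact W.add_mem (hx z hz) (hy z hz)
    | hmul x y hx hy => exact fun z hz ↦ by rw [← mul_assoc]; exact hy _ (hx z hz)
  refine hy _ _ ?_
  rw [idemType]
  refine W.sum_mem fun A hA ↦ ?_
  have := hmem A (by simpa using hA) (Equiv.refl _)
  rwa [gPerm_refl, mul_one] at this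

end SetPartitions

/-! ### The order on words -/

section Words

variable {n : ℕ} {L C : Type*} [LinearOrder L]

open Classical in
/-- The number of positions before `m` with colour `c` and letter at most `a`. -/
def wordCount (f : Fin n → L × C) (c : C) (a : L) (m : ℕ) : ℕ :=
  (Finset.univ.filter fun x : Fin n ↦ (x : ℕ) < m ∧ (f x).2 = c ∧ (f x).1 ≤ a).card

/-- The order on words: the colours agree and small letters come first in the larger word. -/
def WordLE (f' f : Fin n → L × C) : Prop :=
  (∀ x, (f' x).2 = (f x).2) ∧ ∀ c a m, wordCount f' c a m ≤ wordCount f c a m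

theorem WordLE.refl (f : Fin n → L × C) : WordLE f f := ⟨fun _ ↦ rfl, fun _ _ _ ↦ le_rfl⟩

theorem WordLE.trans {f g h : Fin n → L × C} (h1 : WordLE f g) (h2 : WordLE g h) : WordLE f h :=
  ⟨fun x ↦ (h1.1 x).trans (h2.1 x), fun c a m ↦ (h1.2 c a m).trans (h2.2 c a m)⟩

open Classical in
theorem wordCount_succ (f : Fin n → L × C) (c : C) (a : L) {m : ℕ} (hm : m < n) :
    wordCount f c a (m + 1) = wordCount f c a m +
      if (f ⟨m, hm⟩).2 = c ∧ (f ⟨m, hm⟩).1 ≤ a then 1 else 0 := by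
  have : (Finset.univ.filter fun x : Fin n ↦ (x : ℕ) < m + 1 ∧ (f x).2 = c ∧ (f x).1 ≤ a) =
      (Finset.univ.filter fun x : Fin n ↦ (x : ℕ) < m ∧ (f x).2 = c ∧ (f x).1 ≤ a) ∪
      (if (f ⟨m, hm⟩).2 = c ∧ (f ⟨m, hm⟩).1 ≤ a then {⟨m, hm⟩} else ∅) := by
    ext x
    by_cases hx : x = ⟨m, hm⟩
    · subst hx
      split_ifs with h <;> simp [h]
    · have h1 : (x : ℕ) ≠ m := fun h ↦ hx (Fin.ext h)
      have h2 : (x : ℕ) < m + 1 ↔ (x : ℕ) < m := by omega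
      simp only [Finset.mem_union, Finset.mem_filter_univ, h2]
      split_ifs with h <;> simp [hx]
  rw [wordCount, this, Finset.card_union_of_disjoint, wordCount]
  · split_ifs <;> rfl
  · split_ifs <;> simp

/-- The counts for the prefixes of length `x` and `x + 1`, in the colour at `x`, tell which bounds
`a` the letter at `x` meets. -/
theorem WordLE.antisymm {f g : Fin n → L × C} (h1 : WordLE f g) (h2 : WordLE g f) : f = g := by
  classical
  have hc : ∀ c a m, wordCount f c a m = wordCount g c a m :=
    fun c a m ↦ le_antisymm (h1.2 c a m) (h2.2 c a m)
  funext x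
  refine Prod.ext (eq_of_forall_ge_iff fun a ↦ ?_) (h1.1 x)
  have h3 := hc (f x).2 a (x + 1)
  rw [wordCount_succ _ _ _ x.2, wordCount_succ _ _ _ x.2, hc] at h3
  simp only [Fin.eta, true_and, h1.1 x] at h3
  constructor <;> intro h4 <;> by_contra h5 <;> simp [h4, h5] at h3

theorem lo_val (k : Fin (n - 1)) : ((lo k : Fin n) : ℕ) = k := rfl

theorem hi_val (k : Fin (n - 1)) : ((hi k : Fin n) : ℕ) = k + 1 := rfl

/-- Only the prefix of length `k + 1` contains one of the positions `k`, `k + 1` without the other.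
-/
theorem wordCount_comp_adjSwap (f : Fin n → L × C) (k : Fin (n - 1)) (c : C) (a : L) {m : ℕ}
    (hm : m ≠ k + 1) : wordCount (f ∘ adjSwap k) c a m = wordCount f c a m := by
  classical
  have hs : ∀ x : Fin n, ((adjSwap k x : Fin n) : ℕ) < m ↔ (x : ℕ) < m := fun x ↦ by
    rcases eq_or_ne x (lo k) with rfl | h1
    · rw [adjSwap_lo, lo_val, hi_val]; omega
    rcases eq_or_ne x (hi k) with rfl | h2
    · rw [adjSwap_hi, lo_val, hi_val]; omega
    rw [adjSwap_of_ne h1 h2]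
  refine Finset.card_bij' (fun x _ ↦ adjSwap k x) (fun x _ ↦ adjSwap k x) ?_ ?_ ?_ ?_
  · intro x; simp [hs]
  · intro x; simp [hs]
  · intro x _; simp
  · intro x _; simp

/-- The effect of an adjacent transposition on the order of words. -/
theorem WordLE.adjSwap {f' f : Fin n → L × C} (h : WordLE f' f) (k : Fin (n - 1))
    (hk : (f (lo k)).2 = (f (hi k)).2 → (f (hi k)).1 ≤ (f (lo k)).1) :
    WordLE (f' ∘ adjSwap k) (f ∘ adjSwap k) ∧
      ((f' (lo k)).2 = (f' (hi k)).2 → WordLE f' (f ∘ adjSwap k)) := by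
  classical
  have hkn : (k : ℕ) < n := by omega
  have hkn' : (k : ℕ) + 1 < n := by omega
  have e1 : (⟨(k : ℕ), hkn⟩ : Fin n) = lo k := rfl
  have e2 : (⟨(k : ℕ) + 1, hkn'⟩ : Fin n) = hi k := rfl
  -- the only count of `f ∘ s_k` that matters
  have key : ∀ (F : Fin n → L × C), (∀ x, (F x).2 = ((f ∘ BraidsTies.adjSwap k) x).2) → ∀ c a,
      wordCount F c a k ≤ wordCount f c a k → wordCount F c a (k + 2) ≤ wordCount f c a (k + 2) →
      wordCount F c a (k + 1) ≤ wordCount (f ∘ BraidsTies.adjSwap k) c a (k + 1) := by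
    intro F hF c a h0 h2
    rw [wordCount_succ _ _ _ hkn', wordCount_succ _ _ _ hkn,
      wordCount_succ (f := f) _ _ hkn', wordCount_succ (f := f) _ _ hkn, e1, e2] at h2
    rw [wordCount_succ _ _ _ hkn, wordCount_succ _ _ _ hkn,
      wordCount_comp_adjSwap _ _ _ _ (by omega), e1]
    have hF1 := hF (lo k)
    have hF2 := hF (hi k)
    simp only [Function.comp_apply, adjSwap_lo, adjSwap_hi] at hF1 hF2 ⊢
    rw [hF1] at h2 ⊢
    rw [hF2] at h2
    -- For equal colours the swap puts the smaller letter first, so the count at `k + 1` becomes as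
    -- large as the counts at `k` and `k + 2` allow.
    have hle : (f (lo k)).2 = (f (hi k)).2 → (f (lo k)).1 ≤ a → (f (hi k)).1 ≤ a :=
      fun h1 h2 ↦ (hk h1).trans h2
    by_cases c1 : (f (lo k)).2 = c <;> by_cases c2 : (f (hi k)).2 = c <;>
      by_cases c3 : (f (lo k)).1 ≤ a <;> by_cases c4 : (f (hi k)).1 ≤ a <;>
      simp only [c1, c2, c3, c4, true_and, false_and, if_true, if_false, and_false] at h2 ⊢ <;>
      first
      | (split_ifs at h2 ⊢ <;> omega)
      | omega
      | exact absurd (hle (c1.trans c2.symm) c3) c4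
  refine ⟨⟨fun x ↦ h.1 _, fun c a m ↦ ?_⟩, fun hc ↦ ⟨fun x ↦ ?_, fun c a m ↦ ?_⟩⟩
  · by_cases hm : m = k + 1
    · subst hm
      refine key (f' ∘ BraidsTies.adjSwap k) (fun x ↦ h.1 _) c a ?_ ?_
      · rw [wordCount_comp_adjSwap _ _ _ _ (by omega)]; exact h.2 _ _ _
      · rw [wordCount_comp_adjSwap _ _ _ _ (by omega)]; exact h.2 _ _ _
    · rw [wordCount_comp_adjSwap _ _ _ _ hm, wordCount_comp_adjSwap _ _ _ _ hm]
      exact h.2 _ _ _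
  · have := congrFun (comp_adjSwap_eq (f := fun x ↦ (f' x).2) hc) x
    exact this.symm.trans (h.1 _)
  · by_cases hm : m = k + 1
    · subst hm
      refine key _ (fun x ↦ ?_) c a (h.2 _ _ _) (h.2 _ _ _)
      have := congrFun (comp_adjSwap_eq (f := fun x ↦ (f' x).2) hc) x
      exact this.symm.trans (h.1 _)
    · rw [wordCount_comp_adjSwap _ _ _ _ hm]
      exact h.2 _ _ _

/-- A pair of positions that is inverted by a reduced word after its first letter. -/
theorem IsReduced.inversion_cons {k : Fin (n - 1)} {l : List (Fin (n - 1))}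
    (hl : IsReduced (k :: l)) {x y : Fin n} (hxy : x < y) (h : wordPerm l y < wordPerm l x) :
    adjSwap k x < adjSwap k y ∧
      wordPerm (k :: l) (adjSwap k y) < wordPerm (k :: l) (adjSwap k x) := by
  refine ⟨adjSwap_lt hxy ?_, by simpa [wordPerm] using h⟩
  rintro ⟨rfl, rfl⟩
  exact absurd h hl.of_cons.2.not_gt

theorem IsReduced.inversion_head {k : Fin (n - 1)} {l : List (Fin (n - 1))}
    (hl : IsReduced (k :: l)) : wordPerm (k :: l) (hi k) < wordPerm (k :: l) (lo k) := by
  simpa [wordPerm] using hl.of_cons.2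

theorem comp_wordPerm_cons {X : Type*} (F : Fin n → X) (k : Fin (n - 1)) (l : List (Fin (n - 1))) :
    F ∘ (wordPerm (k :: l)).symm = (F ∘ adjSwap k) ∘ (wordPerm l).symm := by
  ext x; simp [wordPerm]

/-- Sorting letters of equal colour in decreasing order makes a word smaller. -/
theorem wordLE_comp_symm {w : Equiv.Perm (Fin n)} {F : Fin n → L × C}
    (h : ∀ x y, x < y → w y < w x → (F x).2 = (F y).2 ∧ (F x).1 ≤ (F y).1) :
    WordLE (F ∘ w.symm) F := by
  have : ∀ l : List (Fin (n - 1)), IsReduced l → ∀ F : Fin n → L × C, (∀ x y, x < y →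
      wordPerm l y < wordPerm l x → (F x).2 = (F y).2 ∧ (F x).1 ≤ (F y).1) →
      WordLE (F ∘ (wordPerm l).symm) F := by
    intro l
    induction l with
    | nil => intro _ F _; exact WordLE.refl _
    | cons k l ih =>
      intro hl F hF
      obtain ⟨h1, h2⟩ := hF _ _ (lo_lt_hi k) hl.inversion_head
      rw [comp_wordPerm_cons]
      refine (ih hl.of_cons.1 _ fun x y hxy hw ↦ ?_).trans ?_
      · exact hF _ _ (hl.inversion_cons hxy hw).1 (hl.inversion_cons hxy hw).2
      · have := ((WordLE.refl (F ∘ adjSwap k)).adjSwap k (by simpa using fun _ ↦ h2)).2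
          (by simpa using h1.symm)
        rwa [comp_adjSwap_twice] at this
  have h1 := this (reducedWord w) (isReduced_reducedWord w) F
  rw [wordPerm_reducedWord] at h1
  exact h1 h

/-- Sorting letters of equal colour in increasing order preserves the order of words. -/
theorem WordLE.comp_symm {w : Equiv.Perm (Fin n)} {f F : Fin n → L × C} (hfF : WordLE f F)
    (h : ∀ x y, x < y → w y < w x → (F x).2 = (F y).2 → (F y).1 ≤ (F x).1) :
    WordLE (f ∘ w.symm) (F ∘ w.symm) := by
  have : ∀ l : List (Fin (n - 1)), IsReduced l → ∀ f F : Fin n → L × C, WordLE f F → 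
      (∀ x y, x < y → wordPerm l y < wordPerm l x → (F x).2 = (F y).2 → (F y).1 ≤ (F x).1) →
      WordLE (f ∘ (wordPerm l).symm) (F ∘ (wordPerm l).symm) := by
    intro l
    induction l with
    | nil => intro _ f F h _; exact h
    | cons k l ih =>
      intro hl f F hfF hF
      rw [comp_wordPerm_cons, comp_wordPerm_cons]
      refine ih hl.of_cons.1 _ _ (hfF.adjSwap k (hF _ _ (lo_lt_hi k) hl.inversion_head)).1 ?_
      intro x y hxy hw
      exact hF _ _ (hl.inversion_cons hxy hw).1 (hl.inversion_cons hxy hw).2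
  have h1 := this (reducedWord w) (isReduced_reducedWord w) f F hfF
  rw [wordPerm_reducedWord] at h1
  exact h1 h

end Words

/-! ### The action on words -/

section Action

variable (R : Type*) [CommRing R] [Algebra GroundRing R] {N r n : ℕ}

/-- The operator `v ↦ v · x`. -/
abbrev act (x : BT n) : Module.End R (VTensor R N r n) := actLin R N r n x

theorem act_mul (x y : BT n) (v : VTensor R N r n) : act R (x * y) v = act R y (act R x v) := by
  simp [act, actLin]

theorem act_one (v : VTensor R N r n) : act R (1 : BT n) v = v := by
  simp [act, actLin]

theorem act_add (x y : BT n) (v : VTensor R N r n) :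
    act R (x + y) v = act R x v + act R y v := by
  simp [act]

theorem act_smul (c : GroundRing) (x : BT n) (v : VTensor R N r n) :
    act R (c • x) v = algebraMap GroundRing R c • act R x v := by
  rw [act, map_smul, ← algebraMap_smul R c, LinearMap.smul_apply]

theorem act_g (k : Fin (n - 1)) : (act R (g k) : Module.End R (VTensor R N r n)) = opG R k := by
  simp [act, actLin, tensorRep, g, liftBT_mk, fg]

theorem act_e (k : Fin (n - 1)) : (act R (e k) : Module.End R (VTensor R N r n)) = opE R k := by
  simp [act, actLin, tensorRep, e, liftBT_mk, fe]

/-- The coefficient of the word `f'` in `v_f · x`. -/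
def coef (x : BT n) (f f' : Fin n → Fin N × Fin r) : R :=
  (vBasis R N r n).repr (act R x (vBasis R N r n f)) f'

theorem act_eq_sum (x : BT n) (f : Fin n → Fin N × Fin r) :
    act R x (vBasis R N r n f) = ∑ f', coef R x f f' • vBasis R N r n f' :=
  ((vBasis R N r n).sum_repr _).symm

theorem coef_mul (x y : BT n) (f f' : Fin n → Fin N × Fin r) :
    coef R (x * y) f f' = ∑ h, coef R x f h * coef R y h f' := by
  rw [coef, act_mul, act_eq_sum, map_sum, map_sum, Finsupp.finsetSum_apply]
  simp [coef]

theorem coef_add (x y : BT n) (f f' : Fin n → Fin N × Fin r) :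
    coef R (x + y) f f' = coef R x f f' + coef R y f f' := by
  simp [coef]

theorem coef_smul (c : GroundRing) (x : BT n) (f f' : Fin n → Fin N × Fin r) :
    coef R (c • x) f f' = algebraMap GroundRing R c * coef R x f f' := by
  rw [coef, act_smul, map_smul]; rfl

open Classical in
theorem coef_one (f f' : Fin n → Fin N × Fin r) :
    coef R (1 : BT n) f f' = if f = f' then 1 else 0 := by
  rw [coef, act_one, Module.Basis.repr_self, Finsupp.single_apply]

open Classical in
theorem coef_g (k : Fin (n - 1)) (f f' : Fin n → Fin N × Fin r) :
    coef R (g k) f f' = (if f = f' then coefC R (f (lo k)) (f (hi k)) else 0) +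
      if f ∘ adjSwap k = f' then coefD R (f (lo k)) (f (hi k)) else 0 := by
  rw [coef, act_g, opG_basis']
  simp [Finsupp.single_apply]

open Classical in
theorem coef_e (k : Fin (n - 1)) (f f' : Fin n → Fin N × Fin r) :
    coef R (e k) f f' = if f = f' ∧ (f (lo k)).2 = (f (hi k)).2 then 1 else 0 := by
  rw [coef, act_e, opE_basis]
  by_cases h : (f (lo k)).2 = (f (hi k)).2 <;> simp [h, Finsupp.single_apply]

theorem coef_algebraMap (c : GroundRing) (f f' : Fin n → Fin N × Fin r) :
    open Classical in coef R (algebraMap GroundRing (BT n) c) f f' =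
      if f = f' then algebraMap GroundRing R c else 0 := by
  rw [Algebra.algebraMap_eq_smul_one, coef_smul, coef_one]; simp

theorem star_add (x y : BT n) : star (x + y) = star x + star y := by simp [star]

theorem star_algebraMap (c : GroundRing) :
    star (algebraMap GroundRing (BT n) c) = algebraMap GroundRing (BT n) c := by
  simp [star]

/-- The involution `*` acts by transposed matrices. -/
theorem coef_star (x : BT n) (f f' : Fin n → Fin N × Fin r) :
    coef R (star x) f f' = coef R x f' f := by
  classical
  induction x using BT_induction generalizing f f' with
  | hg k =>
    rw [star_g, coef_g, coef_g]
    congr 1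
    · by_cases h : f = f'
      · subst h; rfl
      · simp [h, Ne.symm h]
    · by_cases h : f ∘ adjSwap k = f'
      · subst h
        simp [comp_adjSwap_twice, coefD_comm]
      · have : f' ∘ adjSwap k ≠ f := by
          rintro rfl; exact h (comp_adjSwap_twice _ _)
        simp [h, this]
  | he k =>
    rw [star_e, coef_e, coef_e]
    by_cases h : f = f'
    · subst h; rfl
    · simp [h, Ne.symm h]
  | hc c =>
    rw [star_algebraMap, coef_algebraMap, coef_algebraMap]
    simp [eq_comm]
  | hadd x y hx hy => rw [star_add, coef_add, coef_add, hx, hy]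
  | hmul x y hx hy =>
    rw [star_mul, coef_mul, coef_mul]
    exact Finset.sum_congr rfl fun h _ ↦ by rw [hx, hy, mul_comm]

/-- The action only rearranges words. -/
theorem exists_perm_of_coef_ne_zero (x : BT n) (f f' : Fin n → Fin N × Fin r)
    (h : coef R x f f' ≠ 0) : ∃ w : Equiv.Perm (Fin n), f' = f ∘ w := by
  classical
  induction x using BT_induction generalizing f f' with
  | hg k =>
    rw [coef_g] at h
    by_cases h1 : f = f'
    · exact ⟨Equiv.refl _, by simp [h1]⟩
    by_cases h2 : f ∘ adjSwap k = f'
    · exact ⟨_, h2.symm⟩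
    simp [h1, h2] at h
  | he k =>
    rw [coef_e] at h
    by_cases h1 : f = f'
    · exact ⟨Equiv.refl _, by simp [h1]⟩
    simp [h1] at h
  | hc c =>
    rw [coef_algebraMap] at h
    by_cases h1 : f = f'
    · exact ⟨Equiv.refl _, by simp [h1]⟩
    simp [h1] at h
  | hadd x y hx hy =>
    rw [coef_add] at h
    by_cases h1 : coef R x f f' = 0
    · exact hy _ _ fun h2 ↦ h (by rw [h1, h2, add_zero])
    · exact hx _ _ h1
  | hmul x y hx hy =>
    rw [coef_mul] at h
    obtain ⟨f₁, -, h1⟩ := Finset.exists_ne_zero_of_sum_ne_zero h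
    obtain ⟨w, rfl⟩ := hx _ _ (left_ne_zero_of_mul h1)
    obtain ⟨w', rfl⟩ := hy _ _ (right_ne_zero_of_mul h1)
    exact ⟨w * w', rfl⟩

/-- The formula for `e_1` is carried to all pairs by conjugation with the `g_k`. Conjugation
respects it because `𝐆_k` keeps a word in place only when the colours at `k` and `k + 1` agree, and
then the exchange does not alter the colours either. -/
theorem act_tie (i j : Fin n) (f : Fin n → Fin N × Fin r) :
    act R (tie i j) (vBasis R N r n f) =
      if (f i).2 = (f j).2 then vBasis R N r n f else 0 := by
  rcases eq_or_ne i j with rfl | hij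
  · rw [tie_self, act_one, if_pos rfl]
  have hstep : ∀ (k : Fin (n - 1)) (i j : Fin n),
      (∀ f : Fin n → Fin N × Fin r, act R (tie i j) (vBasis R N r n f) =
        if (f i).2 = (f j).2 then vBasis R N r n f else 0) →
      ∀ f : Fin n → Fin N × Fin r, act R (tie (adjSwap k i) (adjSwap k j)) (vBasis R N r n f) =
        if (f (adjSwap k i)).2 = (f (adjSwap k j)).2 then vBasis R N r n f else 0 := by
    intro k i j h f
    have h1 : tie (adjSwap k i) (adjSwap k j) =
        g k * tie i j * ((gUnit k)⁻¹ : (BT n)ˣ) := by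
      rw [(g_mul_tie k i j).eq]
      exact (Units.mul_inv_cancel_right _ (gUnit k)).symm
    have h2 : act R (g k * tie i j) (vBasis R N r n f) =
        if (f (adjSwap k i)).2 = (f (adjSwap k j)).2 then act R (g k) (vBasis R N r n f) else 0 := by
      rw [act_mul, act_g, opG_basis', map_add, map_smul, map_smul, h, h]
      by_cases hc : (f (lo k)).2 = (f (hi k)).2
      · have h3 : ∀ x, (f (adjSwap k x)).2 = (f x).2 :=
          congrFun (comp_adjSwap_eq (f := fun x ↦ (f x).2) hc)
        simp only [Function.comp_apply, h3]
        split_ifs <;> simp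
      · rw [coefC_ne R hc]
        simp only [Function.comp_apply]
        split_ifs <;> simp
    rw [h1, act_mul, h2]
    split_ifs
    · rw [← act_mul, show g k * ((gUnit k)⁻¹ : (BT n)ˣ) = 1 from Units.mul_inv (gUnit k), act_one]
    · simp
  have hn : 1 < n := by
    have : (i : ℕ) ≠ j := fun h ↦ hij (Fin.ext h)
    omega
  refine tie_induction (n := n) (m := 2) (fun p ↦ ∀ f : Fin n → Fin N × Fin r,
    act R (tie (p 0) (p 1)) (vBasis R N r n f) =
      if (f (p 0)).2 = (f (p 1)).2 then vBasis R N r n f else 0) (fun p w h ↦ ?_)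
    (f₀ := ![lo ⟨0, by omega⟩, hi ⟨0, by omega⟩]) (f := ![i, j])
    (by intro a b; fin_cases a <;> fin_cases b <;> simp [(lo_lt_hi _).ne, (lo_lt_hi _).ne'])
    (by intro a b; fin_cases a <;> fin_cases b <;> simp [hij, Ne.symm hij]) ?_ f
  · obtain ⟨l, hl⟩ := exists_wordPerm w.symm
    have : ∀ l : List (Fin (n - 1)), ∀ f : Fin n → Fin N × Fin r,
        act R (tie ((wordPerm l).symm (p 0)) ((wordPerm l).symm (p 1))) (vBasis R N r n f) =
        if (f ((wordPerm l).symm (p 0))).2 = (f ((wordPerm l).symm (p 1))).2 then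
          vBasis R N r n f else 0 := fun l ↦ by
      induction l with
      | nil => exact h
      | cons k l ih => exact hstep k _ _ ih
    have h1 := this l
    rw [hl] at h1
    exact h1
  · intro f
    simp only [Matrix.cons_val_zero, Matrix.cons_val_one]
    rw [tie_lo_hi, act_e, opE_basis]
    congr

/-- The set partition given by the fibres of a function. -/
def kerPartition {X : Type*} (c : Fin n → X) : SetPartition n := ofRel (Setoid.ker c)

theorem sameBlock_kerPartition {X : Type*} (c : Fin n → X) (i j : Fin n) :
    SameBlock (kerPartition c) i j ↔ c i = c j := sameBlock_ofRel _ _ _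

-- If `A` and the colours disagree on a pair `i, j`, the two evaluations of `E_{ij} 𝔼_A = 𝔼_A
-- E_{ij}` on the word force the image to be zero. The one remaining `𝔼_A` acts as the identity
-- since they all add up to `1`.
open Classical in
theorem act_idem (A : SetPartition n) (f : Fin n → Fin N × Fin r) :
    act R (idem A) (vBasis R N r n f) =
      if A = kerPartition (fun x ↦ (f x).2) then vBasis R N r n f else 0 := by
  have h1 : ∀ A : SetPartition n, A ≠ kerPartition (fun x ↦ (f x).2) →
      act R (idem A) (vBasis R N r n f) = 0 := by
    intro A hA
    obtain ⟨i, j, hij⟩ : ∃ i j, ¬(SameBlock A i j ↔ (f i).2 = (f j).2) := by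
      by_contra! hc
      exact hA (setPartition_ext fun i j ↦ by rw [hc, sameBlock_kerPartition])
    have h2 := congrArg (fun x ↦ act R x (vBasis R N r n f)) (tie_mul_idem A i j)
    simp only [idem_mul_tie, act_mul R (tie i j), act_tie] at h2
    by_cases c1 : SameBlock A i j <;> by_cases c2 : (f i).2 = (f j).2 <;> simp_all
  split_ifs with h
  · have h2 := congrArg (fun x ↦ act R x (vBasis R N r n f)) (sum_idem (n := n))
    simp only [act_one, act, map_sum, LinearMap.sum_apply] at h2
    rwa [Finset.sum_eq_single A (fun B _ hB ↦ h1 B fun h' ↦ hB (h'.trans h.symm)) (by simp)] at h2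
  · exact h1 A h

/-- The number of steps at which equal letters meet when a word is rearranged. -/
def equalSteps {X : Type*} [DecidableEq X] (F : Fin n → X) : List (Fin (n - 1)) → ℕ
  | [] => 0
  | k :: l => (if F (lo k) = F (hi k) then 1 else 0) + equalSteps (F ∘ adjSwap k) l

/-- Along a reduced word every step meets two different colours or two letters in increasing order,
and there `𝐆` is a plain exchange. -/
theorem act_gPerm_of_lt {w : Equiv.Perm (Fin n)} {F : Fin n → Fin N × Fin r}
    (h : ∀ x y, x < y → w y < w x → (F x).2 ≠ (F y).2 ∨ (F x).1 < (F y).1) :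
    act R (gPerm w) (vBasis R N r n F) = vBasis R N r n (F ∘ w.symm) := by
  have : ∀ l : List (Fin (n - 1)), IsReduced l → ∀ F : Fin n → Fin N × Fin r, (∀ x y, x < y →
      wordPerm l y < wordPerm l x → (F x).2 ≠ (F y).2 ∨ (F x).1 < (F y).1) →
      act R (l.map g).prod (vBasis R N r n F) = vBasis R N r n (F ∘ (wordPerm l).symm) := by
    intro l
    induction l with
    | nil => intro _ F _; simp [act_one]; rfl
    | cons k l ih =>
      intro hl F hF
      rw [comp_wordPerm_cons, List.map_cons, List.prod_cons, act_mul, act_g, opG_basis]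
      have h1 := hF _ _ (lo_lt_hi k) hl.inversion_head
      have h2 : (if (F (lo k)).2 ≠ (F (hi k)).2 then vBasis R N r n (F ∘ adjSwap k)
          else if (F (lo k)).1 = (F (hi k)).1 then qR R • vBasis R N r n F
          else if (F (lo k)).1 < (F (hi k)).1 then vBasis R N r n (F ∘ adjSwap k)
          else (qR R - qInvR R) • vBasis R N r n F + vBasis R N r n (F ∘ adjSwap k)) =
          vBasis R N r n (F ∘ adjSwap k) := by
        rcases h1 with h1 | h1
        · rw [if_pos h1]
        · rw [if_neg h1.ne, if_pos h1, ite_self]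
      rw [h2]
      exact ih hl.of_cons.1 _ fun x y hxy hw ↦
        hF _ _ (hl.inversion_cons hxy hw).1 (hl.inversion_cons hxy hw).2
  have h1 := this (reducedWord w) (isReduced_reducedWord w) F
  rw [wordPerm_reducedWord] at h1
  exact h1 h

/-- The words in `v_f · g_w` for `f ≤ F`, if all inversions of `w` move letters of `F` to increasing
order. -/
theorem coef_gPerm_of_wordLE {w : Equiv.Perm (Fin n)} {f F : Fin n → Fin N × Fin r}
    (hfF : WordLE f F)
    (h : ∀ x y, x < y → w y < w x → (F x).2 = (F y).2 → (F y).1 ≤ (F x).1) :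
    (∀ f', coef R (gPerm w) f f' ≠ 0 → WordLE f' (F ∘ w.symm)) ∧
      coef R (gPerm w) f (F ∘ w.symm) =
        if f = F then qR R ^ equalSteps F (reducedWord w) else 0 := by
  classical
  have : ∀ l : List (Fin (n - 1)), IsReduced l → ∀ f F : Fin n → Fin N × Fin r, WordLE f F →
      (∀ x y, x < y → wordPerm l y < wordPerm l x → (F x).2 = (F y).2 → (F y).1 ≤ (F x).1) →
      (∀ f', coef R (l.map g).prod f f' ≠ 0 → WordLE f' (F ∘ (wordPerm l).symm)) ∧
        coef R (l.map g).prod f (F ∘ (wordPerm l).symm) =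
          if f = F then qR R ^ equalSteps F l else 0 := by
    intro l
    induction l with
    | nil =>
      intro _ f F hfF _
      simp only [List.map_nil, List.prod_nil, coef_one]
      refine ⟨fun f' hf' ↦ ?_, by simp [equalSteps]; rfl⟩
      by_cases h1 : f = f'
      · exact h1 ▸ hfF
      · simp [h1] at hf'
    | cons k l ih =>
      intro hl f F hfF hF
      have hk := hF _ _ (lo_lt_hi k) hl.inversion_head
      have hF' : ∀ x y, x < y → wordPerm l y < wordPerm l x →
          ((F ∘ adjSwap k) x).2 = ((F ∘ adjSwap k) y).2 →
          ((F ∘ adjSwap k) y).1 ≤ ((F ∘ adjSwap k) x).1 := fun x y hxy hw ↦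
        hF _ _ (hl.inversion_cons hxy hw).1 (hl.inversion_cons hxy hw).2
      have hs := hfF.adjSwap k hk
      have hexp : ∀ f', coef R ((k :: l).map g).prod f f' =
          coefC R (f (lo k)) (f (hi k)) * coef R (l.map g).prod f f' +
          coefD R (f (lo k)) (f (hi k)) * coef R (l.map g).prod (f ∘ adjSwap k) f' := fun f' ↦ by
        rw [List.map_cons, List.prod_cons, coef, act_mul, act_g, opG_basis', map_add, map_smul,
          map_smul, map_add, map_smul, map_smul]
        rfl
      obtain ⟨h1, h2⟩ := ih hl.of_cons.1 _ _ hs.1 hF'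
      rw [comp_wordPerm_cons]
      have h3 : coefC R (f (lo k)) (f (hi k)) ≠ 0 → WordLE f (F ∘ adjSwap k) := fun h ↦ hs.2 (by
        by_contra hc
        exact h (coefC_ne R hc))
      constructor
      · intro f' hf'
        by_cases hc : coefC R (f (lo k)) (f (hi k)) * coef R (l.map g).prod f f' = 0
        · rw [hexp, hc, zero_add] at hf'
          exact h1 _ (right_ne_zero_of_mul hf')
        · exact (ih hl.of_cons.1 _ _ (h3 (left_ne_zero_of_mul hc)) hF').1 _
            (right_ne_zero_of_mul hc)
      · rw [hexp, h2]
        have hinj : f ∘ adjSwap k = F ∘ adjSwap k ↔ f = F :=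
          (adjSwap k).surjective.injective_comp_right.eq_iff
        -- The summand in which `𝐆_k` leaves `f` in place. By induction it reaches the top word only
        -- from `f = F ∘ s_k`.
        have hC : coefC R (f (lo k)) (f (hi k)) *
            coef R (l.map g).prod f ((F ∘ adjSwap k) ∘ (wordPerm l).symm) =
            if f = F ∘ adjSwap k then coefC R (f (lo k)) (f (hi k)) *
              qR R ^ equalSteps (F ∘ adjSwap k) l else 0 := by
          by_cases hc : coefC R (f (lo k)) (f (hi k)) = 0
          · simp [hc]
          · rw [(ih hl.of_cons.1 _ _ (h3 hc) hF').2]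
            simp
        rw [hC]
        by_cases hf : f = F
        · subst hf
          rw [if_pos rfl, if_pos rfl, equalSteps]
          -- Equal letters of equal colour contribute the factor `q` counted by `equalSteps`;
          -- otherwise only the exchanged word reaches the top, with coefficient `1`.
          by_cases he : f (lo k) = f (hi k)
          · rw [if_pos (comp_adjSwap_eq he).symm, if_pos he, coefD, if_pos he, zero_mul, add_zero,
              coefC, if_neg (by simp [he]), if_pos (by rw [he]), pow_add, pow_one]
          · rw [if_neg he, coefD, if_neg he, one_mul, zero_add, if_neg, zero_add]
            intro h
            exact he (by simpa using congrFun h (lo k))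
        · rw [if_neg hf, if_neg (mt hinj.1 hf), mul_zero, add_zero]
          split_ifs with h4
          · by_cases hc : coefC R (f (lo k)) (f (hi k)) = 0
            · rw [hc, zero_mul]
            -- A word `f = F ∘ s_k` with equal colours at `k` and `k + 1` would lie both below and
            -- above `F`, hence be `F`.
            · exfalso
              apply hf
              have hcol : (F (lo k)).2 = (F (hi k)).2 := by
                by_contra hne
                apply hc
                apply coefC_ne
                rw [h4]
                simpa using Ne.symm hne
              refine hfF.antisymm ?_
              rw [h4]
              exact ((WordLE.refl F).adjSwap k hk).2 hcol
          · rfl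
  have h1 := this (reducedWord w) (isReduced_reducedWord w) f F hfF
  rw [wordPerm_reducedWord] at h1
  exact h1 h

end Action

/-! ### The antisymmetrizer of a Young subgroup -/

section Young

variable {n : ℕ} {X : Type*} [LinearOrder X] {c : Fin n → X}

open Classical in
/-- The permutations that preserve the fibres of a function. -/
def fibreSubgroup (c : Fin n → X) : Finset (Equiv.Perm (Fin n)) := {w | ∀ i, c (w i) = c i}

theorem mem_fibreSubgroup {w : Equiv.Perm (Fin n)} :
    w ∈ fibreSubgroup c ↔ ∀ i, c (w i) = c i := by simp [fibreSubgroup]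

theorem symm_mem_fibreSubgroup {w : Equiv.Perm (Fin n)} (h : w ∈ fibreSubgroup c) :
    w.symm ∈ fibreSubgroup c := by
  rw [mem_fibreSubgroup] at h ⊢
  intro i
  simpa using (h (w.symm i)).symm

theorem trans_mem_fibreSubgroup {w w' : Equiv.Perm (Fin n)} (h : w ∈ fibreSubgroup c)
    (h' : w' ∈ fibreSubgroup c) : w.trans w' ∈ fibreSubgroup c := by
  rw [mem_fibreSubgroup] at *
  intro i
  rw [Equiv.trans_apply, h', h]

theorem adjSwap_mem_fibreSubgroup {k : Fin (n - 1)} (h : c (lo k) = c (hi k)) :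
    adjSwap k ∈ fibreSubgroup c := by
  rw [mem_fibreSubgroup]
  exact fun i ↦ congrFun (comp_adjSwap_eq h) i

/-- The fibres of a monotone function are intervals, so a permutation that preserves them cannot
invert points of different fibres. -/
theorem eq_of_inversion (hc : Monotone c) {w : Equiv.Perm (Fin n)} (hw : w ∈ fibreSubgroup c)
    {x y : Fin n} (hxy : x < y) (h : w y < w x) : c x = c y := by
  rw [mem_fibreSubgroup] at hw
  refine le_antisymm (hc hxy.le) ?_
  rw [← hw y, ← hw x]
  exact hc h.le

/-- The element `∑_w (-q)^{-ℓ(w)} g_w`, summed over a Young subgroup. -/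
def antisymmetrizer (c : Fin n → X) : BT n := ∑ w ∈ fibreSubgroup c, (-qInv) ^ len w • gPerm w

/-- Split the subgroup into pairs `{w, s_k w}`: the shorter members make up `x`, the longer ones
contribute `-q⁻¹ g_k x`. The left factor `1 - q⁻¹ g_k` is what `act_antisymmetrizer_of_eq` and
`act_g_mul_antisymmetrizer` exploit. -/
theorem antisymmetrizer_eq {k : Fin (n - 1)} (h : c (lo k) = c (hi k)) :
    ∃ x, antisymmetrizer c = x - qInv • (g k * x) := by
  refine ⟨∑ w ∈ fibreSubgroup c with w (lo k) < w (hi k), (-qInv) ^ len w • gPerm w, ?_⟩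
  rw [antisymmetrizer, ← Finset.sum_filter_add_sum_filter_not _ (fun w ↦ w (lo k) < w (hi k)),
    sub_eq_add_neg]
  congr 1
  rw [Finset.mul_sum, Finset.smul_sum, ← Finset.sum_neg_distrib]
  have hs := adjSwap_mem_fibreSubgroup h
  refine Finset.sum_nbij' (fun w ↦ (adjSwap k).trans w) (fun w ↦ (adjSwap k).trans w) ?_ ?_ ?_ ?_ ?_
  · intro w hw
    simp only [Finset.mem_filter, not_lt] at hw ⊢
    exact ⟨trans_mem_fibreSubgroup hs hw.1, by
      simpa using lt_of_le_of_ne hw.2 (apply_lo_ne_hi w k).symm⟩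
  · intro w hw
    simp only [Finset.mem_filter, not_lt] at hw ⊢
    exact ⟨trans_mem_fibreSubgroup hs hw.1, by simpa using hw.2.le⟩
  · intro w _; simp
  · intro w _; simp
  · intro w hw
    simp only [Finset.mem_filter, not_lt] at hw
    have h1 : w (hi k) < w (lo k) := lt_of_le_of_ne hw.2 (apply_lo_ne_hi w k).symm
    have h2 := inv_adjSwap_trans' h1
    have h3 : g k * gPerm ((adjSwap k).trans w) = gPerm w := by
      rw [← gPerm_adjSwap_trans (by simpa using h1)]; simp
    rw [mul_smul_comm, h3, smul_smul, ← neg_smul, len_eq_inv, len_eq_inv, ← h2, pow_succ]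
    congr 1
    ring

variable (R : Type*) [CommRing R] [Algebra GroundRing R] {N r : ℕ}

theorem act_sub (x y : BT n) (v : VTensor R N r n) : act R (x - y) v = act R x v - act R y v := by
  rw [eq_sub_iff_add_eq, ← act_add, sub_add_cancel]

theorem act_antisymmetrizer_of_eq {k : Fin (n - 1)} (h : c (lo k) = c (hi k))
    {f : Fin n → Fin N × Fin r} (hf : f (lo k) = f (hi k)) :
    act R (antisymmetrizer c) (vBasis R N r n f) = 0 := by
  obtain ⟨x, hx⟩ := antisymmetrizer_eq h
  have h1 : algebraMap GroundRing R qInv * qR R = 1 := by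
    rw [mul_comm]; exact qR_mul_qInvR R
  rw [hx, act_sub, act_smul, act_mul, act_g, opG_basis, hf, if_neg (by simp), if_pos rfl,
    map_smul, smul_smul, h1, one_smul, sub_self]

/-- On a word with equal colours at `k` and `k + 1` the tie is the identity, so `g_k` obeys the
Hecke relation there and `g_k (1 - q⁻¹ g_k) = -q⁻¹ (1 - q⁻¹ g_k)`. -/
theorem act_g_mul_antisymmetrizer {k : Fin (n - 1)} (h : c (lo k) = c (hi k))
    {f : Fin n → Fin N × Fin r} (hf : (f (lo k)).2 = (f (hi k)).2) :
    act R (g k * antisymmetrizer c) (vBasis R N r n f) =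
      (-qInvR R) • act R (antisymmetrizer c) (vBasis R N r n f) := by
  obtain ⟨x, hx⟩ := antisymmetrizer_eq h
  have h1 : act R (e k * (g k * x)) (vBasis R N r n f) = act R (g k * x) (vBasis R N r n f) := by
    rw [act_mul, act_e, opE_basis, if_pos hf]
  have h2 : g k * antisymmetrizer c =
      g k * x - qInv • (x + (qVar - qInv) • (e k * (g k * x))) := by
    rw [hx, mul_sub, mul_smul_comm, ← mul_assoc, g_sq, add_mul, one_mul, smul_mul_assoc, mul_assoc]
  have h3 := qR_mul_qInvR R
  rw [h2, hx, act_sub, act_smul, act_add, act_smul, h1, act_sub, act_smul, map_sub]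
  let _ : AddCommGroup (VTensor R N r n) := Module.addCommMonoidToAddCommGroup R
  change _ - qInvR R • (_ + (qR R - qInvR R) • _) = (-qInvR R) • (_ - qInvR R • _)
  linear_combination (norm := module) (- h3) • act R (g k * x) (vBasis R N r n f)

/-- The antisymmetrizer kills the words with a repeated letter in a fibre. -/
theorem act_antisymmetrizer_eq_zero (hc : Monotone c) {f : Fin n → Fin N × Fin r}
    (hcol : ∀ x y, c x = c y → (f x).2 = (f y).2) {x y : Fin n} (hxy : x < y) (h : c x = c y)
    (hf : f x = f y) : act R (antisymmetrizer c) (vBasis R N r n f) = 0 := by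
  obtain ⟨d, hd⟩ : ∃ d, (y : ℕ) = x + 1 + d := ⟨y - x - 1, by omega⟩
  induction d generalizing f y with
  | zero =>
    have e1 : lo (⟨x, by omega⟩ : Fin (n - 1)) = x := rfl
    have e2 : hi (⟨x, by omega⟩ : Fin (n - 1)) = y := Fin.ext (by rw [hi_val]; simp [hd])
    exact act_antisymmetrizer_of_eq R (k := ⟨x, by omega⟩) (by rw [e1, e2, h]) (by rw [e1, e2, hf])
  | succ d ih =>
    set k : Fin (n - 1) := ⟨x + 1 + d, by omega⟩ with hk
    have e2 : hi k = y := Fin.ext (by rw [hi_val]; simp [hd, hk]; omega)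
    have hx : x < lo k := by rw [Fin.lt_def, lo_val]; simp [hk]; omega
    have e1 : c (lo k) = c (hi k) := by
      refine le_antisymm (hc (lo_lt_hi k).le) ?_
      rw [e2, ← h]; exact hc hx.le
    by_cases hkf : f (lo k) = f (hi k)
    · exact act_antisymmetrizer_of_eq R e1 hkf
    have hcc : ∀ z, ((f ∘ adjSwap k) z).2 = (f z).2 :=
      congrFun (comp_adjSwap_eq (f := fun x ↦ (f x).2) (hcol _ _ e1))
    -- Exchanging the positions `y - 1` and `y` brings the two equal letters one step closer.
    have h0 : act R (antisymmetrizer c) (vBasis R N r n (f ∘ adjSwap k)) = 0 := by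
      refine ih (y := lo k) (fun a b hab ↦ ?_) hx ?_ ?_ ?_
      · rw [hcc, hcc]; exact hcol _ _ hab
      · rw [e1, e2, h]
      · simp [adjSwap_of_ne hx.ne (hx.trans (lo_lt_hi k)).ne, e2, hf]
      · simp [lo_val, hk]
    -- Applied to the exchanged word, `g_k` times the antisymmetrizer gives a multiple of zero;
    -- expanding `𝐆_k` first shows that it gives the image of `v_f`.
    have h1 := act_g_mul_antisymmetrizer R (c := c) e1 (f := f ∘ adjSwap k) (by
      simpa using (hcol _ _ e1).symm)
    rw [h0, smul_zero, act_mul, act_g, opG_basis', map_add, map_smul, map_smul, h0, smul_zero,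
      zero_add, comp_adjSwap_twice, coefD, if_neg (by simpa using Ne.symm hkf), one_smul] at h1
    exact h1

theorem act_gPerm_mul_antisymmetrizer (hc : Monotone c) {f : Fin n → Fin N × Fin r}
    (hcol : ∀ x y, c x = c y → (f x).2 = (f y).2) {w : Equiv.Perm (Fin n)}
    (hw : w ∈ fibreSubgroup c) : act R (gPerm w * antisymmetrizer c) (vBasis R N r n f) =
      (-qInvR R) ^ len w • act R (antisymmetrizer c) (vBasis R N r n f) := by
  have : ∀ l : List (Fin (n - 1)), (∀ k ∈ l, c (lo k) = c (hi k)) → ∀ f : Fin n → Fin N × Fin r,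
      (∀ x y, c x = c y → (f x).2 = (f y).2) →
      act R ((l.map g).prod * antisymmetrizer c) (vBasis R N r n f) =
      (-qInvR R) ^ l.length • act R (antisymmetrizer c) (vBasis R N r n f) := by
    intro l
    induction l with
    | nil => intro _ f _; simp
    | cons k l ih =>
      intro hl f hcol
      have hk := hl k (by simp)
      have hcc : ∀ z, ((f ∘ adjSwap k) z).2 = (f z).2 :=
        congrFun (comp_adjSwap_eq (f := fun x ↦ (f x).2) (hcol _ _ hk))
      have hl' : ∀ k ∈ l, c (lo k) = c (hi k) := fun j hj ↦ hl j (by simp [hj])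
      have h1 := act_g_mul_antisymmetrizer R (c := c) hk (f := f) (hcol _ _ hk)
      rw [act_mul, act_g, opG_basis', map_add, map_smul, map_smul] at h1
      rw [List.map_cons, List.prod_cons, mul_assoc, act_mul, act_g, opG_basis', map_add, map_smul,
        map_smul, ih hl' f hcol, ih hl' _ (fun x y hxy ↦ by rw [hcc, hcc]; exact hcol _ _ hxy),
        smul_comm (coefC R _ _), smul_comm (coefD R _ _), ← smul_add, h1, smul_smul,
        List.length_cons, pow_succ]
  refine this _ ((isReduced_reducedWord w).class_eq hc ?_) f hcol
  rw [wordPerm_reducedWord]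
  exact mem_fibreSubgroup.1 hw

/-- All inversions of `w` lie inside fibres, where the letters increase, so `g_w` only moves the
word. -/
theorem act_antisymmetrizer_of_lt (hc : Monotone c) {f : Fin n → Fin N × Fin r}
    (h : ∀ x y, x < y → c x = c y → (f x).1 < (f y).1) :
    act R (antisymmetrizer c) (vBasis R N r n f) =
      ∑ w ∈ fibreSubgroup c, (-qInvR R) ^ len w • vBasis R N r n (f ∘ w.symm) := by
  rw [antisymmetrizer, act, map_sum, LinearMap.sum_apply]
  refine Finset.sum_congr rfl fun w hw ↦ ?_
  change act R _ _ = _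
  rw [act_smul, act_gPerm_of_lt R fun x y hxy hw' ↦
    Or.inr (h x y hxy (eq_of_inversion hc hw hxy hw')), map_pow, map_neg]
  rfl

end Young

/-! ### Combinatorics of multitableaux -/

namespace Multipartition

section Tableaux

variable {r n : ℕ} {lam : Multipartition r n}

/-- The row of a node within its component. -/
abbrev Node.row (x : lam.Node) : ℕ := x.2.1.1

/-- The column of a node within its component. -/
abbrev Node.col (x : lam.Node) : ℕ := x.2.1.2

theorem node_ext {x y : lam.Node} (h1 : x.1 = y.1) (h2 : Node.row x = Node.row y)
    (h3 : Node.col x = Node.col y) : x = y :=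
  lam.key_injective (congrArg toLex (Prod.ext h1 (congrArg toLex (Prod.ext h2 h3))))

theorem key_lt_key_iff {x y : lam.Node} : lam.key x < lam.key y ↔ x.1 < y.1 ∨ x.1 = y.1 ∧
    (Node.row x < Node.row y ∨ Node.row x = Node.row y ∧ Node.col x < Node.col y) := by
  simp only [key, Prod.Lex.toLex_lt_toLex]

theorem initial_lt_iff (i j : Fin n) :
    i < j ↔ lam.key (lam.initial i) < lam.key (lam.initial j) := by
  -- The linear order on nodes is local to the definition of `initial`; quantifying over it brings
  -- it within reach.
  have : ∀ {A : Type} [Fintype A] (o : LinearOrder A) (h : Fintype.card A = n),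
      i < j ↔ o.lt (Fintype.orderIsoFinOfCardEq A h i) (Fintype.orderIsoFinOfCardEq A h j) :=
    fun o h ↦ (Fintype.orderIsoFinOfCardEq _ h).lt_iff_lt.symm
  exact this (LinearOrder.lift' lam.key lam.key_injective) lam.card_node

theorem monotone_comp_initial : Monotone fun i ↦ (lam.initial i).1 := by
  intro i j hij
  rcases hij.eq_or_lt with rfl | h
  · exact le_rfl
  · rcases key_lt_key_iff.1 ((initial_lt_iff i j).1 h) with h | h
    · exact h.le
    · exact h.1.le

variable (lam) in
/-- The rows of `t^λ`, numbered by component and row. -/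
def rowKey (i : Fin n) : Fin r ×ₗ ℕ := toLex ((lam.initial i).1, Node.row (lam.initial i))

theorem rowKey_eq_iff {i j : Fin n} : lam.rowKey i = lam.rowKey j ↔
    (lam.initial i).1 = (lam.initial j).1 ∧
      Node.row (lam.initial i) = Node.row (lam.initial j) := by
  simp [rowKey]

theorem monotone_rowKey : Monotone lam.rowKey := by
  intro i j hij
  rcases hij.eq_or_lt with rfl | h
  · exact le_rfl
  · rw [rowKey, rowKey, Prod.Lex.toLex_le_toLex]
    rcases key_lt_key_iff.1 ((initial_lt_iff i j).1 h) with h | ⟨h, h' | h'⟩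
    · exact Or.inl h
    · exact Or.inr ⟨h, h'.le⟩
    · exact Or.inr ⟨h, h'.1.le⟩

theorem youngSubgroup_eq : lam.youngSubgroup = fibreSubgroup lam.rowKey := by
  ext w
  simp [youngSubgroup, mem_fibreSubgroup, rowKey_eq_iff]

theorem yElt_eq : lam.yElt = antisymmetrizer lam.rowKey := by
  rw [yElt, youngSubgroup_eq, antisymmetrizer]

theorem col_lt_of_rowKey_eq {i j : Fin n} (hij : i < j) (h : lam.rowKey i = lam.rowKey j) :
    Node.col (lam.initial i) < Node.col (lam.initial j) := by
  rw [rowKey_eq_iff] at h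
  rcases key_lt_key_iff.1 ((initial_lt_iff i j).1 hij) with h1 | ⟨_, h1 | h1⟩
  · exact absurd h.1 h1.ne
  · exact absurd h.2 h1.ne
  · exact h1.2

theorem row_le_of_comp_eq {i j : Fin n} (hij : i < j) (h : (lam.initial i).1 = (lam.initial j).1) :
    Node.row (lam.initial i) ≤ Node.row (lam.initial j) := by
  rcases key_lt_key_iff.1 ((initial_lt_iff i j).1 hij) with h1 | ⟨_, h1 | h1⟩
  · exact absurd h h1.ne
  · exact h1.le
  · exact h1.1.le

/-- Entries of a standard tableau increase weakly to the south-east. -/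
theorem IsStd.le {t : lam.Tab} (ht : lam.IsStd t) {x y : lam.Node} (h : x.1 = y.1)
    (h1 : Node.row x ≤ Node.row y) (h2 : Node.col x ≤ Node.col y) : t.symm x ≤ t.symm y := by
  obtain ⟨k, ⟨a, b⟩, hx⟩ := x
  obtain ⟨k', ⟨a', b'⟩, hy⟩ := y
  obtain rfl : k = k' := h
  simp only [Node.row, Node.col] at h1 h2
  have hz : (a, b') ∈ lam.comp k := (lam.comp k).up_left_mem h1 le_rfl hy
  refine le_trans (b := t.symm ⟨k, (a, b'), hz⟩) ?_ ?_
  · rcases h2.eq_or_lt with rfl | h2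
    · exact le_rfl
    · exact ((ht ⟨k, (a, b), hx⟩ ⟨k, (a, b'), hz⟩ rfl).1 rfl h2).le
  · rcases h1.eq_or_lt with rfl | h1
    · exact le_rfl
    · exact ((ht ⟨k, (a, b'), hz⟩ ⟨k, (a', b'), hy⟩ rfl).2 rfl h1).le

/-- As `t^λ` is read along rows, `x` lies weakly above `y`; if `y` also lay further right, a
standard `t` could not invert the pair. This is the hypothesis on inversions in
`coef_gPerm_of_wordLE`. -/
theorem IsStd.col_le_of_inversion {t : lam.Tab} (ht : lam.IsStd t) {x y : Fin n} (hxy : x < y)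
    (h : lam.dPerm t y < lam.dPerm t x) (hc : (lam.initial x).1 = (lam.initial y).1) :
    Node.col (lam.initial y) ≤ Node.col (lam.initial x) := by
  by_contra! h1
  exact absurd h (ht.le hc (row_le_of_comp_eq hxy hc) h1.le).not_gt

/-- The numbers of columns are bounded. -/
theorem col_lt (x : lam.Node) : Node.col x < n := by
  obtain ⟨k, ⟨a, b⟩, hx⟩ := x
  have : Function.Injective fun i : Fin (b + 1) ↦ (⟨k, (a, i),
      (lam.comp k).up_left_mem le_rfl (Nat.lt_succ_iff.1 i.2) hx⟩ : lam.Node) := by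
    intro i j hij
    have := congrArg Node.col hij
    exact Fin.ext this
  have := Fintype.card_le_of_injective _ this
  rw [card_node, Fintype.card_fin] at this
  exact this

/-! ### Words of multitableaux -/

section Words

variable {N : ℕ} (hN : ∀ x : lam.Node, Node.col x < N)

/-- The word of a tableau: the letter of an entry is its column, the colour is its component. -/
def tabWord (t : lam.Tab) (x : Fin n) : Fin N × Fin r := (⟨Node.col (t x), hN _⟩, (t x).1)

theorem tabWord_comp_symm (t : lam.Tab) :
    lam.tabWord hN t = lam.tabWord hN lam.initial ∘ (lam.dPerm t).symm := by
  ext x <;> simp [tabWord, dPerm]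

theorem tabWord_eq_iff {t : lam.Tab} {x y : Fin n} : lam.tabWord hN t x = lam.tabWord hN t y ↔
    (t x).1 = (t y).1 ∧ Node.col (t x) = Node.col (t y) := by
  simp [tabWord, Prod.ext_iff, and_comm]

-- The positions of one letter in one colour fill one column. Hence a word determines all column
-- lengths, which is how `comp_eq_of_recolour_eq` recovers the shapes.
open Classical in
theorem card_tabWord (t : lam.Tab) (a : Fin N) (k : Fin r) :
    (Finset.univ.filter fun x ↦ lam.tabWord hN t x = (a, k)).card = (lam.comp k).colLen a := by
  rw [← Finset.card_range ((lam.comp k).colLen a)]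
  refine Finset.card_bij' (fun x _ ↦ Node.row (t x))
    (fun m hm ↦ t.symm ⟨k, (m, a), YoungDiagram.mem_iff_lt_colLen.2 (Finset.mem_range.1 hm)⟩)
    ?_ ?_ ?_ ?_
  · intro x hx
    simp only [Finset.mem_filter_univ, tabWord, Prod.mk.injEq] at hx
    rw [Finset.mem_range, ← YoungDiagram.mem_iff_lt_colLen, ← hx.1, ← hx.2]
    exact (t x).2.2
  · intro m hm
    rw [Finset.mem_filter_univ, tabWord]
    exact Prod.ext (Fin.ext (congrArg Node.col (t.apply_symm_apply _)))
      (congrArg Sigma.fst (t.apply_symm_apply _))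
  · intro x hx
    simp only [Finset.mem_filter_univ, tabWord, Prod.mk.injEq] at hx
    rw [Equiv.symm_apply_eq]
    exact node_ext hx.2.symm rfl (congrArg Fin.val hx.1).symm
  · intro m hm
    exact congrArg Node.row (t.apply_symm_apply _)

-- The smaller entries in a column of a standard tableau are those above, so counting earlier
-- occurrences of a letter recovers the row.
open Classical in
theorem IsStd.card_tabWord_lt {t : lam.Tab} (ht : lam.IsStd t) (x : Fin n) :
    (Finset.univ.filter fun y ↦ y < x ∧ lam.tabWord hN t y = lam.tabWord hN t x).card =
      Node.row (t x) := by
  have hm' : ∀ m, m ∈ Finset.range (Node.row (t x)) →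
      (m, Node.col (t x)) ∈ lam.comp (t x).1 := fun m hm ↦
    (lam.comp _).up_left_mem (Finset.mem_range.1 hm).le le_rfl (t x).2.2
  conv_rhs => rw [← Finset.card_range (Node.row (t x))]
  refine Finset.card_bij' (fun y _ ↦ Node.row (t y))
    (fun m hm ↦ t.symm ⟨(t x).1, (m, Node.col (t x)), hm' m hm⟩) ?_ ?_ ?_ ?_
  · intro y hy
    simp only [Finset.mem_filter_univ, tabWord_eq_iff] at hy
    rw [Finset.mem_range]
    by_contra! h
    have := ht.le hy.2.1.symm h hy.2.2.ge
    simp only [Equiv.symm_apply_apply] at this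
    exact absurd hy.1 this.not_gt
  · intro m hm
    rw [Finset.mem_filter_univ, tabWord_eq_iff]
    have hz := t.apply_symm_apply ⟨(t x).1, (m, Node.col (t x)), hm' m hm⟩
    refine ⟨?_, (congrArg Sigma.fst hz :), (congrArg Node.col hz :)⟩
    have := (ht ⟨(t x).1, (m, Node.col (t x)), hm' m hm⟩ (t x) rfl).2 rfl (Finset.mem_range.1 hm)
    simpa using this
  · intro y hy
    simp only [Finset.mem_filter_univ, tabWord_eq_iff] at hy
    rw [Equiv.symm_apply_eq]
    exact node_ext hy.2.1.symm rfl hy.2.2.symm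
  · intro m hm
    exact congrArg Node.row (t.apply_symm_apply _)

/-- Standard tableaux are determined by their words. -/
theorem IsStd.eq_of_tabWord_eq {t t' : lam.Tab} (ht : lam.IsStd t) (ht' : lam.IsStd t')
    (h : lam.tabWord hN t = lam.tabWord hN t') : t = t' := by
  ext1 x
  have h1 := congrFun h x
  simp only [tabWord, Prod.mk.injEq, Fin.mk.injEq] at h1
  exact node_ext h1.2 (by rw [← ht.card_tabWord_lt hN, ← ht'.card_tabWord_lt hN, h]) h1.1

end Words

/-- The sum of the column numbers of the nodes. -/
def colSum (lam : Multipartition r n) : ℕ := ∑ x : lam.Node, Node.col x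

theorem sum_col (t : lam.Tab) : ∑ x, Node.col (t x) = lam.colSum :=
  Equiv.sum_comp t (fun x : lam.Node ↦ Node.col x)

/-- Letters that are distinct in rows have at least the sum of the column numbers, and they are
rearranged column numbers in the case of equality. -/
theorem colSum_le {f : Fin n → ℕ} (hf : ∀ x y, lam.rowKey x = lam.rowKey y → f x = f y → x = y) :
    lam.colSum ≤ ∑ x, f x ∧ (∑ x, f x = lam.colSum → ∃ w ∈ fibreSubgroup lam.rowKey,
      ∀ x, f x = Node.col (lam.initial (w x))) := by
  classical
  -- The cardinality of `S x` is the rank of the letter of `x` within its row. Ranks never exceed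
  -- letters, and the ranks in a row are distinct and below its length, so they are its column
  -- numbers rearranged.
  let S (x : Fin n) : Finset (Fin n) := {y | lam.rowKey y = lam.rowKey x ∧ f y < f x}
  have hS : ∀ x y, lam.rowKey x = lam.rowKey y → f x < f y → (S x).card < (S y).card := by
    intro x y h1 h2
    refine Finset.card_lt_card ((Finset.ssubset_iff_of_subset fun z hz ↦ ?_).2 ⟨x, ?_, ?_⟩)
    · simp only [S, Finset.mem_filter_univ] at hz ⊢
      exact ⟨hz.1.trans h1, hz.2.trans h2⟩
    · simpa [S] using ⟨h1, h2⟩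
    · simp [S]
  have hrow : ∀ x, (Finset.univ.filter fun y ↦ lam.rowKey y = lam.rowKey x).card ≤
      (lam.comp (lam.initial x).1).rowLen (Node.row (lam.initial x)) := by
    intro x
    rw [← Finset.card_range (YoungDiagram.rowLen _ _)]
    refine Finset.card_le_card_of_injOn (fun y ↦ Node.col (lam.initial y)) ?_ ?_
    · intro y hy
      simp only [Finset.coe_filter, Finset.mem_univ, true_and, Set.mem_ofPred_eq,
        rowKey_eq_iff] at hy
      simp only [Finset.coe_range, Set.mem_Iio, ← YoungDiagram.mem_iff_lt_rowLen]
      rw [← hy.1, ← hy.2]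
      exact (lam.initial y).2.2
    · intro y hy z hz h
      simp only [Finset.coe_filter, Finset.mem_univ, true_and, Set.mem_ofPred_eq] at hy hz
      have h2 := rowKey_eq_iff.1 (hy.trans hz.symm)
      exact lam.initial.injective (node_ext h2.1 h2.2 h)
  have hSlt : ∀ x, (S x).card <
      (lam.comp (lam.initial x).1).rowLen (Node.row (lam.initial x)) := by
    refine fun x ↦ lt_of_lt_of_le (Finset.card_lt_card
      ((Finset.ssubset_iff_of_subset fun z hz ↦ ?_).2 ⟨x, ?_, ?_⟩)) (hrow x)
    · simp only [S, Finset.mem_filter_univ] at hz ⊢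
      exact hz.1
    · simp
    · simp [S]
  let v' (x : Fin n) : lam.Node := ⟨(lam.initial x).1,
    (Node.row (lam.initial x), (S x).card), YoungDiagram.mem_iff_lt_rowLen.2 (hSlt x)⟩
  let v (x : Fin n) : Fin n := lam.initial.symm (v' x)
  have hv : Function.Injective v := by
    intro x y h
    have h' : v' x = v' y := lam.initial.symm.injective h
    have h1 : (v' x).1 = (v' y).1 := congrArg Sigma.fst h'
    have h2 : Node.row (v' x) = Node.row (v' y) := congrArg Node.row h'
    have h3 : (S x).card = (S y).card := congrArg Node.col h'
    have h4 := rowKey_eq_iff.2 ⟨h1, h2⟩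
    refine hf _ _ h4 ?_
    rcases lt_trichotomy (f x) (f y) with h5 | h5 | h5
    · exact absurd h3 (hS _ _ h4 h5).ne
    · exact h5
    · exact absurd h3 (hS _ _ h4.symm h5).ne'
  let w : Equiv.Perm (Fin n) := Equiv.ofBijective v (Finite.injective_iff_bijective.1 hv)
  have hw : ∀ x, lam.initial (w x) = v' x := fun x ↦ lam.initial.apply_symm_apply _
  have hcol : ∀ x, Node.col (lam.initial (w x)) = (S x).card := fun x ↦ by rw [hw]
  -- The smaller letters in the row of `x` are distinct natural numbers below `f x`.
  have hle : ∀ x, (S x).card ≤ f x := by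
    intro x
    conv_rhs => rw [← Finset.card_range (f x)]
    refine Finset.card_le_card_of_injOn f ?_ ?_
    · intro y hy
      simpa using (Finset.mem_filter_univ _).1 hy |>.2
    · intro y hy z hz h
      have hy' := (Finset.mem_filter_univ _).1 hy
      have hz' := (Finset.mem_filter_univ _).1 hz
      exact hf _ _ (hy'.1.trans hz'.1.symm) h
  have hsum : lam.colSum = ∑ x, (S x).card := by
    rw [← sum_col lam.initial, ← Equiv.sum_comp w]
    exact Finset.sum_congr rfl fun x _ ↦ hcol x
  rw [hsum]
  refine ⟨Finset.sum_le_sum fun x _ ↦ hle x, fun h ↦ ⟨w, ?_, fun x ↦ ?_⟩⟩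
  · rw [mem_fibreSubgroup]
    intro x
    rw [rowKey_eq_iff, hw]
    exact ⟨rfl, rfl⟩
  · rw [hcol]
    exact ((Finset.sum_eq_sum_iff_of_le fun x _ ↦ hle x).1 h.symm x (Finset.mem_univ _)).symm

/-- A permutation of equal components that is compatible with increasing tableaux is trivial. -/
theorem IsIncreasing.eq_refl {t t' : lam.Tab} (ht : lam.IsIncreasing t) (ht' : lam.IsIncreasing t')
    {σ : Equiv.Perm (Fin r)} (hσ : ∀ k, lam.comp (σ k) = lam.comp k)
    (h : ∀ x, (t' x).1 = σ (t x).1) : σ = Equiv.refl _ := by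
  have hmin : ∀ k, lam.minEntry t' (σ k) = lam.minEntry t k := by
    intro k
    rw [minEntry, minEntry]
    congr 1
    ext m
    constructor
    · rintro ⟨x, hx, rfl⟩
      refine ⟨t (t'.symm x), ?_, by simp⟩
      have := h (t'.symm x)
      rw [Equiv.apply_symm_apply, hx] at this
      exact (σ.injective this).symm
    · rintro ⟨x, hx, rfl⟩
      refine ⟨t' (t.symm x), ?_, by simp⟩
      rw [h, Equiv.apply_symm_apply, hx]
  have hmono : ∀ i j, lam.comp i = lam.comp j → i < j → σ i < σ j := by
    intro i j hij hlt
    rw [ht' _ _ (by rw [hσ, hσ, hij]), hmin, hmin, ← ht _ _ hij]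
    exact hlt
  by_contra hne
  have hex : ∃ k, σ k ≠ k := by
    by_contra! hc
    exact hne (Equiv.ext hc)
  classical
  -- For the first point `k` moved by `σ`, both `σ k` and `σ⁻¹ k` lie beyond `k`, while monotonicity
  -- on equal shapes, applied to `k < σ⁻¹ k`, gives `σ k < k`.
  obtain ⟨k, hk, hmin'⟩ : ∃ k, σ k ≠ k ∧ ∀ j, j < k → σ j = j := by
    have hs : (Finset.univ.filter fun k ↦ σ k ≠ k).Nonempty := by
      obtain ⟨k, hk⟩ := hex
      exact ⟨k, by simpa using hk⟩
    refine ⟨_, by simpa using Finset.min'_mem _ hs, fun j hj ↦ ?_⟩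
    by_contra hc
    exact absurd (Finset.min'_le _ j (by simpa using hc)) hj.not_ge
  have h1 : k < σ k := by
    refine lt_of_le_of_ne (le_of_not_gt fun hlt ↦ ?_) hk.symm
    exact hlt.ne (σ.injective (hmin' _ hlt))
  have h2 : k < σ.symm k := by
    refine lt_of_le_of_ne (le_of_not_gt fun hlt ↦ ?_) fun he ↦ hk ?_
    · exact hlt.ne (by rw [← hmin' _ hlt, Equiv.apply_symm_apply])
    · conv_lhs => rw [he]
      simp
  have h3 := hmono k (σ.symm k) (by rw [← hσ (σ.symm k), Equiv.apply_symm_apply]) h2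
  rw [Equiv.apply_symm_apply] at h3
  exact absurd h3 h1.not_gt

theorem setPartition_eq : lam.setPartition = kerPartition fun i ↦ (lam.initial i).1 := by
  refine setPartition_ext fun i j ↦ ?_
  rw [setPartition, kerPartition, ofRel]

end Tableaux

end Multipartition

theorem youngDiagram_eq_of_colLen {D E : YoungDiagram} (h : ∀ a, D.colLen a = E.colLen a) :
    D = E := by
  refine YoungDiagram.ext (Finset.ext fun ⟨i, j⟩ ↦ ?_)
  rw [YoungDiagram.mem_cells, YoungDiagram.mem_cells, YoungDiagram.mem_iff_lt_colLen,
    YoungDiagram.mem_iff_lt_colLen, h]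

/-- Sorted families that differ by a permutation are equal. -/
theorem eq_of_sorted {X : Type*} {le : X → X → Prop} [Std.Antisymm le] {r : ℕ} {f g : Fin r → X}
    (hf : ∀ i j, i ≤ j → le (f i) (f j)) (hg : ∀ i j, i ≤ j → le (g i) (g j))
    (σ : Equiv.Perm (Fin r)) (h : ∀ i, f (σ i) = g i) : f = g := by
  have h1 : (List.ofFn f).Perm (List.ofFn g) := by
    have : g = f ∘ σ := funext fun i ↦ (h i).symm
    rw [this]
    exact (Equiv.Perm.ofFn_comp_perm σ f).symm
  refine List.ofFn_injective (h1.eq_of_pairwise (le := le) (fun a b _ _ ↦ Std.Antisymm.antisymm a b)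
    ?_ ?_)
  · exact List.pairwise_ofFn.2 fun i j hij ↦ hf i j hij.le
  · exact List.pairwise_ofFn.2 fun i j hij ↦ hg i j hij.le

/-! ### Permuting the colours of words -/

section Recolour

variable {n r : ℕ} {L : Type*}

/-- Apply a permutation to the colours of a word. -/
def recolour (σ : Equiv.Perm (Fin r)) (f : Fin n → L × Fin r) (x : Fin n) : L × Fin r :=
  ((f x).1, σ (f x).2)

theorem recolour_one (f : Fin n → L × Fin r) : recolour 1 f = f := rfl

theorem recolour_recolour (σ τ : Equiv.Perm (Fin r)) (f : Fin n → L × Fin r) :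
    recolour σ (recolour τ f) = recolour (σ * τ) f := rfl

theorem recolour_comp (σ : Equiv.Perm (Fin r)) (f : Fin n → L × Fin r) (w : Fin n → Fin n) :
    recolour σ (f ∘ w) = recolour σ f ∘ w := rfl

theorem recolour_injective (σ : Equiv.Perm (Fin r)) :
    Function.Injective (recolour (n := n) (L := L) σ) := by
  intro f f' h
  have := congrArg (recolour σ⁻¹) h
  simpa [recolour_recolour, recolour_one] using this

variable (R : Type*) [CommRing R] [Algebra GroundRing R] {N : ℕ}

/-- The action commutes with the permutations of the colours. -/
theorem coef_recolour (σ : Equiv.Perm (Fin r)) (x : BT n) (f f' : Fin n → Fin N × Fin r) :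
    coef R x (recolour σ f) (recolour σ f') = coef R x f f' := by
  classical
  have hi : ∀ {f f' : Fin n → Fin N × Fin r}, recolour σ f = recolour σ f' ↔ f = f' :=
    (recolour_injective σ).eq_iff
  induction x using BT_induction generalizing f f' with
  | hg k =>
    simp only [coef_g, ← recolour_comp, hi]
    simp [recolour, coefC, coefD, Prod.ext_iff]
    congr
  | he k =>
    simp only [coef_e, hi]
    simp [recolour]
  | hc c => simp only [coef_algebraMap, hi]
  | hadd x y hx hy => rw [coef_add, coef_add, hx, hy]
  | hmul x y hx hy =>
    rw [coef_mul, coef_mul]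
    let E : (Fin n → Fin N × Fin r) ≃ (Fin n → Fin N × Fin r) :=
      Equiv.ofBijective _ (Finite.injective_iff_bijective.1 (recolour_injective σ))
    rw [← Equiv.sum_comp E]
    exact Finset.sum_congr rfl fun h _ ↦ by
      change coef R x _ (recolour σ h) * coef R y (recolour σ h) _ = _
      rw [hx, hy]

theorem act_idem_mul_of_ker {A : SetPartition n} {f : Fin n → Fin N × Fin r}
    (h : A = kerPartition fun x ↦ (f x).2) (x : BT n) :
    act R (idem A * x) (vBasis R N r n f) = act R x (vBasis R N r n f) := by
  rw [act_mul, act_idem, if_pos h]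

theorem act_idem_mul_of_not_ker {A : SetPartition n} {f : Fin n → Fin N × Fin r}
    (h : A ≠ kerPartition fun x ↦ (f x).2) (x : BT n) :
    act R (idem A * x) (vBasis R N r n f) = 0 := by
  rw [act_mul, act_idem, if_neg h, map_zero]

theorem act_star_idem (A : SetPartition n) (f : Fin n → Fin N × Fin r) :
    act R (star (idem A)) (vBasis R N r n f) = act R (idem A) (vBasis R N r n f) := by
  classical
  apply (vBasis R N r n).repr.injective
  ext f'
  change coef R _ _ _ = coef R _ _ _
  rw [coef_star, coef, coef, act_idem, act_idem]
  by_cases h : f = f'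
  · subst h; rfl
  · split_ifs <;> simp [h, Ne.symm h]

end Recolour

theorem kerPartition_eq_iff {n : ℕ} {X Y : Type*} {c : Fin n → X} {d : Fin n → Y} :
    kerPartition c = kerPartition d ↔ ∀ x y, c x = c y ↔ d x = d y := by
  constructor
  · intro h x y
    rw [← sameBlock_kerPartition, h, sameBlock_kerPartition]
  · intro h
    exact setPartition_ext fun x y ↦ by rw [sameBlock_kerPartition, sameBlock_kerPartition, h]

/-! ### The words that survive `𝔼_λ y_λ` -/

namespace Multipartition

variable {r n : ℕ} {lam : Multipartition r n} (R : Type*) [CommRing R] [Algebra GroundRing R]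
  {N : ℕ} (hN : ∀ x : lam.Node, Node.col x < N)

/-- The word of `t^λ`, with permuted colours. -/
abbrev iword (σ : Equiv.Perm (Fin r)) : Fin n → Fin N × Fin r :=
  recolour σ (lam.tabWord hN lam.initial)

/-- The image of the word of `t^λ` under `y_λ`. -/
def zVec (σ : Equiv.Perm (Fin r)) : VTensor R N r n :=
  act R lam.yElt (vBasis R N r n (lam.iword hN σ))

theorem iword_lt {σ : Equiv.Perm (Fin r)} {x y : Fin n} (hxy : x < y)
    (h : lam.rowKey x = lam.rowKey y) : (lam.iword hN σ x).1 < (lam.iword hN σ y).1 :=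
  col_lt_of_rowKey_eq hxy h

theorem iword_comp_color {σ : Equiv.Perm (Fin r)} {w : Equiv.Perm (Fin n)}
    (hw : w ∈ fibreSubgroup lam.rowKey) (x : Fin n) :
    (lam.iword hN σ (w x)).2 = σ (lam.initial x).1 :=
  congrArg σ (rowKey_eq_iff.1 (mem_fibreSubgroup.1 hw x)).1

theorem setPartition_eq_ker {σ : Equiv.Perm (Fin r)} {w : Equiv.Perm (Fin n)}
    (hw : w ∈ fibreSubgroup lam.rowKey) :
    lam.setPartition = kerPartition fun x ↦ ((lam.iword hN σ ∘ w) x).2 := by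
  rw [setPartition_eq, kerPartition_eq_iff]
  intro x y
  simp only [Function.comp_apply, iword_comp_color hN hw, EmbeddingLike.apply_eq_iff_eq]

theorem zVec_eq_sum (σ : Equiv.Perm (Fin r)) : lam.zVec R hN σ =
    ∑ w ∈ fibreSubgroup lam.rowKey,
      (-qInvR R) ^ len w • vBasis R N r n (lam.iword hN σ ∘ w.symm) := by
  rw [zVec, yElt_eq]
  exact act_antisymmetrizer_of_lt R monotone_rowKey fun x y hxy h ↦ iword_lt hN hxy h

theorem act_idem_zVec (σ : Equiv.Perm (Fin r)) :
    act R (idem lam.setPartition) (lam.zVec R hN σ) = lam.zVec R hN σ := by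
  rw [zVec_eq_sum, map_sum]
  refine Finset.sum_congr rfl fun w hw ↦ ?_
  rw [map_smul, act_idem, if_pos (setPartition_eq_ker hN (symm_mem_fibreSubgroup hw))]

theorem act_star_idem_zVec (σ : Equiv.Perm (Fin r)) :
    act R (star (idem lam.setPartition)) (lam.zVec R hN σ) = lam.zVec R hN σ := by
  rw [zVec_eq_sum, map_sum]
  refine Finset.sum_congr rfl fun w hw ↦ ?_
  rw [map_smul, act_star_idem, act_idem,
    if_pos (setPartition_eq_ker hN (symm_mem_fibreSubgroup hw))]

/-- The rearrangements of the word of `t^λ` by the row stabilizer. -/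
theorem act_yElt_iword_comp (σ : Equiv.Perm (Fin r)) {w : Equiv.Perm (Fin n)}
    (hw : w ∈ fibreSubgroup lam.rowKey) :
    act R lam.yElt (vBasis R N r n (lam.iword hN σ ∘ w)) =
      (-qInvR R) ^ len w • lam.zVec R hN σ := by
  have hw' := symm_mem_fibreSubgroup hw
  have h1 := act_gPerm_of_lt R (w := w.symm) (F := lam.iword hN σ) fun x y hxy h ↦
    Or.inr (iword_lt hN hxy (eq_of_inversion monotone_rowKey hw' hxy h))
  rw [Equiv.symm_symm] at h1
  rw [← h1, ← act_mul, yElt_eq, act_gPerm_mul_antisymmetrizer R monotone_rowKey _ hw', len_eq_inv,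
    inv_symm, ← len_eq_inv, zVec, yElt_eq]
  intro x y h
  exact congrArg σ (rowKey_eq_iff.1 h).1

theorem iword_comp_injOn (σ : Equiv.Perm (Fin r)) {w w' : Equiv.Perm (Fin n)}
    (hw : w ∈ fibreSubgroup lam.rowKey) (hw' : w' ∈ fibreSubgroup lam.rowKey)
    (h : lam.iword hN σ ∘ w = lam.iword hN σ ∘ w') : w = w' := by
  ext1 x
  have h1 := congrArg (fun p ↦ (p.1 : ℕ)) (congrFun h x)
  have h2 := rowKey_eq_iff.1
    ((mem_fibreSubgroup.1 hw x).trans (mem_fibreSubgroup.1 hw' x).symm)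
  exact lam.initial.injective (node_ext h2.1 h2.2 h1)

/-- The words that are not killed by `𝔼_λ y_λ`. -/
theorem of_act_idem_mul_yElt_ne_zero (hs : ∀ k, ∃ x : lam.Node, x.1 = k)
    {f : Fin n → Fin N × Fin r}
    (h : act R (idem lam.setPartition * lam.yElt) (vBasis R N r n f) ≠ 0) :
    lam.colSum ≤ ∑ x, ((f x).1 : ℕ) ∧ (∑ x, ((f x).1 : ℕ) = lam.colSum →
      ∃ σ, ∃ w ∈ fibreSubgroup lam.rowKey, f = lam.iword hN σ ∘ w) := by
  have hker : lam.setPartition = kerPartition fun x ↦ (f x).2 := by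
    by_contra hc
    exact h (act_idem_mul_of_not_ker R hc _)
  have hker' := hker
  rw [setPartition_eq, kerPartition_eq_iff] at hker'
  rw [act_idem_mul_of_ker R hker, yElt_eq] at h
  have hcol : ∀ x y, lam.rowKey x = lam.rowKey y → (f x).2 = (f y).2 := fun x y hxy ↦
    (hker' x y).1 (rowKey_eq_iff.1 hxy).1
  -- Rows are monochromatic, so a letter repeated in a row is repeated with its colour, and the
  -- antisymmetrizer kills the word.
  have hf : ∀ x y, lam.rowKey x = lam.rowKey y → ((f x).1 : ℕ) = (f y).1 → x = y := by
    intro x y hxy he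
    have he' : f x = f y := Prod.ext (Fin.ext he) (hcol _ _ hxy)
    by_contra hne
    rcases lt_or_gt_of_ne hne with hlt | hlt
    · exact h (act_antisymmetrizer_eq_zero R monotone_rowKey hcol hlt hxy he')
    · exact h (act_antisymmetrizer_eq_zero R monotone_rowKey hcol hlt hxy.symm he'.symm)
  refine ⟨(colSum_le hf).1, fun he ↦ ?_⟩
  obtain ⟨w, hw, hfw⟩ := (colSum_le hf).2 he
  -- The colour is constant on each block and separates blocks. Since no component is empty, the
  -- colours at representatives `p k` define the permutation `σ`.
  choose p hp using hs
  have hp' : ∀ x, (f (lam.initial.symm (p (lam.initial x).1))).2 = (f x).2 := fun x ↦ by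
    rw [← hker']
    simp [hp]
  have hσ : Function.Injective fun k ↦ (f (lam.initial.symm (p k))).2 := by
    intro k k' hk
    have := (hker' _ _).2 hk
    simpa [hp] using this
  refine ⟨Equiv.ofBijective _ (Finite.injective_iff_bijective.1 hσ), w, hw, funext fun x ↦ ?_⟩
  refine Prod.ext (Fin.ext (hfw x)) ?_
  rw [Function.comp_apply, iword_comp_color hN hw]
  exact (hp' x).symm

/-- Rearranged words of tableaux come from multipartitions that agree up to order. -/
theorem comp_eq_of_recolour_eq {nu : Multipartition r n} {hN' : ∀ x : nu.Node, Node.col x < N}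
    {t' : nu.Tab} {t : lam.Tab} {w : Equiv.Perm (Fin n)} {σ : Equiv.Perm (Fin r)}
    (h : nu.tabWord hN' t' = recolour σ (lam.tabWord hN t) ∘ w) (k : Fin r) :
    nu.comp (σ k) = lam.comp k := by
  classical
  refine youngDiagram_eq_of_colLen fun a ↦ ?_
  have h0 : ∀ {m : Multipartition r n} (hm : ∀ x : m.Node, Node.col x < N) (k) (a), N ≤ a →
      (m.comp k).colLen a = 0 := by
    intro m hm k a ha
    by_contra hne
    exact absurd (hm ⟨k, (0, a), YoungDiagram.mem_iff_lt_colLen.2 (Nat.pos_of_ne_zero hne)⟩)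
      ha.not_gt
  rcases le_or_gt N a with ha | ha
  · rw [h0 hN' _ _ ha, h0 hN _ _ ha]
  rw [← card_tabWord hN' t' ⟨a, ha⟩, ← card_tabWord hN t ⟨a, ha⟩, h]
  refine Finset.card_bij (fun x _ ↦ w x) ?_ (fun x _ y _ ↦ fun h ↦ w.injective h) ?_
  · intro x hx
    simpa [recolour, Prod.ext_iff] using hx
  · intro y hy
    exact ⟨w.symm y, by simpa [recolour, Prod.ext_iff] using hy, by simp⟩

theorem sum_tabWord (t : lam.Tab) : ∑ x, ((lam.tabWord hN t x).1 : ℕ) = lam.colSum := sum_col t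

theorem wordLE_iword_comp (σ : Equiv.Perm (Fin r)) {w : Equiv.Perm (Fin n)}
    (hw : w ∈ fibreSubgroup lam.rowKey) : WordLE (lam.iword hN σ ∘ w) (lam.iword hN σ) := by
  refine wordLE_comp_symm (w := w.symm) fun x y hxy h ↦ ?_
  have := eq_of_inversion monotone_rowKey (symm_mem_fibreSubgroup hw) hxy h
  exact ⟨congrArg σ (rowKey_eq_iff.1 this).1, (iword_lt hN hxy this).le⟩

/-- The coefficients of the words of tableaux in the image of the word of `t^λ` under
`y_λ g_{d(t)}`. -/
def tabCoef (t : lam.Tab) (f : Fin n → Fin N × Fin r) : R :=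
  ∑ w ∈ fibreSubgroup lam.rowKey, (-qInvR R) ^ len w *
    coef R (gPerm (lam.dPerm t)) (lam.iword hN 1 ∘ w) f

theorem wordLE_of_coef_dPerm {t : lam.Tab} (ht : lam.IsStd t) {σ : Equiv.Perm (Fin r)} {w : Equiv.Perm (Fin n)}
    (hw : w ∈ fibreSubgroup lam.rowKey) {f : Fin n → Fin N × Fin r}
    (h : coef R (gPerm (lam.dPerm t)) (lam.iword hN σ ∘ w) f ≠ 0) :
    WordLE f (recolour σ (lam.tabWord hN t)) := by
  have := (coef_gPerm_of_wordLE R (w := lam.dPerm t) (wordLE_iword_comp hN σ hw)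
    fun x y hxy hd hc ↦ ht.col_le_of_inversion hxy hd (σ.injective hc)).1 f h
  rwa [← recolour_comp, ← tabWord_comp_symm] at this

theorem wordLE_of_tabCoef {t : lam.Tab} (ht : lam.IsStd t) {f : Fin n → Fin N × Fin r} (h : lam.tabCoef R hN t f ≠ 0) :
    WordLE f (lam.tabWord hN t) := by
  obtain ⟨w, hw, h⟩ := Finset.exists_ne_zero_of_sum_ne_zero h
  exact wordLE_of_coef_dPerm R hN ht hw (right_ne_zero_of_mul h)

/-- A summand with `w ≠ 1` starts from a word strictly below that of `t^λ` and does not reach the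
top word, by `coef_gPerm_of_wordLE`; the summand of `w = 1` is a power of `q`. -/
theorem isUnit_tabCoef {t : lam.Tab} (ht : lam.IsStd t) : IsUnit (lam.tabCoef R hN t (lam.tabWord hN t)) := by
  classical
  have h1 : ∀ w ∈ fibreSubgroup lam.rowKey, coef R (gPerm (lam.dPerm t)) (lam.iword hN 1 ∘ w)
      (lam.tabWord hN t) = if w = 1 then
        qR R ^ equalSteps (lam.iword hN 1) (reducedWord (lam.dPerm t)) else 0 := by
    intro w hw
    have := (coef_gPerm_of_wordLE R (w := lam.dPerm t) (wordLE_iword_comp hN 1 hw)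
      fun x y hxy hd hc ↦ ht.col_le_of_inversion hxy hd hc).2
    have he : lam.iword hN 1 ∘ (lam.dPerm t).symm = lam.tabWord hN t :=
      (tabWord_comp_symm hN t).symm
    rw [he] at this
    rw [this]
    have hi : lam.iword hN 1 ∘ w = lam.iword hN 1 ↔ w = 1 := by
      refine ⟨fun h ↦ iword_comp_injOn hN 1 hw ?_ h, fun h ↦ by rw [h]; rfl⟩
      simp [mem_fibreSubgroup]
    simp only [hi]
  have h2 : lam.tabCoef R hN t (lam.tabWord hN t) =
      qR R ^ equalSteps (lam.iword hN 1) (reducedWord (lam.dPerm t)) := by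
    rw [tabCoef, Finset.sum_eq_single 1]
    · rw [h1 1 (by simp [mem_fibreSubgroup]), if_pos rfl, len_eq_inv]
      have : inv (1 : Equiv.Perm (Fin n)) = 0 := inv_refl
      rw [this, pow_zero, one_mul]
    · intro w hw hne
      rw [h1 w hw, if_neg hne, mul_zero]
    · intro h; exact absurd (by simp [mem_fibreSubgroup]) h
  rw [h2]
  exact (IsUnit.of_mul_eq_one _ (qR_mul_qInvR R)).pow _

end Multipartition

/-! ### Interchanging equal components, and the action on words of tableaux -/

namespace Multipartition

variable {r n : ℕ} {lam : Multipartition r n} (R : Type*) [CommRing R] [Algebra GroundRing R]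
  {N : ℕ} (hN : ∀ x : lam.Node, Node.col x < N)

section BlockSwap

variable {i : Fin (r - 1)} (h : lam.comp (lo i) = lam.comp (hi i))

theorem blockSwap_symm : (lam.blockSwap h).symm = lam.blockSwap h := rfl

theorem initial_blockSwap (x : Fin n) :
    lam.initial (lam.blockSwap h x) = lam.nodeSwap h (lam.initial x) := by
  simp [blockSwap]

theorem blockSwap_blockSwap (x : Fin n) : lam.blockSwap h (lam.blockSwap h x) = x := by
  conv_lhs => rw [← blockSwap_symm]
  exact Equiv.symm_apply_apply _ _

theorem iword_comp_blockSwap (σ : Equiv.Perm (Fin r)) :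
    lam.iword hN σ ∘ lam.blockSwap h = lam.iword hN (σ * adjSwap i) := by
  funext x
  have := initial_blockSwap h x
  refine Prod.ext (Fin.ext ?_) ?_
  · change Node.col (lam.initial (lam.blockSwap h x)) = _
    rw [this]
    rfl
  · change σ (lam.initial (lam.blockSwap h x)).1 = _
    rw [this]
    rfl

theorem rowKey_blockSwap {x y : Fin n} :
    lam.rowKey (lam.blockSwap h x) = lam.rowKey (lam.blockSwap h y) ↔
      lam.rowKey x = lam.rowKey y := by
  rw [rowKey_eq_iff, rowKey_eq_iff, initial_blockSwap, initial_blockSwap]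
  exact and_congr (adjSwap i).apply_eq_iff_eq Iff.rfl

theorem blockSwap_lt {x y : Fin n} (hxy : x < y) (hc : (lam.initial x).1 = (lam.initial y).1) :
    lam.blockSwap h x < lam.blockSwap h y := by
  rw [initial_lt_iff, key_lt_key_iff] at hxy ⊢
  rw [initial_blockSwap, initial_blockSwap]
  rcases hxy with hxy | hxy
  · exact absurd hc hxy.ne
  · exact Or.inr ⟨congrArg (adjSwap i) hc, hxy.2⟩

/-- Conjugation by the interchange of two blocks. -/
def blockConj (w : Equiv.Perm (Fin n)) : Equiv.Perm (Fin n) :=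
  (lam.blockSwap h).trans (w.trans (lam.blockSwap h))

theorem blockConj_blockConj (w : Equiv.Perm (Fin n)) : blockConj h (blockConj h w) = w := by
  ext x
  simp [blockConj, blockSwap_blockSwap]

theorem blockConj_mem {w : Equiv.Perm (Fin n)} (hw : w ∈ fibreSubgroup lam.rowKey) :
    blockConj h w ∈ fibreSubgroup lam.rowKey := by
  rw [mem_fibreSubgroup] at hw ⊢
  intro x
  have := (rowKey_blockSwap h).2 (hw (lam.blockSwap h x))
  rwa [blockSwap_blockSwap] at this

/-- Inversions of `w` lie in rows, and `B_i` preserves the order inside each block, so it maps them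
to inversions of the conjugate. Conjugation being an involution, the reverse inequality is the same
statement. -/
theorem inv_blockConj_le {w : Equiv.Perm (Fin n)} (hw : w ∈ fibreSubgroup lam.rowKey) :
    inv w ≤ inv (blockConj h w) := by
  refine Finset.card_le_card_of_injOn
    (fun p ↦ (lam.blockSwap h p.1, lam.blockSwap h p.2)) ?_ ?_
  · rintro ⟨x, y⟩ hxy
    simp only [Finset.coe_filter, Finset.mem_univ, true_and, Set.mem_ofPred_eq] at hxy ⊢
    have h1 := eq_of_inversion monotone_rowKey hw hxy.1 hxy.2
    have h2 : (lam.initial x).1 = (lam.initial y).1 := (rowKey_eq_iff.1 h1).1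
    refine ⟨blockSwap_lt h hxy.1 h2, ?_⟩
    simp only [blockConj, Equiv.trans_apply, blockSwap_blockSwap]
    refine blockSwap_lt h hxy.2 ?_
    have e1 := (rowKey_eq_iff.1 (mem_fibreSubgroup.1 hw x)).1
    have e2 := (rowKey_eq_iff.1 (mem_fibreSubgroup.1 hw y)).1
    rw [e1, e2, h2]
  · rintro ⟨x, y⟩ _ ⟨x', y'⟩ _ hxy
    simpa using hxy

theorem len_blockConj {w : Equiv.Perm (Fin n)} (hw : w ∈ fibreSubgroup lam.rowKey) :
    len (blockConj h w) = len w := by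
  rw [len_eq_inv, len_eq_inv]
  refine le_antisymm ?_ (inv_blockConj_le h hw)
  conv_rhs => rw [← blockConj_blockConj h w]
  exact inv_blockConj_le h (blockConj_mem h hw)

/-- `B_i` inverts only pairs in different blocks, where the colours differ, so `g_{B_i}` merely
moves positions. On the word of `t^λ` this exchanges two colours, and the row rearrangements are
conjugated by `B_i`, which preserves their lengths. -/
theorem act_gPerm_blockSwap (σ : Equiv.Perm (Fin r)) :
    act R (gPerm (lam.blockSwap h)) (lam.zVec R hN σ) = lam.zVec R hN (σ * adjSwap i) := by
  rw [zVec_eq_sum, zVec_eq_sum, map_sum]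
  refine Finset.sum_nbij' (blockConj h) (blockConj h) (fun w hw ↦ blockConj_mem h hw)
    (fun w hw ↦ blockConj_mem h hw) (fun w _ ↦ blockConj_blockConj h w)
    (fun w _ ↦ blockConj_blockConj h w) fun w hw ↦ ?_
  have hw' := symm_mem_fibreSubgroup hw
  rw [map_smul, len_blockConj h hw, act_gPerm_of_lt, blockSwap_symm]
  · congr 2
    rw [← iword_comp_blockSwap hN h]
    funext x
    simp [blockConj, blockSwap_symm, blockSwap_blockSwap]
  · intro x y hxy hB
    left
    simp only [Function.comp_apply, iword_comp_color hN hw', ne_eq, EmbeddingLike.apply_eq_iff_eq]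
    intro hc
    exact absurd hB (blockSwap_lt h hxy hc).not_gt

theorem act_bGen (h : lam.comp (lo i) = lam.comp (hi i)) (σ : Equiv.Perm (Fin r)) :
    act R (lam.bGen i) (lam.zVec R hN σ) = lam.zVec R hN (σ * adjSwap i) := by
  rw [bGen, dif_pos h, act_mul, act_idem_zVec, act_gPerm_blockSwap]

theorem act_star_bGen (h : lam.comp (lo i) = lam.comp (hi i)) (σ : Equiv.Perm (Fin r)) :
    act R (star (lam.bGen i)) (lam.zVec R hN σ) = lam.zVec R hN (σ * adjSwap i) := by
  rw [bGen, dif_pos h, star_mul, star_gPerm, blockSwap_symm, act_mul, act_gPerm_blockSwap,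
    act_star_idem_zVec]

end BlockSwap

/-- Each letter `s_i` multiplies the colour permutation by `s_i` on the right. Since `wordPerm`
composes with `trans`, opposite to `*`, the product is the inverse of `w` here, and `w` itself in
`act_star_bPerm`. -/
theorem act_bPerm {w : Equiv.Perm (Fin r)}
    (hw : ∀ i ∈ reducedWord w, lam.comp (lo i) = lam.comp (hi i)) (σ : Equiv.Perm (Fin r)) :
    act R (lam.bPerm w) (lam.zVec R hN σ) = lam.zVec R hN (σ * w⁻¹) := by
  have : ∀ l : List (Fin (r - 1)), (∀ i ∈ l, lam.comp (lo i) = lam.comp (hi i)) → ∀ σ,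
      act R (l.map lam.bGen).prod (lam.zVec R hN σ) = lam.zVec R hN (σ * (wordPerm l)⁻¹) := by
    intro l
    induction l with
    | nil => intro _ σ; rw [List.map_nil, List.prod_nil, act_one]; rfl
    | cons i l ih =>
      intro hl σ
      rw [List.map_cons, List.prod_cons, act_mul, act_bGen R hN (hl i (by simp)),
        ih (fun j hj ↦ hl j (by simp [hj]))]
      rfl
  rw [bPerm, act_mul, act_idem_zVec, this _ hw, wordPerm_reducedWord]

theorem act_star_bPerm {w : Equiv.Perm (Fin r)}
    (hw : ∀ i ∈ reducedWord w, lam.comp (lo i) = lam.comp (hi i)) (σ : Equiv.Perm (Fin r)) :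
    act R (star (lam.bPerm w)) (lam.zVec R hN σ) = lam.zVec R hN (σ * w) := by
  have : ∀ l : List (Fin (r - 1)), (∀ i ∈ l, lam.comp (lo i) = lam.comp (hi i)) → ∀ σ,
      act R (star (l.map lam.bGen).prod) (lam.zVec R hN σ) = lam.zVec R hN (σ * wordPerm l) := by
    intro l
    induction l with
    | nil => intro _ σ; rw [List.map_nil, List.prod_nil, star_one, act_one]; rfl
    | cons i l ih =>
      intro hl σ
      rw [List.map_cons, List.prod_cons, star_mul, act_mul, ih (fun j hj ↦ hl j (by simp [hj])),
        act_star_bGen R hN (hl i (by simp))]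
      rfl
  rw [bPerm, star_mul, act_mul, this _ hw, wordPerm_reducedWord, act_star_idem_zVec]

/-- The image of a word under the first factors of `n_{𝔰𝔱}`. -/
theorem act_star_gPerm_mul (t : lam.Tab) (f : Fin n → Fin N × Fin r) :
    act R (star (gPerm (lam.dPerm t)) * idem lam.setPartition * lam.yElt) (vBasis R N r n f) =
      ∑ f', coef R (gPerm (lam.dPerm t)) f' f •
        act R (idem lam.setPartition * lam.yElt) (vBasis R N r n f') := by
  rw [mul_assoc, act_mul, act_eq_sum, map_sum]
  exact Finset.sum_congr rfl fun f' _ ↦ by rw [map_smul, coef_star]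

variable {le : YoungDiagram → YoungDiagram → Prop} [Std.Antisymm le]

/-- Some rearrangement of the word of `t'` survives `𝔼_λ y_λ`, and rearranging keeps the letter sum.
In the case of equality the word of `t'` is a recoloured rearrangement of the word of `t^λ`, so the
two multipartitions agree up to order, and both are sorted. -/
theorem colSum_le_of_act_ne_zero {nu : Multipartition r n}
    (hN : ∀ x : lam.Node, Node.col x < N) (hN' : ∀ x : nu.Node, Node.col x < N)
    (hs : ∀ k, ∃ x : lam.Node, x.1 = k)
    (hlam : ∀ i j, i ≤ j → le (lam.comp i) (lam.comp j))
    (hnu : ∀ i j, i ≤ j → le (nu.comp i) (nu.comp j)) {t : lam.Tab} {t' : nu.Tab}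
    (h : act R (star (gPerm (lam.dPerm t)) * idem lam.setPartition * lam.yElt)
      (vBasis R N r n (nu.tabWord hN' t')) ≠ 0) :
    lam.colSum ≤ nu.colSum ∧ (lam.colSum = nu.colSum → nu = lam) := by
  rw [act_star_gPerm_mul] at h
  obtain ⟨f, -, h⟩ := Finset.exists_ne_zero_of_sum_ne_zero h
  have h1 : coef R (gPerm (lam.dPerm t)) f (nu.tabWord hN' t') ≠ 0 := fun hc ↦ h (by
    rw [hc, zero_smul])
  have h2 : act R (idem lam.setPartition * lam.yElt) (vBasis R N r n f) ≠ 0 := fun hc ↦ h (by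
    rw [hc, smul_zero])
  obtain ⟨w, hw⟩ := exists_perm_of_coef_ne_zero R _ _ _ h1
  have h3 : ∑ x, ((f x).1 : ℕ) = nu.colSum := by
    rw [← sum_tabWord hN' t', hw]
    exact (Equiv.sum_comp w fun x ↦ ((f x).1 : ℕ)).symm
  obtain ⟨h4, h5⟩ := of_act_idem_mul_yElt_ne_zero R hN hs h2
  rw [h3] at h4 h5
  refine ⟨h4, fun he ↦ ?_⟩
  obtain ⟨σ, v, -, rfl⟩ := h5 he.symm
  have h6 := comp_eq_of_recolour_eq hN (w := v * w) hw
  exact Multipartition.ext (eq_of_sorted hnu hlam σ h6)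

/-- The case of equal multipartitions. -/
theorem act_star_gPerm_mul_tabWord (hs : ∀ k, ∃ x : lam.Node, x.1 = k) {t t' : lam.Tab}
    (ht : lam.IsStd t) (hi : lam.IsIncreasing t) (hi' : lam.IsIncreasing t') :
    act R (star (gPerm (lam.dPerm t)) * idem lam.setPartition * lam.yElt)
      (vBasis R N r n (lam.tabWord hN t')) =
        lam.tabCoef R hN t (lam.tabWord hN t') • lam.zVec R hN 1 := by
  classical
  rw [act_star_gPerm_mul, tabCoef, Finset.sum_smul]
  symm
  refine Finset.sum_of_injOn (fun w : Equiv.Perm (Fin n) ↦ lam.iword hN 1 ∘ w)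
    (fun w hw w' hw' h ↦ iword_comp_injOn hN 1 hw hw' h) (fun w _ ↦ Finset.mem_univ _)
    (fun f _ hf ↦ ?_) fun w hw ↦ ?_
  · by_contra h
    have h1 : coef R (gPerm (lam.dPerm t)) f (lam.tabWord hN t') ≠ 0 := fun hc ↦ h (by
      rw [hc, zero_smul])
    have h2 : act R (idem lam.setPartition * lam.yElt) (vBasis R N r n f) ≠ 0 := fun hc ↦ h (by
      rw [hc, smul_zero])
    obtain ⟨w, hw⟩ := exists_perm_of_coef_ne_zero R _ _ _ h1
    have h3 : ∑ x, ((f x).1 : ℕ) = lam.colSum := by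
      rw [← sum_tabWord hN t', hw]
      exact (Equiv.sum_comp w fun x ↦ ((f x).1 : ℕ)).symm
    obtain ⟨σ, v, hv, rfl⟩ := (of_act_idem_mul_yElt_ne_zero R hN hs h2).2 h3
    have h6 := comp_eq_of_recolour_eq hN (w := v * w) hw
    -- Words that are comparable have the same colours, so `t'` has the components of `t` permuted
    -- by `σ`; as both tableaux are increasing, `σ` is trivial.
    have h7 := hi.eq_refl hi' h6 (wordLE_of_coef_dPerm R hN ht hv h1).1
    exact hf ⟨v, hv, by rw [h7]; rfl⟩
  · rw [act_idem_mul_of_ker R (setPartition_eq_ker hN hw), act_yElt_iword_comp R hN 1 hw, smul_smul,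
      mul_comm]

/-- The word of `t'` recoloured by `τ` occurs only if `τ⁻¹ σ` matches the components of two
increasing tableaux, hence only for `σ = τ`. So the colour permutation can be read off from
coefficients. -/
theorem repr_act_gPerm_zVec {t t' : lam.Tab} (ht : lam.IsStd t) (hi : lam.IsIncreasing t)
    (hi' : lam.IsIncreasing t') (σ τ : Equiv.Perm (Fin r)) :
    (vBasis R N r n).repr (act R (gPerm (lam.dPerm t)) (lam.zVec R hN σ))
      (recolour τ (lam.tabWord hN t')) =
        if σ = τ then lam.tabCoef R hN t (lam.tabWord hN t') else 0 := by
  have h1 : (vBasis R N r n).repr (act R (gPerm (lam.dPerm t)) (lam.zVec R hN σ))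
      (recolour τ (lam.tabWord hN t')) = ∑ w ∈ fibreSubgroup lam.rowKey, (-qInvR R) ^ len w *
        coef R (gPerm (lam.dPerm t)) (lam.iword hN σ ∘ w) (recolour τ (lam.tabWord hN t')) := by
    rw [zVec_eq_sum, map_sum, map_sum, Finsupp.finsetSum_apply]
    refine Finset.sum_nbij' (fun w ↦ w.symm) (fun w ↦ w.symm)
      (fun w hw ↦ symm_mem_fibreSubgroup hw) (fun w hw ↦ symm_mem_fibreSubgroup hw) (fun _ _ ↦ rfl)
      (fun _ _ ↦ rfl) fun w _ ↦ ?_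
    rw [map_smul, map_smul, len_eq_inv, len_eq_inv, inv_symm]
    rfl
  rw [h1]
  split_ifs with h
  · subst h
    refine Finset.sum_congr rfl fun w _ ↦ ?_
    rw [← coef_recolour R σ (f' := lam.tabWord hN t')]
    rfl
  · refine Finset.sum_eq_zero fun w hw ↦ ?_
    by_contra hc
    have hc := right_ne_zero_of_mul hc
    obtain ⟨v, hv⟩ := exists_perm_of_coef_ne_zero R _ _ _ hc
    have hv' : lam.tabWord hN t' = recolour (τ⁻¹ * σ) (lam.tabWord hN lam.initial) ∘ (w * v) := by
      apply recolour_injective τ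
      rw [hv, recolour_comp, recolour_recolour, mul_inv_cancel_left]
      rfl
    have h6 := comp_eq_of_recolour_eq hN hv'
    have h7 := hi.eq_refl hi' h6 fun x ↦ by
      have := (wordLE_of_coef_dPerm R hN ht hw hc).1 x
      apply τ.injective
      exact this.trans (τ.apply_symm_apply _).symm
    exact h (inv_mul_eq_one.1 h7).symm

end Multipartition

/-! ### Signs -/

theorem neg_one_pow_len {n : ℕ} (w : Equiv.Perm (Fin n)) :
    (-1 : ℤ) ^ len w = (Equiv.Perm.sign w : ℤ) := by
  have : ∀ l : List (Fin (n - 1)), (Equiv.Perm.sign (wordPerm l) : ℤ) = (-1) ^ l.length := by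
    intro l
    induction l with
    | nil => simp [wordPerm]
    | cons i l ih =>
      rw [wordPerm, Equiv.Perm.sign_trans, Units.val_mul, ih, adjSwap,
        Equiv.Perm.sign_swap (lo_lt_hi i).ne, List.length_cons, pow_succ]
      simp
  rw [len, ← this, wordPerm_reducedWord]

/-! ### The rank of a word -/

section Rank

variable {n N r : ℕ}

/-- A statistic that is strictly monotone for the order on words. -/
def wordRank (f : Fin n → Fin N × Fin r) : ℕ :=
  ∑ c, ∑ a, ∑ m ∈ Finset.range (n + 1), wordCount f c a m

theorem WordLE.rank_le {f f' : Fin n → Fin N × Fin r} (h : WordLE f' f) :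
    wordRank f' ≤ wordRank f :=
  Finset.sum_le_sum fun _ _ ↦ Finset.sum_le_sum fun _ _ ↦ Finset.sum_le_sum fun _ _ ↦ h.2 _ _ _

theorem WordLE.eq_of_rank_eq {f f' : Fin n → Fin N × Fin r} (h : WordLE f' f)
    (hr : wordRank f' = wordRank f) : f' = f := by
  refine h.antisymm ⟨fun x ↦ (h.1 x).symm, fun c a m ↦ ?_⟩
  have h1 := (Finset.sum_eq_sum_iff_of_le fun c _ ↦ Finset.sum_le_sum fun a _ ↦
    Finset.sum_le_sum fun m _ ↦ h.2 c a m).1 hr c (Finset.mem_univ _)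
  have h2 := (Finset.sum_eq_sum_iff_of_le fun a _ ↦
    Finset.sum_le_sum fun m _ ↦ h.2 c a m).1 h1 a (Finset.mem_univ _)
  have h3 := (Finset.sum_eq_sum_iff_of_le fun m _ ↦ h.2 c a m).1 h2
  have h4 : ∀ f : Fin n → Fin N × Fin r, wordCount f c a m = wordCount f c a (min m n) := by
    intro f
    rw [wordCount, wordCount]
    congr 1
    ext x
    simp
  rw [h4 f, h4 f', h3 _ (Finset.mem_range.2 (by omega))]

end Rank

/-! ### The permutation analogue of the coefficients -/

namespace Multipartition

section Sign

variable {s r : ℕ} {mu mu' : Multipartition s r}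

theorem IsInitialKind.initial_dPerm {u : mu.Tab} (hu : mu.IsInitialKind u) (x : Fin r) :
    (mu.initial (mu.dPerm u x)).1 = (mu.initial x).1 := by
  rw [← hu, dPerm]
  simp

/-- The word of a tableau with as many letters as entries. -/
abbrev ownWord (u : mu.Tab) : Fin r → Fin r × Fin s := mu.tabWord col_lt u

open Classical in
/-- The sum of the signs of the elements of the row stabilizer that lead from one word to
another. -/
def signSum (mu : Multipartition s r) (F G : Fin r → Fin r × Fin s) : ℤ :=
  ∑ w ∈ mu.youngSubgroup, if F ∘ w.symm = G then (-1) ^ len w else 0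

/-- Composition with the transposition of `x` and `y` is a sign-reversing involution of the row
stabilizer that leaves the rearranged words unchanged. -/
theorem signSum_eq_zero {F G : Fin r → Fin r × Fin s} {x y : Fin r} (hne : x ≠ y)
    (h : mu.rowKey x = mu.rowKey y) (hF : F x = F y) : mu.signSum F G = 0 := by
  classical
  have hsw : F ∘ Equiv.swap x y = F := by
    funext z
    simp only [Function.comp_apply, Equiv.swap_apply_def]
    split_ifs with h1 h2
    · rw [h1, hF]
    · rw [h2, hF]
    · rfl
  have hs : ∀ w : Equiv.Perm (Fin r),
      F ∘ ((Equiv.swap x y).trans w).symm = F ∘ w.symm := fun w ↦ by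
    conv_rhs => rw [← hsw]
    rfl
  have hmem : Equiv.swap x y ∈ fibreSubgroup mu.rowKey := by
    rw [mem_fibreSubgroup]
    intro z
    rw [Equiv.swap_apply_def]
    split_ifs with h1 h2
    · rw [h1, h]
    · rw [h2, h]
    · rfl
  rw [signSum, youngSubgroup_eq]
  refine Finset.sum_involution (fun w _ ↦ (Equiv.swap x y).trans w) (fun w _ ↦ ?_)
    (fun w _ _ hw ↦ ?_) (fun w hw ↦ trans_mem_fibreSubgroup hmem hw) fun w _ ↦ ?_
  · rw [hs]
    simp only [neg_one_pow_len, Equiv.Perm.sign_trans, Equiv.Perm.sign_swap hne]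
    split_ifs <;> simp
  · have := Equiv.ext_iff.1 hw x
    simp only [Equiv.trans_apply, Equiv.swap_apply_left, EmbeddingLike.apply_eq_iff_eq] at this
    exact hne this.symm
  · ext z; simp

theorem ownWord_comp_color {u : mu.Tab} {u' : mu'.Tab} (hu : mu.IsInitialKind u)
    (hu' : mu'.IsInitialKind u') (hc : ∀ x, (mu'.initial x).1 = (mu.initial x).1) (x : Fin r) :
    ((ownWord u' ∘ mu.dPerm u) x).2 = (mu.initial x).1 :=
  (hu' _).trans ((hc _).trans (hu.initial_dPerm x))

/-- The counterpart of `of_act_idem_mul_yElt_ne_zero`: by `signSum_eq_zero` the letters are distinct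
in rows, so `colSum_le` applies. No recolouring arises, because tableaux of the initial kind keep
every number in its component. -/
theorem exists_of_signSum_ne_zero {u : mu.Tab} {u' : mu'.Tab} (hu : mu.IsInitialKind u)
    (hu' : mu'.IsInitialKind u') (hc : ∀ x, (mu'.initial x).1 = (mu.initial x).1)
    {G : Fin r → Fin r × Fin s} (h : mu.signSum (ownWord u' ∘ mu.dPerm u) G ≠ 0) :
    mu.colSum ≤ mu'.colSum ∧ (mu.colSum = mu'.colSum → ∃ w ∈ fibreSubgroup mu.rowKey,
      ownWord u' ∘ mu.dPerm u = mu.iword col_lt 1 ∘ w) := by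
  have hF := ownWord_comp_color hu hu' hc
  set F := ownWord u' ∘ mu.dPerm u with hFdef
  have hsum : ∑ x, ((F x).1 : ℕ) = mu'.colSum := by
    rw [← sum_tabWord col_lt u']
    exact Equiv.sum_comp (mu.dPerm u) fun x ↦ ((ownWord u' x).1 : ℕ)
  have hinj : ∀ x y, mu.rowKey x = mu.rowKey y → ((F x).1 : ℕ) = (F y).1 → x = y := by
    intro x y hxy he
    by_contra hne
    refine h (signSum_eq_zero hne hxy (Prod.ext (Fin.ext he) ?_))
    rw [hF, hF, (rowKey_eq_iff.1 hxy).1]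
  rw [← hsum]
  refine ⟨(colSum_le hinj).1, fun he ↦ ?_⟩
  obtain ⟨w, hw, hFw⟩ := (colSum_le hinj).2 he.symm
  refine ⟨w, hw, funext fun x ↦ Prod.ext (Fin.ext (hFw x)) ?_⟩
  rw [hF, Function.comp_apply, iword_comp_color col_lt hw]
  rfl

theorem colSum_le_of_signSum_ne_zero {u : mu.Tab} {u' : mu'.Tab} (hu : mu.IsInitialKind u)
    (hu' : mu'.IsInitialKind u') (hc : ∀ x, (mu'.initial x).1 = (mu.initial x).1)
    {G : Fin r → Fin r × Fin s} (h : mu.signSum (ownWord u' ∘ mu.dPerm u) G ≠ 0) :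
    mu.colSum ≤ mu'.colSum ∧ (mu.colSum = mu'.colSum → mu' = mu) := by
  refine ⟨(exists_of_signSum_ne_zero hu hu' hc h).1, fun he ↦ ?_⟩
  obtain ⟨w, -, hF⟩ := (exists_of_signSum_ne_zero hu hu' hc h).2 he
  have hF' : ownWord u' =
      recolour 1 (mu.tabWord col_lt mu.initial) ∘ ((mu.dPerm u).symm.trans w) := by
    funext x
    have := congrFun hF ((mu.dPerm u).symm x)
    simpa using this
  exact Multipartition.ext (funext (comp_eq_of_recolour_eq (N := r) col_lt hF'))

theorem wordLE_of_dPerm_comp {u u' : mu.Tab} (hu : mu.IsStd u) {w : Equiv.Perm (Fin r)}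
    (hw : w ∈ fibreSubgroup mu.rowKey)
    (h : ownWord u' ∘ mu.dPerm u = mu.iword col_lt 1 ∘ w) : WordLE (ownWord u') (ownWord u) := by
  have h1 := (wordLE_iword_comp (N := r) col_lt 1 hw).comp_symm (w := mu.dPerm u)
    fun x y hxy hd hc ↦ hu.col_le_of_inversion hxy hd hc
  rw [← h] at h1
  have h2 : mu.iword (N := r) col_lt 1 ∘ (mu.dPerm u).symm = ownWord u :=
    (tabWord_comp_symm col_lt u).symm
  rw [h2] at h1
  convert h1 using 1
  funext x
  simp

/-- Both words are row rearrangements of the word of `t^μ`: the first by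
`exists_of_signSum_ne_zero`, the second because some element of the row stabilizer joins it to the
first. -/
theorem wordLE_of_signSum_ne_zero {u v u' v' : mu.Tab} (hu : mu.IsStd u) (hv : mu.IsStd v)
    (hui : mu.IsInitialKind u) (hui' : mu.IsInitialKind u')
    (h : mu.signSum (ownWord u' ∘ mu.dPerm u) (ownWord v' ∘ mu.dPerm v) ≠ 0) :
    WordLE (ownWord u') (ownWord u) ∧ WordLE (ownWord v') (ownWord v) := by
  obtain ⟨w, hw, hF⟩ := (exists_of_signSum_ne_zero hui hui' (fun _ ↦ rfl) h).2 rfl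
  refine ⟨wordLE_of_dPerm_comp hu hw hF, ?_⟩
  obtain ⟨w', hw', h'⟩ := Finset.exists_ne_zero_of_sum_ne_zero h
  have hG : (ownWord u' ∘ mu.dPerm u) ∘ w'.symm = ownWord v' ∘ mu.dPerm v := by
    by_contra hc
    exact h' (if_neg hc)
  rw [youngSubgroup_eq] at hw'
  refine wordLE_of_dPerm_comp hv
    (trans_mem_fibreSubgroup (symm_mem_fibreSubgroup hw') hw) (hG.symm.trans ?_)
  rw [hF]
  rfl

/-- Both words become that of `t^μ`, whose letters are distinct in rows, so only `w = 1`
contributes. -/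
theorem signSum_self (u v : mu.Tab) :
    mu.signSum (ownWord u ∘ mu.dPerm u) (ownWord v ∘ mu.dPerm v) = 1 := by
  classical
  have h1 : ∀ u : mu.Tab, ownWord u ∘ mu.dPerm u = mu.iword col_lt 1 := fun u ↦ by
    rw [ownWord, tabWord_comp_symm]
    funext x
    simp [recolour_one]
  rw [h1, h1, signSum, youngSubgroup_eq, Finset.sum_eq_single 1]
  · have : inv (1 : Equiv.Perm (Fin r)) = 0 := inv_refl
    rw [if_pos (by rfl), len_eq_inv, this, pow_zero]
  · intro w hw hne
    rw [if_neg]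
    intro h
    apply hne
    have := iword_comp_injOn (N := r) col_lt 1 (symm_mem_fibreSubgroup hw)
      (w' := 1) (by simp [mem_fibreSubgroup]) h
    rw [← w.symm_symm, this]
    rfl
  · intro h; exact absurd (by simp [mem_fibreSubgroup]) h

theorem card_comp_initial (k : Fin s) :
    (Finset.univ.filter fun x ↦ (mu.initial x).1 = k).card = (mu.comp k).card := by
  refine Finset.card_bij' (fun x _ ↦ (mu.initial x).2.1) (fun c hc ↦ mu.initial.symm ⟨k, c, hc⟩)
    ?_ ?_ ?_ ?_
  · intro x hx
    rw [Finset.mem_filter_univ] at hx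
    subst hx
    exact (mu.initial x).2.2
  · intro c hc
    rw [Finset.mem_filter_univ, Equiv.apply_symm_apply]
  · intro x hx
    rw [Finset.mem_filter_univ] at hx
    rw [Equiv.symm_apply_eq]
    exact node_ext hx.symm rfl rfl
  · intro c hc
    have := mu.initial.apply_symm_apply ⟨k, c, hc⟩
    exact (congrArg (fun x : mu.Node ↦ x.2.1) this :)

end Sign

end Multipartition

theorem count_ofFn {X : Type*} [DecidableEq X] {r : ℕ} (f : Fin r → X) (D : X) :
    (List.ofFn f).count D = (Finset.univ.filter fun j ↦ f j = D).card := by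
  rw [← Multiset.coe_count, ← Fin.univ_val_map, Multiset.count_map, Finset.card_def,
    Finset.filter_val]
  simp only [eq_comm]

/-! ### Compatibility of the two multipartitions of a label -/

namespace Label

open Multipartition

variable {le : YoungDiagram → YoungDiagram → Prop} {n : ℕ} {α : n.Partition} (L : Label le α)

/-- `A_λ` has `r` blocks, as many as `α` has parts, and they come from the non-empty ones among the
`r` components. -/
theorem exists_node (k : Fin α.parts.card) : ∃ x : L.lam.Node, x.1 = k := by
  classical
  have h := congrArg Multiset.card L.type_eq
  rw [blockSizes, Multiset.card_map] at h
  let c := fun i ↦ (L.lam.initial i).1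
  have h1 : L.lam.setPartition.parts ⊆
      (Finset.univ.image c).image fun k ↦ Finset.univ.filter fun i ↦ c i = k := by
    intro p hp
    obtain ⟨x, hx⟩ := L.lam.setPartition.nonempty_of_mem_parts hp
    rw [Finset.mem_image]
    refine ⟨c x, Finset.mem_image_of_mem _ (Finset.mem_univ _), ?_⟩
    rw [← L.lam.setPartition.part_eq_of_mem hp hx]
    ext i
    rw [mem_part_iff, setPartition_eq, sameBlock_kerPartition, Finset.mem_filter_univ]
  have h2 := (Finset.card_le_card h1).trans Finset.card_image_le
  have h3 : Finset.univ.image c = Finset.univ := by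
    rw [← Finset.card_eq_iff_eq_univ, Fintype.card_fin]
    refine le_antisymm ((Finset.card_le_univ _).trans_eq (Fintype.card_fin _)) ?_
    exact h.ge.trans h2
  obtain ⟨x, -, hx⟩ := Finset.mem_image.1 (h3 ▸ Finset.mem_univ k)
  exact ⟨L.lam.initial x, hx⟩

/-- Both sides are sorted families in which the `k`-th distinct shape occurs `m_k` times, on the
left because `μ^{(k)}` has `m_k` nodes. So a component of `t^μ` contains the numbers of the
components of `λ` of one shape. -/
theorem shapes_get_initial [IsLinearOrder YoungDiagram le] (j : Fin α.parts.card) :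
    L.lam.shapes.get (L.mu.initial j).1 = L.lam.comp j := by
  classical
  have hnd : L.lam.shapes.Nodup := List.nodup_dedup _
  have hinj : Function.Injective L.lam.shapes.get := List.nodup_iff_injective_get.1 hnd
  have hsorted : L.lam.shapes.Pairwise le :=
    (List.pairwise_ofFn.2 fun i j hij ↦ L.increasing i j hij.le).sublist (List.dedup_sublist _)
  have hperm : (List.ofFn fun j ↦ L.lam.shapes.get (L.mu.initial j).1).Perm
      (List.ofFn L.lam.comp) := by
    rw [List.perm_iff_count]
    intro D
    by_cases hD : D ∈ L.lam.shapes
    · obtain ⟨k, rfl⟩ := List.get_of_mem hD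
      rw [count_ofFn]
      simp only [hinj.eq_iff]
      rw [card_comp_initial, L.card_mu, mult]
    · rw [List.count_eq_zero_of_not_mem, List.count_eq_zero_of_not_mem]
      · exact fun h ↦ hD (List.mem_dedup.2 h)
      · rw [List.mem_ofFn]
        rintro ⟨j, rfl⟩
        exact hD (List.get_mem _ _)
  have hrefl : ∀ D, le D D := fun D ↦ Std.Refl.refl D
  have := List.ofFn_injective (hperm.eq_of_pairwise (le := le)
    (fun a b _ _ ↦ Std.Antisymm.antisymm a b) (List.pairwise_ofFn.2 fun i j hij ↦ ?_)
    (List.pairwise_ofFn.2 fun i j hij ↦ L.increasing i j hij.le))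
  · exact congrFun this j
  · rcases (monotone_comp_initial (lam := L.mu) hij.le).eq_or_lt with h | h
    · change (L.mu.initial i).1 = (L.mu.initial j).1 at h
      rw [h]
      exact hrefl _
    · exact List.pairwise_iff_get.1 hsorted _ _ h

theorem comp_eq_of_initial_eq [IsLinearOrder YoungDiagram le] {i j : Fin α.parts.card}
    (h : (L.mu.initial i).1 = (L.mu.initial j).1) : L.lam.comp i = L.lam.comp j := by
  rw [← shapes_get_initial, ← shapes_get_initial, h]

/-- Ensures that `bGen` never takes its default value `1` along the words that enter `n_{𝔰𝔱}`. -/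
theorem reducedWord_comp_eq [IsLinearOrder YoungDiagram le] {w : Equiv.Perm (Fin α.parts.card)}
    (hw : ∀ j, (L.mu.initial (w j)).1 = (L.mu.initial j).1) :
    ∀ i ∈ reducedWord w, L.lam.comp (lo i) = L.lam.comp (hi i) := fun i hi ↦
  L.comp_eq_of_initial_eq ((isReduced_reducedWord w).class_eq monotone_comp_initial
    (by rw [wordPerm_reducedWord]; exact hw) i hi)

theorem col_lt_of_columnsLE {N : ℕ} (h : L.ColumnsLE N) (x : L.lam.Node) : Node.col x < N := by
  refine lt_of_lt_of_le ?_ (h x.1)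
  rw [← YoungDiagram.mem_iff_lt_rowLen]
  exact (L.lam.comp _).up_left_mem (Nat.zero_le _) le_rfl x.2.2

end Label

open Multipartition

/-! ### Finiteness -/

theorem youngDiagram_mem_lt {D : YoungDiagram} {c : ℕ × ℕ} (h : c ∈ D) :
    c.1 < D.card ∧ c.2 < D.card := by
  constructor
  · have : (Finset.range (c.1 + 1)).card ≤ D.card := by
      refine Finset.card_le_card_of_injOn (fun i ↦ (i, c.2)) (fun i hi ↦ ?_) ?_
      · exact D.up_left_mem (Nat.lt_succ_iff.1 (Finset.mem_range.1 hi)) le_rfl h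
      · intro i _ j _ hij; exact congrArg Prod.fst hij
    rwa [Finset.card_range] at this
  · have : (Finset.range (c.2 + 1)).card ≤ D.card := by
      refine Finset.card_le_card_of_injOn (fun i ↦ (c.1, i)) (fun i hi ↦ ?_) ?_
      · exact D.up_left_mem le_rfl (Nat.lt_succ_iff.1 (Finset.mem_range.1 hi)) h
      · intro i _ j _ hij; exact congrArg Prod.snd hij
    rwa [Finset.card_range] at this

instance finite_youngDiagram (k : ℕ) : Finite {D : YoungDiagram // D.card ≤ k} := by
  refine Finite.of_injective (β := (Finset.range k ×ˢ Finset.range k).powerset)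
    (fun D ↦ ⟨D.1.cells, Finset.mem_powerset.2 fun c hc ↦ ?_⟩) ?_
  · have := youngDiagram_mem_lt hc
    rw [Finset.mem_product, Finset.mem_range, Finset.mem_range]
    exact ⟨this.1.trans_le D.2, this.2.trans_le D.2⟩
  · intro D E h
    exact Subtype.ext (YoungDiagram.ext (congrArg Subtype.val h))

instance finite_multipartition (r n : ℕ) : Finite (Multipartition r n) := by
  refine Finite.of_injective (β := Fin r → {D : YoungDiagram // D.card ≤ n})
    (fun lam k ↦ ⟨lam.comp k, ?_⟩) ?_
  · refine le_of_le_of_eq ?_ lam.sum_card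
    exact Finset.single_le_sum (f := fun k ↦ (lam.comp k).card) (fun _ _ ↦ Nat.zero_le _)
      (Finset.mem_univ k)
  · intro lam mu h
    exact Multipartition.ext (funext fun k ↦ congrArg Subtype.val (congrFun h k))

section

variable {le : YoungDiagram → YoungDiagram → Prop} {n : ℕ} {α : n.Partition}

instance finite_label : Finite (Label le α) := by
  refine Finite.of_injective (β := Σ lam : Multipartition α.parts.card n,
    Multipartition lam.shapes.length α.parts.card) (fun L ↦ ⟨L.lam, L.mu⟩) ?_
  rintro ⟨lam, h1, h2, mu, h3⟩ ⟨lam', h1', h2', mu', h3'⟩ h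
  simp only [Sigma.mk.injEq] at h
  obtain ⟨rfl, h⟩ := h
  obtain rfl := eq_of_heq h
  rfl

instance finite_stdTab (L : Label le α) : Finite L.StdTab := by
  refine Finite.of_injective (β := L.lam.Tab × L.mu.Tab) (fun s ↦ (s.t, s.u)) ?_
  intro s s' h
  exact Label.StdTab.ext (congrArg Prod.fst h) (congrArg Prod.snd h)

instance finite_basisIndex (N : ℕ) : Finite (BasisIndex le α N) :=
  inferInstanceAs (Finite (Σ L : {L : Label le α // L.ColumnsLE N}, L.1.StdTab × L.1.StdTab))

end

/-! ### The test functionals -/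

section Test

variable {le : YoungDiagram → YoungDiagram → Prop} [IsLinearOrder YoungDiagram le] {n : ℕ}
  {α : n.Partition} (R : Type*) [CommRing R] [Algebra GroundRing R] {N : ℕ}

namespace Label

variable (L : Label le α) (hN : ∀ x : L.lam.Node, Node.col x < N)

theorem lam_comp_eq_of_mem {w : Equiv.Perm (Fin α.parts.card)} (hw : w ∈ L.mu.youngSubgroup) :
    ∀ i ∈ reducedWord w, L.lam.comp (lo i) = L.lam.comp (hi i) :=
  L.reducedWord_comp_eq fun j ↦ by
    rw [youngSubgroup_eq, mem_fibreSubgroup] at hw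
    exact (rowKey_eq_iff.1 (hw j)).1

theorem act_cElt (σ : Equiv.Perm (Fin α.parts.card)) : act R L.cElt (L.lam.zVec R hN σ) =
    ∑ w ∈ L.mu.youngSubgroup, (-1 : R) ^ len w • L.lam.zVec R hN (σ * w⁻¹) := by
  rw [cElt, act, map_sum, LinearMap.sum_apply]
  refine Finset.sum_congr rfl fun w hw ↦ ?_
  have h1 : (-1 : ℤ) ^ len w • L.lam.bPerm w = (-1 : GroundRing) ^ len w • L.lam.bPerm w := by
    rw [← Int.cast_smul_eq_zsmul GroundRing]
    simp
  rw [h1]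
  change act R _ _ = _
  rw [act_smul, act_bPerm R hN (L.lam_comp_eq_of_mem hw)]
  simp

/-- Once the left factors have produced a multiple of `zVec`, the factors before `g_{d(t)}` only
permute its colours. -/
theorem act_nElt {s t : L.StdTab} {v : VTensor R N α.parts.card n} {a : R}
    (h : act R (star (gPerm (L.lam.dPerm s.t)) * idem L.lam.setPartition * L.lam.yElt) v =
      a • L.lam.zVec R hN 1) :
    act R (L.nElt s t) v = a • ∑ w ∈ L.mu.youngSubgroup, (-1 : R) ^ len w •
      act R (gPerm (L.lam.dPerm t.t))
        (L.lam.zVec R hN (L.mu.dPerm s.u * w⁻¹ * (L.mu.dPerm t.u)⁻¹)) := by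
  have hd : ∀ s : L.StdTab, ∀ i ∈ reducedWord (L.mu.dPerm s.u),
      L.lam.comp (lo i) = L.lam.comp (hi i) := fun s ↦
    L.reducedWord_comp_eq s.u_initial.initial_dPerm
  rw [nElt, act_mul, act_mul, act_mul, act_mul, h, map_smul, map_smul, map_smul, map_smul,
    act_star_bPerm R hN (hd s), one_mul, act_cElt, map_sum, map_sum]
  congr 1
  refine Finset.sum_congr rfl fun w _ ↦ ?_
  rw [map_smul, map_smul, act_bPerm R hN (hd t)]

end Label

namespace BasisIndex

theorem col_lt (x : BasisIndex le α N) : ∀ y : x.1.1.lam.Node, Node.col y < N :=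
  x.1.1.col_lt_of_columnsLE x.1.2

open Classical in
/-- A linear functional that detects the triple `x`. -/
def test (x : BasisIndex le α N) : Module.End R (VTensor R N α.parts.card n) →ₗ[R] R :=
  ∑ τ : Equiv.Perm (Fin α.parts.card),
    (if ownWord x.2.1.u ∘ τ = ownWord x.2.2.u then (1 : R) else 0) •
      (Finsupp.lapply (recolour τ (x.1.1.lam.tabWord x.col_lt x.2.2.t)) ∘ₗ
        (vBasis R N α.parts.card n).repr.toLinearMap ∘ₗ
          LinearMap.applyₗ (vBasis R N α.parts.card n (x.1.1.lam.tabWord x.col_lt x.2.1.t)))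

open Classical in
theorem test_apply (x : BasisIndex le α N) (T : Module.End R (VTensor R N α.parts.card n)) :
    x.test R T = ∑ τ : Equiv.Perm (Fin α.parts.card),
      if ownWord x.2.1.u ∘ τ = ownWord x.2.2.u then
        (vBasis R N α.parts.card n).repr
          (T (vBasis R N α.parts.card n (x.1.1.lam.tabWord x.col_lt x.2.1.t)))
          (recolour τ (x.1.1.lam.tabWord x.col_lt x.2.2.t)) else 0 := by
  rw [test, LinearMap.sum_apply]
  refine Finset.sum_congr rfl fun τ _ ↦ ?_
  split_ifs <;> simp

theorem colSum_le_of_test_ne_zero {x y : BasisIndex le α N} (h : x.test R (act R y.elt) ≠ 0) :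
    y.1.1.lam.colSum ≤ x.1.1.lam.colSum ∧
      (y.1.1.lam.colSum = x.1.1.lam.colSum → x.1.1.lam = y.1.1.lam) := by
  refine colSum_le_of_act_ne_zero R (t := y.2.1.t) (t' := x.2.1.t) y.col_lt x.col_lt
    y.1.1.exists_node y.1.1.increasing x.1.1.increasing fun hc ↦ h ?_
  rw [test_apply]
  refine Finset.sum_eq_zero fun τ _ ↦ ?_
  rw [elt, Label.nElt, act_mul, act_mul, act_mul, act_mul, hc]
  simp

end BasisIndex

theorem sum_ite_perm {r : ℕ} {X : Type*} [DecidableEq X] (F G : Fin r → X) (a : R)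
    (w₀ : Equiv.Perm (Fin r)) :
    ∑ τ : Equiv.Perm (Fin r), (if F ∘ τ = G then if w₀ = τ then a else 0 else 0) =
      if F ∘ w₀ = G then a else 0 := by
  rw [Finset.sum_eq_single w₀]
  · simp
  · intro τ _ hτ
    rw [if_neg hτ.symm, ite_self]
  · intro h; exact absurd (Finset.mem_univ _) h

/-- The values of the test functionals in the case of equal multipartitions. -/
theorem test_act_elt {lam : Multipartition α.parts.card n}
    {h1 : blockSizes lam.setPartition = α.parts} {h2 : ∀ i j, i ≤ j → le (lam.comp i) (lam.comp j)}
    {mu mu' : Multipartition lam.shapes.length α.parts.card}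
    {h3 : ∀ j, (mu.comp j).card = lam.mult j} {h3' : ∀ j, (mu'.comp j).card = lam.mult j}
    (hL' : Label.ColumnsLE ⟨lam, h1, h2, mu', h3'⟩ N)
    (s t : Label.StdTab ⟨lam, h1, h2, mu, h3⟩) (s' t' : Label.StdTab ⟨lam, h1, h2, mu', h3'⟩)
    (hN : ∀ x : lam.Node, Node.col x < N) :
    BasisIndex.test R ⟨⟨⟨lam, h1, h2, mu', h3'⟩, hL'⟩, s', t'⟩
        (act R (Label.nElt ⟨lam, h1, h2, mu, h3⟩ s t)) =
      lam.tabCoef R hN s.t (lam.tabWord hN s'.t) * lam.tabCoef R hN t.t (lam.tabWord hN t'.t) *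
        ((mu.signSum (ownWord s'.u ∘ mu.dPerm s.u) (ownWord t'.u ∘ mu.dPerm t.u) : ℤ) : R) := by
  classical
  let L : Label le α := ⟨lam, h1, h2, mu, h3⟩
  rw [BasisIndex.test_apply]
  have hact := act_star_gPerm_mul_tabWord R hN (t' := s'.t) L.exists_node s.t_std s.t_increasing
    s'.t_increasing
  change ∑ τ : Equiv.Perm (Fin α.parts.card), (if ownWord s'.u ∘ τ = ownWord t'.u then
    (vBasis R N α.parts.card n).repr (act R (L.nElt s t)
      (vBasis R N α.parts.card n (lam.tabWord hN s'.t)))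
        (recolour τ (lam.tabWord hN t'.t)) else 0) = _
  rw [L.act_nElt R hN hact]
  dsimp only [L]
  have hr : ∀ τ, (vBasis R N α.parts.card n).repr
      (lam.tabCoef R hN s.t (lam.tabWord hN s'.t) • ∑ w ∈ mu.youngSubgroup,
        (-1 : R) ^ len w • act R (gPerm (lam.dPerm t.t))
          (lam.zVec R hN (mu.dPerm s.u * w⁻¹ * (mu.dPerm t.u)⁻¹)))
      (recolour τ (lam.tabWord hN t'.t)) =
      lam.tabCoef R hN s.t (lam.tabWord hN s'.t) * ∑ w ∈ mu.youngSubgroup,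
        (-1 : R) ^ len w • (if mu.dPerm s.u * w⁻¹ * (mu.dPerm t.u)⁻¹ = τ then
          lam.tabCoef R hN t.t (lam.tabWord hN t'.t) else 0) := by
    intro τ
    rw [map_smul, Finsupp.smul_apply, smul_eq_mul, map_sum, Finsupp.finsetSum_apply]
    congr 1
    refine Finset.sum_congr rfl fun w _ ↦ ?_
    rw [map_smul, Finsupp.smul_apply]
    congr 1
    exact repr_act_gPerm_zVec R hN t.t_std t.t_increasing t'.t_increasing _ τ
  simp only [hr]
  rw [signSum, Int.cast_sum, mul_assoc, Finset.mul_sum]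
  have hpull : ∀ τ : Equiv.Perm (Fin α.parts.card),
      (if ownWord s'.u ∘ τ = ownWord t'.u then
        lam.tabCoef R hN s.t (lam.tabWord hN s'.t) * ∑ w ∈ mu.youngSubgroup,
        (-1 : R) ^ len w • (if mu.dPerm s.u * w⁻¹ * (mu.dPerm t.u)⁻¹ = τ then
          lam.tabCoef R hN t.t (lam.tabWord hN t'.t) else 0) else 0) =
      ∑ w ∈ mu.youngSubgroup, lam.tabCoef R hN s.t (lam.tabWord hN s'.t) *
        ((-1 : R) ^ len w • (if ownWord s'.u ∘ τ = ownWord t'.u then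
          if mu.dPerm s.u * w⁻¹ * (mu.dPerm t.u)⁻¹ = τ then
          lam.tabCoef R hN t.t (lam.tabWord hN t'.t) else 0 else 0)) := by
    intro τ
    split_ifs
    · rw [Finset.mul_sum]
    · simp
  simp only [hpull]
  rw [Finset.sum_comm, Finset.mul_sum]
  refine Finset.sum_congr rfl fun w _ ↦ ?_
  -- Each `w` yields the single recolouring `d(u) w⁻¹ d(v)⁻¹`, so the sum over `τ` in the functional
  -- collapses.
  rw [← Finset.mul_sum, ← Finset.smul_sum, sum_ite_perm R]
  have hiff : ownWord s'.u ∘ (mu.dPerm s.u * w⁻¹ * (mu.dPerm t.u)⁻¹) = ownWord t'.u ↔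
      (ownWord s'.u ∘ mu.dPerm s.u) ∘ w.symm = ownWord t'.u ∘ mu.dPerm t.u := by
    constructor
    · intro he
      rw [← he]
      funext x
      simp
    · intro he
      funext x
      have := congrFun he ((mu.dPerm t.u)⁻¹ x)
      simpa using this
  simp only [hiff]
  split_ifs
  · simp only [smul_eq_mul, Int.cast_pow, Int.cast_neg, Int.cast_one]
    ring
  · simp

end Test

/-! ### Triangularity of the test matrix -/

open Multipartition

/-- A matrix that is triangular with respect to a numbering and has units on the diagonal. -/
theorem isUnit_det_of_key {ι κ R : Type*} [Fintype ι] [DecidableEq ι] [LinearOrder κ] [CommRing R]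
    {M : Matrix ι ι R} (key : ι → κ) (h : ∀ i j, M i j ≠ 0 → i = j ∨ key i < key j)
    (hd : ∀ i, IsUnit (M i i)) : IsUnit M.det := by
  classical
  have hb : M.BlockTriangular key := fun i j hij ↦ by
    by_contra hc
    rcases h i j hc with rfl | h
    · exact lt_irrefl _ hij
    · exact lt_asymm h hij
  rw [hb.det]
  refine IsUnit.prod_iff.2 fun a _ ↦ ?_
  have hdiag : M.toSquareBlock key a = Matrix.diagonal fun i : {i // key i = a} ↦ M i.1 i.1 := by
    ext ⟨i, hi⟩ ⟨j, hj⟩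
    rw [Matrix.toSquareBlock, Matrix.toSquareBlockProp, Matrix.diagonal_apply]
    split_ifs with he
    · cases he
      rfl
    · by_contra hc
      rcases h i j hc with rfl | h
      · exact he rfl
      · exact h.ne (hi.trans hj.symm)
  rw [hdiag, Matrix.det_diagonal]
  exact IsUnit.prod_iff.2 fun i _ ↦ hd i

variable {le : YoungDiagram → YoungDiagram → Prop} [IsLinearOrder YoungDiagram le] {n : ℕ}
  {α : n.Partition} (R : Type*) [CommRing R] [Algebra GroundRing R] {N : ℕ}

namespace BasisIndex

/-- The numbering of the triples for which the matrix of the test functionals is triangular. -/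
def rank (x : BasisIndex le α N) : ℕᵒᵈ ×ₗ (ℕ ×ₗ (ℕᵒᵈ ×ₗ ℕ)) :=
  toLex (OrderDual.toDual x.1.1.lam.colSum,
    toLex (wordRank (x.1.1.lam.tabWord x.col_lt x.2.1.t) +
      wordRank (x.1.1.lam.tabWord x.col_lt x.2.2.t),
    toLex (OrderDual.toDual x.1.1.mu.colSum,
      wordRank (ownWord x.2.1.u) + wordRank (ownWord x.2.2.u))))

theorem isUnit_test_self (x : BasisIndex le α N) : IsUnit (x.test R (act R x.elt)) := by
  obtain ⟨⟨⟨lam, h1, h2, mu, h3⟩, hL⟩, s, t⟩ := x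
  have hN := Label.col_lt_of_columnsLE _ hL
  rw [elt, test_act_elt R hL s t s t hN, signSum_self]
  simpa using (isUnit_tabCoef R hN s.t_std).mul (isUnit_tabCoef R hN t.t_std)

/-- Four comparisons in turn: letter sums of `λ`, words of the `λ`-tableaux, letter sums of `μ`,
words of the `μ`-tableaux. Equality in each one identifies the corresponding ingredient of the
triples, after which the next one makes sense. -/
theorem eq_or_rank_lt_of_test_ne_zero (x y : BasisIndex le α N)
    (h : x.test R (act R y.elt) ≠ 0) : x = y ∨ x.rank < y.rank := by
  obtain ⟨h1, h2⟩ := colSum_le_of_test_ne_zero R h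
  rcases h1.lt_or_eq with h1 | h1
  · right
    rw [rank, rank, Prod.Lex.toLex_lt_toLex]
    exact Or.inl h1
  have hlam := h2 h1
  obtain ⟨⟨⟨lam, a1, a2, mu, a3⟩, hL⟩, s, t⟩ := y
  obtain ⟨⟨⟨lam', a1', a2', mu', a3'⟩, hL'⟩, s', t'⟩ := x
  obtain rfl : lam' = lam := hlam
  have hN := Label.col_lt_of_columnsLE _ hL
  rw [elt, test_act_elt R hL' s t s' t' hN] at h
  have hs := wordLE_of_tabCoef R hN s.t_std (left_ne_zero_of_mul (left_ne_zero_of_mul h))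
  have ht := wordLE_of_tabCoef R hN t.t_std (right_ne_zero_of_mul (left_ne_zero_of_mul h))
  have hK : mu.signSum (ownWord s'.u ∘ mu.dPerm s.u) (ownWord t'.u ∘ mu.dPerm t.u) ≠ 0 := fun hc ↦
    right_ne_zero_of_mul h (by rw [hc, Int.cast_zero])
  rcases (add_le_add hs.rank_le ht.rank_le).lt_or_eq with h3 | h3
  · right
    rw [rank, rank, Prod.Lex.toLex_lt_toLex, Prod.Lex.toLex_lt_toLex]
    exact Or.inr ⟨rfl, Or.inl h3⟩
  have hse := hs.eq_of_rank_eq (le_antisymm hs.rank_le (by have := ht.rank_le; omega))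
  have hte := ht.eq_of_rank_eq (le_antisymm ht.rank_le (by have := hs.rank_le; omega))
  -- The initial tableaux of `μ` and `μ'` both sort the components of the same `λ` by shape.
  have hc : ∀ x, (mu'.initial x).1 = (mu.initial x).1 := fun x ↦ by
    have hinj : Function.Injective lam'.shapes.get :=
      List.nodup_iff_injective_get.1 (by classical exact List.nodup_dedup _)
    apply hinj
    have e1 := Label.shapes_get_initial (le := le) (α := α) ⟨lam', a1, a2, mu, a3⟩ x
    have e2 := Label.shapes_get_initial (le := le) (α := α) ⟨lam', a1', a2', mu', a3'⟩ x
    exact e2.trans e1.symm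
  obtain ⟨h4, h5⟩ := colSum_le_of_signSum_ne_zero s.u_initial s'.u_initial hc hK
  rcases h4.lt_or_eq with h4 | h4
  · right
    rw [rank, rank, Prod.Lex.toLex_lt_toLex, Prod.Lex.toLex_lt_toLex, Prod.Lex.toLex_lt_toLex]
    exact Or.inr ⟨rfl, Or.inr ⟨h3, Or.inl h4⟩⟩
  obtain rfl := h5 h4
  obtain ⟨hu, hv⟩ := wordLE_of_signSum_ne_zero s.u_std t.u_std s.u_initial s'.u_initial hK
  rcases (add_le_add hu.rank_le hv.rank_le).lt_or_eq with h6 | h6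
  · right
    rw [rank, rank, Prod.Lex.toLex_lt_toLex, Prod.Lex.toLex_lt_toLex, Prod.Lex.toLex_lt_toLex]
    exact Or.inr ⟨rfl, Or.inr ⟨h3, Or.inr ⟨rfl, h6⟩⟩⟩
  left
  have hue := hu.eq_of_rank_eq (le_antisymm hu.rank_le (by have := hv.rank_le; omega))
  have hve := hv.eq_of_rank_eq (le_antisymm hv.rank_le (by have := hu.rank_le; omega))
  have es : s' = s := Label.StdTab.ext (s'.t_std.eq_of_tabWord_eq hN s.t_std hse)
    (s'.u_std.eq_of_tabWord_eq _ s.u_std hue)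
  have et : t' = t := Label.StdTab.ext (t'.t_std.eq_of_tabWord_eq hN t.t_std hte)
    (t'.u_std.eq_of_tabWord_eq _ t.u_std hve)
  rw [es, et]

/-- The matrix of the test functionals. -/
def testMatrix : Matrix (BasisIndex le α N) (BasisIndex le α N) R :=
  Matrix.of fun x y ↦ x.test R (act R y.elt)

open Classical in
theorem isUnit_det_testMatrix [Fintype (BasisIndex le α N)] :
    IsUnit (testMatrix (le := le) (α := α) (N := N) R).det :=
  isUnit_det_of_key rank (fun x y h ↦ eq_or_rank_lt_of_test_ne_zero R x y h)
    fun x ↦ isUnit_test_self R x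

/-- The operators of the `n_{𝔰𝔱}` are linearly independent. -/
theorem eq_zero_of_sum_smul_act_elt [Fintype (BasisIndex le α N)] {c : BasisIndex le α N → R}
    (hc : ∑ x, c x • (act R x.elt : Module.End R (VTensor R N α.parts.card n)) = 0) : c = 0 := by
  classical
  have h1 : (testMatrix (le := le) (α := α) (N := N) R).mulVec c = 0 := by
    funext x
    have := congrArg (x.test R) hc
    rw [map_zero, map_sum] at this
    rw [Pi.zero_apply, ← this, Matrix.mulVec, dotProduct]
    exact Finset.sum_congr rfl fun y _ ↦ by
      rw [map_smul, smul_eq_mul, mul_comm]; rfl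
  have h2 := Matrix.mulVec_injective_of_isUnit
    ((Matrix.isUnit_iff_isUnit_det _).2 (isUnit_det_testMatrix (le := le) (α := α) (N := N) R))
  exact h2 (h1.trans (Matrix.mulVec_zero _).symm)

end BasisIndex

/-! ### Counting standard tableaux -/

open Classical in
/-- The Young diagrams with `k` cells. -/
def diagrams (k : ℕ) : Finset YoungDiagram :=
  have : Fintype {D : YoungDiagram // D.card ≤ k} := Fintype.ofFinite _
  (Finset.univ.map (Function.Embedding.subtype fun D : YoungDiagram ↦ D.card ≤ k)).filter
    fun D ↦ D.card = k

@[simp] theorem mem_diagrams {k : ℕ} {D : YoungDiagram} : D ∈ diagrams k ↔ D.card = k := by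
  simp only [diagrams, Finset.mem_filter, Finset.mem_map, Finset.mem_univ, true_and]
  exact ⟨fun h ↦ h.2, fun h ↦ ⟨⟨⟨D, h.le⟩, rfl⟩, h⟩⟩

theorem youngDiagram_eq_of_le {D E : YoungDiagram} (h : D ≤ E) (hc : E.card ≤ D.card) : D = E :=
  YoungDiagram.ext (Finset.eq_of_subset_of_card_le (YoungDiagram.cells_subset_iff.2 h) hc)

theorem card_sup_add_card_inf (D E : YoungDiagram) :
    (D ⊔ E).card + (D ⊓ E).card = D.card + E.card := by
  rw [YoungDiagram.card, YoungDiagram.card, YoungDiagram.cells_sup, YoungDiagram.cells_inf]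
  exact Finset.card_union_add_card_inter _ _

open Classical in
/-- The number of standard tableaux, defined by recursion. -/
def stdCount : ℕ → YoungDiagram → ℕ
  | 0, _ => 1
  | k + 1, E => ∑ D ∈ diagrams k with D ≤ E, stdCount k D

/-- Append a cell to the row `i`, if this is possible. -/
def addCell (D : YoungDiagram) (i : ℕ) (h : ∀ i' < i, D.rowLen i < D.rowLen i') : YoungDiagram where
  cells := insert (i, D.rowLen i) D.cells
  isLowerSet := by
    rintro ⟨a, b⟩ ⟨a', b'⟩ hle hab
    obtain ⟨h1, h2⟩ : a' ≤ a ∧ b' ≤ b := hle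
    simp only [Finset.coe_insert, Set.mem_insert_iff, Prod.mk.injEq, Finset.mem_coe,
      YoungDiagram.mem_cells] at hab ⊢
    rcases hab with ⟨rfl, rfl⟩ | hab
    · rcases h1.lt_or_eq with h1 | rfl
      · exact Or.inr (YoungDiagram.mem_iff_lt_rowLen.2 (h2.trans_lt (h _ h1)))
      · rcases h2.lt_or_eq with h2 | rfl
        · exact Or.inr (YoungDiagram.mem_iff_lt_rowLen.2 h2)
        · exact Or.inl ⟨rfl, rfl⟩
    · exact Or.inr (D.up_left_mem h1 h2 hab)

theorem mem_addCell {D : YoungDiagram} {i : ℕ} {h} {c : ℕ × ℕ} :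
    c ∈ addCell D i h ↔ c = (i, D.rowLen i) ∨ c ∈ D := by
  rw [← YoungDiagram.mem_cells, addCell, Finset.mem_insert, YoungDiagram.mem_cells]

theorem rowLen_notMem (D : YoungDiagram) (i : ℕ) : (i, D.rowLen i) ∉ D := fun h ↦
  lt_irrefl _ (YoungDiagram.mem_iff_lt_rowLen.1 h)

theorem card_addCell {D : YoungDiagram} {i : ℕ} {h} : (addCell D i h).card = D.card + 1 :=
  Finset.card_insert_of_notMem (rowLen_notMem D i)

theorem le_addCell {D : YoungDiagram} {i : ℕ} {h} : D ≤ addCell D i h := fun _ hc ↦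
  mem_addCell.2 (Or.inr hc)

theorem addCell_inj {D : YoungDiagram} {i j : ℕ} {hi hj} (h : addCell D i hi = addCell D j hj) :
    i = j := by
  have h1 : (i, D.rowLen i) ∈ addCell D j hj := h ▸ mem_addCell.2 (Or.inl rfl)
  rcases mem_addCell.1 h1 with h1 | h1
  · exact congrArg Prod.fst h1
  · exact absurd h1 (rowLen_notMem D i)

/-- A diagram with one cell less is obtained by erasing the last cell of a row. -/
theorem exists_row_of_le {k : ℕ} {C D : YoungDiagram} (hC : C.card = k) (hD : D.card = k + 1)
    (h : C ≤ D) : ∃ i, D.rowLen (i + 1) < D.rowLen i ∧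
      ∀ c, c ∈ C ↔ c ∈ D ∧ c ≠ (i, D.rowLen i - 1) := by
  obtain ⟨⟨i, j⟩, hij⟩ : ∃ c, D.cells \ C.cells = {c} := by
    rw [← Finset.card_eq_one, Finset.card_sdiff_of_subset (YoungDiagram.cells_subset_iff.2 h)]
    exact (congrArg₂ (· - ·) hD hC).trans (by omega)
  have hmem : ∀ c, c ∈ D ∧ c ∉ C ↔ c = (i, j) := fun c ↦ by
    have := Finset.ext_iff.1 hij c
    simpa using this
  obtain ⟨h1, h2⟩ := (hmem (i, j)).2 rfl
  have hnot : ∀ c : ℕ × ℕ, c ≠ (i, j) → i ≤ c.1 → j ≤ c.2 → c ∉ D := by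
    intro c hc hi hj hcD
    have hcC : c ∈ C := by
      by_contra hcC
      exact hc ((hmem c).1 ⟨hcD, hcC⟩)
    exact h2 (C.up_left_mem hi hj hcC)
  have h3 : D.rowLen i = j + 1 := by
    refine le_antisymm ?_ (YoungDiagram.mem_iff_lt_rowLen.1 h1)
    by_contra! hlt
    exact hnot (i, j + 1) (by simp) le_rfl (Nat.le_succ j) (YoungDiagram.mem_iff_lt_rowLen.2 hlt)
  have h4 : D.rowLen (i + 1) ≤ j := by
    by_contra! hlt
    exact hnot (i + 1, j) (by simp) (Nat.le_succ i) le_rfl (YoungDiagram.mem_iff_lt_rowLen.2 hlt)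
  refine ⟨i, by omega, fun c ↦ ?_⟩
  rw [h3, Nat.add_sub_cancel]
  constructor
  · intro hc
    exact ⟨h hc, by rintro rfl; exact h2 hc⟩
  · rintro ⟨hc, hne⟩
    by_contra hcC
    exact hne ((hmem c).1 ⟨hc, hcC⟩)

open Classical in
/-- There are more addable than removable cells. -/
theorem card_down_lt_card_up {k : ℕ} {D : YoungDiagram} (hD : D.card = k + 1) :
    ((diagrams k).filter (· ≤ D)).card < ((diagrams (k + 2)).filter (D ≤ ·)).card := by
  have hrow : ∀ C ∈ (diagrams k).filter (· ≤ D), ∃ i, D.rowLen (i + 1) < D.rowLen i ∧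
      ∀ c, c ∈ C ↔ c ∈ D ∧ c ≠ (i, D.rowLen i - 1) := fun C hC ↦ by
    rw [Finset.mem_filter, mem_diagrams] at hC
    exact exists_row_of_le hC.1 hD hC.2
  choose! row hrow1 hrow2 using hrow
  have hadd : ∀ C ∈ (diagrams k).filter (· ≤ D),
      ∀ i' < row C + 1, D.rowLen (row C + 1) < D.rowLen i' := fun C hC i' hi' ↦
    (hrow1 C hC).trans_le (D.rowLen_anti _ _ (Nat.lt_succ_iff.1 hi'))
  -- A removable cell in row `i` gives an addable cell in row `i + 1`; row `0` is always addable and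
  -- is missed by this map.
  let F (C : {C // C ∈ (diagrams k).filter (· ≤ D)}) : YoungDiagram :=
    addCell D (row C + 1) (hadd C C.2)
  have hF : Function.Injective F := by
    rintro ⟨C, hC⟩ ⟨C', hC'⟩ h
    have h1 : row C = row C' := Nat.succ_injective (addCell_inj h)
    refine Subtype.ext (YoungDiagram.ext (Finset.ext fun c ↦ ?_))
    rw [YoungDiagram.mem_cells, YoungDiagram.mem_cells, hrow2 C hC, hrow2 C' hC', h1]
  have h0 : ∀ i' < 0, D.rowLen 0 < D.rowLen i' := fun i' hi' ↦ absurd hi' (Nat.not_lt_zero _)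
  rw [← Finset.card_attach, ← Finset.card_image_of_injective _ hF]
  refine Finset.card_lt_card ((Finset.ssubset_iff_of_subset fun E hE ↦ ?_).2
    ⟨addCell D 0 h0, ?_, ?_⟩)
  · obtain ⟨C, -, rfl⟩ := Finset.mem_image.1 hE
    rw [Finset.mem_filter, mem_diagrams]
    exact ⟨card_addCell.trans (congrArg (· + 1) hD), le_addCell⟩
  · rw [Finset.mem_filter, mem_diagrams]
    exact ⟨card_addCell.trans (congrArg (· + 1) hD), le_addCell⟩
  · intro h
    obtain ⟨C, -, h⟩ := Finset.mem_image.1 h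
    exact absurd (addCell_inj h) (Nat.succ_ne_zero _)

-- For `D ≠ D'` the only possible common lower neighbour is `D ⊓ D'`, and if it has `k` cells, then
-- `D ⊔ D'` has `k + 2`. For `D = D'` the extra `1` is `card_down_lt_card_up`. This is one half of
-- the commutation relation between the up and down operators of Young's lattice.
open Classical in
theorem card_common_down_le {k : ℕ} {D D' : YoungDiagram} (hD : D.card = k + 1)
    (hD' : D'.card = k + 1) :
    ((diagrams k).filter fun C ↦ C ≤ D ∧ C ≤ D').card + (if D = D' then 1 else 0) ≤
      ((diagrams (k + 2)).filter fun E ↦ D ≤ E ∧ D' ≤ E).card := by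
  split_ifs with h
  · subst h
    simpa using card_down_lt_card_up hD
  · rw [add_zero]
    have hcard := card_sup_add_card_inf D D'
    refine Finset.card_le_card_of_injOn (fun _ ↦ D ⊔ D') ?_ ?_
    · intro C hC
      simp only [Finset.coe_filter, mem_diagrams, Set.mem_ofPred_eq] at hC ⊢
      refine ⟨?_, le_sup_left, le_sup_right⟩
      have h1 : C.card ≤ (D ⊓ D').card :=
        Finset.card_le_card (YoungDiagram.cells_subset_iff.2 (le_inf hC.2.1 hC.2.2))
      have h2 : D.card < (D ⊔ D').card := by
        by_contra! hle
        have h3 := youngDiagram_eq_of_le (le_sup_left : D ≤ D ⊔ D') hle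
        have h4 : D' ≤ D := h3 ▸ le_sup_right
        exact h (youngDiagram_eq_of_le h4 (by omega)).symm
      omega
    · intro C hC C' hC' _
      simp only [Finset.coe_filter, mem_diagrams, Set.mem_ofPred_eq] at hC hC'
      have h2 : (D ⊓ D').card < D.card := by
        by_contra! hle
        have h3 := youngDiagram_eq_of_le (inf_le_left : D ⊓ D' ≤ D) hle
        have h4 : D ≤ D' := h3 ▸ inf_le_right
        exact h (youngDiagram_eq_of_le h4 (by omega))
      have h5 : ∀ C, C.card = k ∧ C ≤ D ∧ C ≤ D' → C = D ⊓ D' := fun C hC ↦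
        youngDiagram_eq_of_le (le_inf hC.2.1 hC.2.2) (by omega)
      rw [h5 C hC, h5 C' hC']

-- Going up and then down from `D` meets every `D'` at least as often as going down and then up,
-- with one more visit to `D` itself; that visit raises the factor by one in the induction.
open Classical in
theorem mul_stdCount_le (k : ℕ) : ∀ D ∈ diagrams k,
    (k + 1) * stdCount k D ≤ ∑ E ∈ diagrams (k + 1) with D ≤ E, stdCount (k + 1) E := by
  induction k with
  | zero =>
    intro D hD
    rw [mem_diagrams] at hD
    have h0 : ∀ i' < 0, D.rowLen 0 < D.rowLen i' := fun i' hi' ↦ absurd hi' (Nat.not_lt_zero _)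
    have hE : addCell D 0 h0 ∈ (diagrams (0 + 1)).filter (D ≤ ·) := by
      rw [Finset.mem_filter, mem_diagrams]
      exact ⟨card_addCell.trans (congrArg (· + 1) hD), le_addCell⟩
    refine le_trans ?_ (Finset.single_le_sum (fun _ _ ↦ Nat.zero_le _) hE)
    rw [stdCount]
    refine le_trans ?_ (Finset.single_le_sum (f := stdCount 0) (a := D) (fun _ _ ↦ Nat.zero_le _) ?_)
    · rw [stdCount]
    · rw [Finset.mem_filter, mem_diagrams]
      exact ⟨hD, le_addCell⟩
  | succ k ih =>
    intro D hD
    rw [mem_diagrams] at hD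
    have h1 : ∑ E ∈ diagrams (k + 2) with D ≤ E, stdCount (k + 2) E =
        ∑ D' ∈ diagrams (k + 1),
          ((diagrams (k + 2)).filter fun E ↦ D ≤ E ∧ D' ≤ E).card * stdCount (k + 1) D' := by
      simp only [stdCount, Finset.sum_filter, Finset.card_filter, Finset.sum_mul]
      conv_rhs => rw [Finset.sum_comm]
      refine Finset.sum_congr rfl fun E _ ↦ ?_
      by_cases h : D ≤ E <;> simp [h]
    have h2 : ∑ D' ∈ diagrams (k + 1), (((diagrams k).filter fun C ↦ C ≤ D ∧ C ≤ D').card +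
          (if D = D' then 1 else 0)) * stdCount (k + 1) D' =
        ∑ C ∈ diagrams k with C ≤ D, (∑ D' ∈ diagrams (k + 1) with C ≤ D', stdCount (k + 1) D') +
          stdCount (k + 1) D := by
      simp only [add_mul, Finset.sum_add_distrib]
      congr 1
      · simp only [Finset.sum_filter, Finset.card_filter, Finset.sum_mul]
        conv_lhs => rw [Finset.sum_comm]
        refine Finset.sum_congr rfl fun C _ ↦ ?_
        by_cases h : C ≤ D <;> simp [h]
      · simp [hD]
    rw [h1]
    refine le_trans ?_ (Finset.sum_le_sum fun D' hD' ↦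
      Nat.mul_le_mul_right _ (card_common_down_le hD (mem_diagrams.1 hD')))
    rw [h2, add_mul, one_mul]
    refine Nat.add_le_add_right ?_ _
    rw [stdCount, Finset.mul_sum]
    exact Finset.sum_le_sum fun C hC ↦ ih C (Finset.mem_filter.1 hC).1

/-- Unfold one factor of each square by its recursion and exchange the sums; `mul_stdCount_le` then
supplies the factor `k + 1`. -/
theorem factorial_le_sum_stdCount_sq (k : ℕ) :
    k.factorial ≤ ∑ D ∈ diagrams k, stdCount k D * stdCount k D := by
  classical
  induction k with
  | zero =>
    have : (⊥ : YoungDiagram) ∈ diagrams 0 := by simp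
    exact Finset.single_le_sum (f := fun D ↦ stdCount 0 D * stdCount 0 D)
      (fun _ _ ↦ Nat.zero_le _) this
  | succ k ih =>
    have h1 : ∑ E ∈ diagrams (k + 1), stdCount (k + 1) E * stdCount (k + 1) E =
        ∑ D ∈ diagrams k, stdCount k D *
          ∑ E ∈ diagrams (k + 1) with D ≤ E, stdCount (k + 1) E := by
      conv_lhs =>
        enter [2, E, 1]
        rw [stdCount]
      simp only [Finset.sum_filter, Finset.mul_sum, Finset.sum_mul]
      rw [Finset.sum_comm]
      refine Finset.sum_congr rfl fun D _ ↦ Finset.sum_congr rfl fun E _ ↦ ?_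
      split_ifs <;> simp
    rw [h1, Nat.factorial_succ]
    refine (Nat.mul_le_mul_left _ ih).trans ?_
    rw [Finset.mul_sum]
    refine Finset.sum_le_sum fun D hD ↦ ?_
    rw [mul_left_comm]
    exact Nat.mul_le_mul_left _ (mul_stdCount_le k D hD)

/-- Standard tableaux with entries in `Fin k`. -/
abbrev SYT (k : ℕ) (D : YoungDiagram) : Type :=
  {T : Fin k → ℕ × ℕ // Function.Injective T ∧ (∀ c, c ∈ D ↔ ∃ x, T x = c) ∧
    ∀ x y, T x ≤ T y → x ≤ y}

instance finite_syt (k : ℕ) (D : YoungDiagram) : Finite (SYT k D) := by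
  refine Finite.of_injective (β := Fin k → D.cells)
    (fun T x ↦ ⟨T.1 x, (T.2.2.1 _).2 ⟨x, rfl⟩⟩) fun T T' h ↦ Subtype.ext (funext fun x ↦ ?_)
  exact congrArg Subtype.val (congrFun h x)

/-- Putting a new largest entry into the one cell of `E` outside `D` embeds the tableaux of all
lower neighbours `D` into those of `E`. -/
theorem stdCount_le (k : ℕ) : ∀ D ∈ diagrams k, stdCount k D ≤ Nat.card (SYT k D) := by
  classical
  induction k with
  | zero =>
    intro D hD
    rw [mem_diagrams] at hD
    have : Nonempty (SYT 0 D) := by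
      refine ⟨fun x ↦ x.elim0, fun x ↦ x.elim0, fun c ↦ ?_, fun x ↦ x.elim0⟩
      refine ⟨fun hc ↦ ?_, fun ⟨x, _⟩ ↦ x.elim0⟩
      exact absurd (youngDiagram_mem_lt hc).1 (by omega)
    exact Nat.card_pos
  | succ k ih =>
    intro E hE
    rw [mem_diagrams] at hE
    let J := {D : YoungDiagram // D ∈ (diagrams k).filter (· ≤ E)}
    have hc : ∀ D : J, ∃ c, c ∉ D.1 ∧ ∀ c', c' ∈ E ↔ c' ∈ D.1 ∨ c' = c := by
      rintro ⟨D, hD⟩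
      rw [Finset.mem_filter, mem_diagrams] at hD
      obtain ⟨i, h1, h2⟩ := exists_row_of_le hD.1 hE hD.2
      refine ⟨(i, E.rowLen i - 1), fun h ↦ ((h2 _).1 h).2 rfl, fun c' ↦ ?_⟩
      rw [h2]
      by_cases h : c' = (i, E.rowLen i - 1)
      · subst h
        simp only [ne_eq, not_true_eq_false, and_false, or_true, iff_true]
        exact YoungDiagram.mem_iff_lt_rowLen.2 (by omega)
      · simp [h]
    choose cell hcell1 hcell2 using hc
    let F : (Σ D : J, SYT k D.1) → SYT (k + 1) E := fun p ↦ ⟨Fin.snoc p.2.1 (cell p.1), by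
      obtain ⟨D, T, hT1, hT2, hT3⟩ := p
      refine ⟨?_, fun c ↦ ?_, fun x y hxy ↦ ?_⟩
      · rw [Fin.snoc_injective_iff]
        refine ⟨hT1, ?_⟩
        rintro ⟨x, hx⟩
        exact hcell1 D ((hT2 _).2 ⟨x, hx⟩)
      · rw [hcell2 D, hT2]
        constructor
        · rintro (⟨x, rfl⟩ | rfl)
          · exact ⟨x.castSucc, by simp⟩
          · exact ⟨Fin.last k, by simp⟩
        · rintro ⟨x, rfl⟩
          induction x using Fin.lastCases with
          | last => right; simp
          | cast x => left; exact ⟨x, by simp⟩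
      · induction y using Fin.lastCases with
        | last => exact Fin.le_last x
        | cast y =>
          induction x using Fin.lastCases with
          | last =>
            simp only [Fin.snoc_last, Fin.snoc_castSucc] at hxy
            exact absurd (D.1.up_left_mem hxy.1 hxy.2 ((hT2 _).2 ⟨y, rfl⟩)) (hcell1 D)
          | cast x =>
            simp only [Fin.snoc_castSucc] at hxy
            exact hT3 x y hxy⟩
    have hF : Function.Injective F := by
      rintro ⟨D, T⟩ ⟨D', T'⟩ h
      have h1 : T.1 = T'.1 := by
        have := congrArg (fun S : SYT (k + 1) E ↦ Fin.init (α := fun _ ↦ ℕ × ℕ) S.1) h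
        simpa [F] using this
      have h2 : D = D' := by
        refine Subtype.ext (YoungDiagram.ext (Finset.ext fun c ↦ ?_))
        rw [YoungDiagram.mem_cells, YoungDiagram.mem_cells, T.2.2.1, T'.2.2.1, h1]
      subst h2
      rw [Subtype.ext h1]
    have : Fintype J := Fintype.ofFinite J
    have h1 := Nat.card_le_card_of_injective F hF
    rw [Nat.card_sigma] at h1
    refine le_trans ?_ h1
    rw [stdCount, ← Finset.sum_coe_sort]
    refine (Finset.sum_le_sum fun D _ ↦ ih D.1 (Finset.mem_filter.1 D.2).1).trans_eq ?_
    refine Finset.sum_congr ?_ fun _ _ ↦ rfl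
    ext; simp

/-- There are enough pairs of standard tableaux of the same shape. -/
theorem exists_perm_embedding (k : ℕ) : ∃ F : Equiv.Perm (Fin k) →
    Σ D : {D // D ∈ diagrams k}, SYT k D.1 × SYT k D.1, Function.Injective F := by
  classical
  have h : Nat.card (Equiv.Perm (Fin k)) ≤
      Nat.card (Σ D : {D // D ∈ diagrams k}, SYT k D.1 × SYT k D.1) := by
    rw [Nat.card_perm, Nat.card_eq_fintype_card, Fintype.card_fin, Nat.card_sigma]
    refine (factorial_le_sum_stdCount_sq k).trans ?_
    rw [← Finset.sum_coe_sort]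
    refine Finset.sum_le_sum fun D _ ↦ ?_
    rw [Nat.card_prod]
    exact Nat.mul_le_mul (stdCount_le k _ D.2) (stdCount_le k _ D.2)
  have := Fintype.ofFinite (Σ D : {D // D ∈ diagrams k}, SYT k D.1 × SYT k D.1)
  rw [Nat.card_eq_fintype_card, Nat.card_eq_fintype_card] at h
  obtain ⟨F⟩ := Function.Embedding.nonempty_of_card_le h
  exact ⟨F, F.injective⟩

/-! ### A correspondence between bijections and pairs of standard tableaux -/

section Correspondence

variable {n : ℕ}

/-- `T` is a standard tableau of shape `D` with the set of entries `X`. -/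
def TabOn (X : Finset (Fin n)) (D : YoungDiagram) (T : Fin n → ℕ × ℕ) : Prop :=
  (∀ x ∈ X, ∀ y ∈ X, T x = T y → x = y) ∧ (∀ c, c ∈ D ↔ ∃ x ∈ X, T x = c) ∧
    ∀ x ∈ X, ∀ y ∈ X, T x ≤ T y → x ≤ y

theorem TabOn.congr {X : Finset (Fin n)} {D : YoungDiagram} {T T' : Fin n → ℕ × ℕ}
    (h : TabOn X D T) (hT : ∀ x ∈ X, T' x = T x) : TabOn X D T' := by
  refine ⟨fun x hx y hy ↦ ?_, fun c ↦ (h.2.1 c).trans ?_, fun x hx y hy ↦ ?_⟩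
  · rw [hT x hx, hT y hy]; exact h.1 x hx y hy
  · exact exists_congr fun x ↦ and_congr_right fun hx ↦ by rw [hT x hx]
  · rw [hT x hx, hT y hy]; exact h.2.2 x hx y hy

theorem TabOn.card_eq {X : Finset (Fin n)} {D : YoungDiagram} {T : Fin n → ℕ × ℕ}
    (h : TabOn X D T) : D.card = X.card := by
  classical
  have : D.cells = X.image T := by
    ext c
    rw [YoungDiagram.mem_cells, h.2.1, Finset.mem_image]
  rw [YoungDiagram.card, this, Finset.card_image_of_injOn fun x hx y hy ↦ h.1 x hx y hy]

open Classical in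
/-- Transport of a standard tableau to another set of entries. -/
def sytOn {k : ℕ} (X : Finset (Fin n)) (hX : X.card = k) (T : Fin k → ℕ × ℕ) (x : Fin n) : ℕ × ℕ :=
  if hx : x ∈ X then T ((X.orderIsoOfFin hX).symm ⟨x, hx⟩) else 0

theorem sytOn_apply {k : ℕ} {X : Finset (Fin n)} (hX : X.card = k) (T : Fin k → ℕ × ℕ) (i : Fin k) :
    sytOn X hX T (X.orderIsoOfFin hX i) = T i := by
  rw [sytOn, dif_pos (X.orderIsoOfFin hX i).2]
  exact congrArg T (OrderIso.symm_apply_apply _ i)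

theorem tabOn_sytOn {k : ℕ} {X : Finset (Fin n)} (hX : X.card = k) {D : YoungDiagram}
    (T : SYT k D) : TabOn X D (sytOn X hX T.1) := by
  obtain ⟨T, h1, h2, h3⟩ := T
  have hsurj : ∀ x ∈ X, ∃ i, x = X.orderIsoOfFin hX i := fun x hx ↦
    ⟨(X.orderIsoOfFin hX).symm ⟨x, hx⟩, by simp⟩
  refine ⟨fun x hx y hy ↦ ?_, fun c ↦ (h2 c).trans ?_, fun x hx y hy ↦ ?_⟩
  · obtain ⟨i, rfl⟩ := hsurj x hx
    obtain ⟨j, rfl⟩ := hsurj y hy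
    rw [sytOn_apply, sytOn_apply]
    intro h
    rw [h1 h]
  · constructor
    · rintro ⟨i, rfl⟩
      exact ⟨_, (X.orderIsoOfFin hX i).2, sytOn_apply hX T i⟩
    · rintro ⟨x, hx, rfl⟩
      obtain ⟨i, rfl⟩ := hsurj x hx
      exact ⟨i, (sytOn_apply hX T i).symm⟩
  · obtain ⟨i, rfl⟩ := hsurj x hx
    obtain ⟨j, rfl⟩ := hsurj y hy
    rw [sytOn_apply, sytOn_apply]
    intro h
    exact Subtype.coe_le_coe.2 ((X.orderIsoOfFin hX).le_iff_le.2 (h3 _ _ h))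

/-- `w` maps `X` onto `Y`. -/
def MapsOnto (w : Equiv.Perm (Fin n)) (X Y : Finset (Fin n)) : Prop := ∀ x, x ∈ X ↔ w x ∈ Y

/-- Any injective coding will do, so `exists_perm_embedding` is transported along the increasing
enumerations of `X` and `Y`. If the sizes differ, no `w` maps `X` onto `Y` and the data are
arbitrary. -/
theorem exists_correspondence (X Y : Finset (Fin n)) :
    ∃ (D : Equiv.Perm (Fin n) → YoungDiagram) (P Q : Equiv.Perm (Fin n) → Fin n → ℕ × ℕ),
      (∀ w, MapsOnto w X Y → TabOn X (D w) (P w) ∧ TabOn Y (D w) (Q w)) ∧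
      ∀ w w', MapsOnto w X Y → MapsOnto w' X Y → D w = D w' → (∀ x ∈ X, P w x = P w' x) →
        (∀ y ∈ Y, Q w y = Q w' y) → ∀ x ∈ X, w x = w' x := by
  classical
  by_cases hY : Y.card = X.card
  swap
  · have : ∀ w, ¬MapsOnto w X Y := fun w h ↦ hY (by
      have hm : X.map w.toEmbedding = Y := by
        ext y
        rw [Finset.mem_map_equiv, h (w.symm y), Equiv.apply_symm_apply]
      rw [← hm, Finset.card_map])
    exact ⟨fun _ ↦ ⊥, fun _ _ ↦ 0, fun _ _ ↦ 0, fun w h ↦ absurd h (this w),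
      fun w _ h ↦ absurd h (this w)⟩
  obtain ⟨F, hF⟩ := exists_perm_embedding X.card
  let b (w : Equiv.Perm (Fin n)) (h : MapsOnto w X Y) : Equiv.Perm (Fin X.card) :=
    (X.orderIsoOfFin rfl).toEquiv.trans
      ((w.subtypeEquiv h).trans (Y.orderIsoOfFin hY).symm.toEquiv)
  refine ⟨fun w ↦ if h : MapsOnto w X Y then (F (b w h)).1.1 else ⊥,
    fun w ↦ if h : MapsOnto w X Y then sytOn X rfl (F (b w h)).2.1.1 else 0,
    fun w ↦ if h : MapsOnto w X Y then sytOn Y hY (F (b w h)).2.2.1 else 0, fun w h ↦ ?_,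
    fun w w' h h' hD hP hQ ↦ ?_⟩
  · simp only [dif_pos h]
    exact ⟨tabOn_sytOn _ _, tabOn_sytOn _ _⟩
  · simp only [dif_pos h, dif_pos h'] at hD hP hQ
    have hext : ∀ p p' : Σ D : {D // D ∈ diagrams X.card}, SYT X.card D.1 × SYT X.card D.1,
        p.1.1 = p'.1.1 → p.2.1.1 = p'.2.1.1 → p.2.2.1 = p'.2.2.1 → p = p' := by
      rintro ⟨⟨D, hD⟩, T, S⟩ ⟨⟨D', hD'⟩, T', S'⟩ h1 h2 h3
      obtain rfl : D = D' := h1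
      obtain rfl : T = T' := Subtype.ext h2
      obtain rfl : S = S' := Subtype.ext h3
      rfl
    have hb : b w h = b w' h' := by
      refine hF (hext _ _ hD (funext fun i ↦ ?_) (funext fun i ↦ ?_))
      · have := hP _ (X.orderIsoOfFin rfl i).2
        rwa [sytOn_apply, sytOn_apply] at this
      · have := hQ _ (Y.orderIsoOfFin hY i).2
        rwa [sytOn_apply, sytOn_apply] at this
    intro x hx
    have := congrArg (Y.orderIsoOfFin hY) (Equiv.ext_iff.1 hb ((X.orderIsoOfFin rfl).symm ⟨x, hx⟩))
    have h2 : w.subtypeEquiv h ⟨x, hx⟩ = w'.subtypeEquiv h' ⟨x, hx⟩ := by simpa [b] using this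
    exact congrArg Subtype.val h2

/-- The common shape of the two tableaux that correspond to `w`. -/
def rsShape (X Y : Finset (Fin n)) (w : Equiv.Perm (Fin n)) : YoungDiagram :=
  (exists_correspondence X Y).choose w

/-- The first tableau that corresponds to `w`. -/
def rsLeft (X Y : Finset (Fin n)) (w : Equiv.Perm (Fin n)) : Fin n → ℕ × ℕ :=
  (exists_correspondence X Y).choose_spec.choose w

/-- The second tableau that corresponds to `w`. -/
def rsRight (X Y : Finset (Fin n)) (w : Equiv.Perm (Fin n)) : Fin n → ℕ × ℕ :=
  (exists_correspondence X Y).choose_spec.choose_spec.choose w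

variable {X Y : Finset (Fin n)} {w w' : Equiv.Perm (Fin n)}

theorem tabOn_rsLeft (h : MapsOnto w X Y) : TabOn X (rsShape X Y w) (rsLeft X Y w) :=
  ((exists_correspondence X Y).choose_spec.choose_spec.choose_spec.1 w h).1

theorem tabOn_rsRight (h : MapsOnto w X Y) : TabOn Y (rsShape X Y w) (rsRight X Y w) :=
  ((exists_correspondence X Y).choose_spec.choose_spec.choose_spec.1 w h).2

theorem eq_of_rs_eq (h : MapsOnto w X Y) (h' : MapsOnto w' X Y)
    (h1 : rsShape X Y w = rsShape X Y w') (h2 : ∀ x ∈ X, rsLeft X Y w x = rsLeft X Y w' x)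
    (h3 : ∀ y ∈ Y, rsRight X Y w y = rsRight X Y w' y) : ∀ x ∈ X, w x = w' x :=
  (exists_correspondence X Y).choose_spec.choose_spec.choose_spec.2 w w' h h' h1 h2 h3

end Correspondence

/-! ### Multitableaux assembled from tableaux on the fibres of a colouring -/

namespace Multipartition

section OfTabOn

variable {r n : ℕ} {lam : Multipartition r n}

/-- The multitableau with given components. -/
def ofTabOn (c : Fin n → Fin r) (T : Fin n → ℕ × ℕ)
    (h : ∀ k, TabOn {x | c x = k} (lam.comp k) T) : lam.Tab :=
  Equiv.ofBijective (fun x ↦ ⟨c x, T x, ((h (c x)).2.1 _).2 ⟨x, by simp, rfl⟩⟩) (by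
    constructor
    · intro x y hxy
      have h1 : c x = c y := congrArg Sigma.fst hxy
      have h2 : T x = T y := congrArg (fun z : lam.Node ↦ (z.2.1 : ℕ × ℕ)) hxy
      exact (h (c x)).1 x (by simp) y (by simp [h1]) h2
    · rintro ⟨k, c', hc⟩
      obtain ⟨x, hx, rfl⟩ := ((h k).2.1 _).1 hc
      rw [Finset.mem_filter_univ] at hx
      subst hx
      exact ⟨x, rfl⟩)

variable {c : Fin n → Fin r} {T : Fin n → ℕ × ℕ} (h : ∀ k, TabOn {x | c x = k} (lam.comp k) T)

theorem ofTabOn_fst (x : Fin n) : (ofTabOn c T h x).1 = c x := rfl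

theorem ofTabOn_snd (x : Fin n) : ((ofTabOn c T h x).2.1 : ℕ × ℕ) = T x := rfl

theorem isStd_ofTabOn : lam.IsStd (ofTabOn c T h) := by
  have key : ∀ a b : Fin n, c a = c b → T a ≤ T b → a ≤ b := fun a b hab hT ↦
    (h (c a)).2.2 a (by simp) b (by simp [hab]) hT
  intro x y hxy
  obtain ⟨a, rfl⟩ := (ofTabOn c T h).surjective x
  obtain ⟨b, rfl⟩ := (ofTabOn c T h).surjective y
  rw [Equiv.symm_apply_apply, Equiv.symm_apply_apply]
  refine ⟨fun h1 h2 ↦ lt_of_le_of_ne (key a b hxy ⟨h1.le, h2.le⟩) ?_,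
    fun h1 h2 ↦ lt_of_le_of_ne (key a b hxy ⟨h2.le, h1.le⟩) ?_⟩
  · rintro rfl; exact h2.ne rfl
  · rintro rfl; exact h2.ne rfl

end OfTabOn

end Multipartition

/-! ### Counting the triples `(Λ, 𝔰, 𝔱)` -/

section Ranks

/-- Counting predecessors inside the finite set `S` turns the total order into a numerical key,
which can enter a lexicographic product. -/
theorem exists_rank (le : YoungDiagram → YoungDiagram → Prop) [IsLinearOrder YoungDiagram le]
    (S : Finset YoungDiagram) : ∃ ρ : YoungDiagram → ℕ, ∀ D ∈ S, ∀ E, ρ D ≤ ρ E → le D E := by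
  classical
  refine ⟨fun D ↦ (S.filter fun F ↦ le F D).card, fun D hD E h ↦ ?_⟩
  by_contra hDE
  have hED : le E D := (total_of le D E).resolve_left hDE
  refine h.not_gt (Finset.card_lt_card (Finset.ssubset_iff_subset_ne.2 ⟨fun F hF ↦ ?_, fun he ↦ ?_⟩))
  · rw [Finset.mem_filter] at hF ⊢
    exact ⟨hF.1, trans_of le hF.2 hED⟩
  · have : D ∈ S.filter fun F ↦ le F D := Finset.mem_filter.2 ⟨hD, refl_of le D⟩
    rw [← he, Finset.mem_filter] at this
    exact hDE this.2

theorem exists_surjective_fin {ι κ : Type*} [Fintype ι] [LinearOrder κ] (f : ι → κ) {r : ℕ}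
    (hr : (Finset.univ.image f).card = r) :
    ∃ c : ι → Fin r, Function.Surjective c ∧ ∀ x y, c x ≤ c y ↔ f x ≤ f y := by
  refine ⟨fun x ↦ ((Finset.univ.image f).orderIsoOfFin hr).symm
    ⟨f x, Finset.mem_image_of_mem f (Finset.mem_univ x)⟩, fun k ↦ ?_, fun x y ↦ ?_⟩
  · obtain ⟨x, -, hx⟩ := Finset.mem_image.1 ((Finset.univ.image f).orderIsoOfFin hr k).2
    refine ⟨x, ?_⟩
    rw [OrderIso.symm_apply_eq]
    exact Subtype.ext hx
  · rw [OrderIso.le_iff_le, Subtype.mk_le_mk]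

theorem card_image_le_of_ker {ι κ κ' : Type*} [Fintype ι] [DecidableEq κ] [DecidableEq κ']
    {f : ι → κ} {g : ι → κ'} (h : ∀ x y, f x = f y → g x = g y) :
    (Finset.univ.image g).card ≤ (Finset.univ.image f).card := by
  rcases isEmpty_or_nonempty ι with hι | ⟨⟨i⟩⟩
  · simp
  have hg : Function.FactorsThrough g f := fun x y ↦ h x y
  have : Finset.univ.image g = (Finset.univ.image f).image (Function.extend f g fun _ ↦ g i) := by
    rw [Finset.image_image]
    exact Finset.image_congr fun x _ ↦ (hg.extend_apply _ x).symm
  rw [this]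
  exact Finset.card_image_le

end Ranks

namespace Multipartition

variable {n : ℕ}

theorem exists_multitableau {α : n.Partition} (le : YoungDiagram → YoungDiagram → Prop)
    [IsLinearOrder YoungDiagram le] {A : SetPartition n} (hA : blockSizes A = α.parts)
    (sh : Fin n → YoungDiagram) (T : Fin n → ℕ × ℕ) (hT : ∀ x, TabOn (A.part x) (sh x) T)
    (hsh : ∀ x y, SameBlock A x y → sh x = sh y) :
    ∃ (lam : Multipartition α.parts.card n) (t : lam.Tab),
      blockSizes lam.setPartition = α.parts ∧ (∀ i j, i ≤ j → le (lam.comp i) (lam.comp j)) ∧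
      lam.IsStd t ∧ lam.IsIncreasing t ∧ (∀ k, ∃ x, (t x).1 = k) ∧
      (∀ x, lam.comp (t x).1 = sh x) ∧ (∀ x, ((t x).2.1 : ℕ × ℕ) = T x) ∧
      ∀ x y, (t x).1 = (t y).1 ↔ SameBlock A x y := by
  classical
  have hE := sameBlock_equivalence A
  obtain ⟨ρ, hρ⟩ := exists_rank le (Finset.univ.image sh)
  have hm : ∀ x, ∃ m, m ∈ A.part x ∧ ∀ y ∈ A.part x, m ≤ y := fun x ↦ by
    have hx : (A.part x).Nonempty := ⟨x, (mem_part_iff A).2 (hE.refl x)⟩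
    exact ⟨_, Finset.min'_mem _ hx, fun y hy ↦ Finset.min'_le _ y hy⟩
  choose m hm hm' using hm
  -- Blocks are numbered by shape first and by smallest entry second: the first key sorts the
  -- components of `λ`, the second makes the tableau increasing.
  let f (x : Fin n) : ℕ ×ₗ Fin n := toLex (ρ (sh x), m x)
  have hf : ∀ x y, f x = f y ↔ SameBlock A x y := by
    intro x y
    constructor
    · intro h
      have h2 : m x = m y := congrArg (fun z ↦ (ofLex z).2) h
      exact hE.trans (hE.symm ((mem_part_iff A).1 (hm x))) ((mem_part_iff A).1 (h2 ▸ hm y))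
    · intro h
      have hp : A.part x = A.part y := h
      have h2 : m x = m y := le_antisymm (hm' x _ (hp ▸ hm y)) (hm' y _ (hp ▸ hm x))
      simp only [f, hsh x y h, h2]
  have hcard : (Finset.univ.image f).card = α.parts.card := by
    have h1 : A.parts = Finset.univ.image A.part := by
      ext b
      simp [mem_parts_iff]
    rw [← hA, blockSizes, Multiset.card_map, Finset.card_val, h1]
    exact le_antisymm (card_image_le_of_ker fun x y h ↦ (hf x y).2 h)
      (card_image_le_of_ker fun x y h ↦ (hf x y).1 h)
  obtain ⟨c, hc, hcf⟩ := exists_surjective_fin f hcard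
  have hce : ∀ x y, c x = c y ↔ SameBlock A x y := fun x y ↦ by
    rw [← hf, le_antisymm_iff, le_antisymm_iff, hcf, hcf]
  have hsum : ∑ k, (sh (Function.surjInv hc k)).card = n := by
    have h1 : ∀ k, (sh (Function.surjInv hc k)).card =
        (Finset.univ.filter fun x ↦ c x = k).card := fun k ↦ by
      rw [(hT _).card_eq]
      congr 1
      ext x
      rw [mem_part_iff, Finset.mem_filter_univ, ← hce, Function.surjInv_eq hc]
    rw [Finset.sum_congr rfl fun k _ ↦ h1 k,
      ← Finset.card_eq_sum_card_fiberwise fun x _ ↦ Finset.mem_coe.2 (Finset.mem_univ (c x))]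
    simp
  let lam : Multipartition α.parts.card n := ⟨fun k ↦ sh (Function.surjInv hc k), hsum⟩
  have hcomp : ∀ x, lam.comp (c x) = sh x := fun x ↦
    hsh _ _ ((hce _ _).1 (Function.surjInv_eq hc _))
  have hTab : ∀ k, TabOn {x | c x = k} (lam.comp k) T := by
    intro k
    obtain ⟨y, rfl⟩ := hc k
    rw [hcomp]
    have h1 : (Finset.univ.filter fun x ↦ c x = c y) = A.part y := by
      ext x
      rw [mem_part_iff, Finset.mem_filter_univ, hce]
    exact h1 ▸ hT y
  let t := ofTabOn c T hTab
  have ht : ∀ x, (t x).1 = c x := ofTabOn_fst hTab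
  have hmin : ∀ x, lam.minEntry t (c x) = m x := by
    intro x
    refine IsLeast.csInf_eq ⟨⟨t (m x), ?_, by simp⟩, ?_⟩
    · rw [ht, hce]
      exact (mem_part_iff A).1 (hm x)
    · rintro _ ⟨y, hy, rfl⟩
      obtain ⟨z, rfl⟩ := t.surjective y
      rw [ht, hce] at hy
      rw [Equiv.symm_apply_apply]
      exact hm' x z ((mem_part_iff A).2 hy)
  refine ⟨lam, t, ?_, ?_, isStd_ofTabOn hTab, ?_, fun k ↦ ?_, hcomp, ofTabOn_snd hTab, hce⟩
  · refine (blockSizes_eq_of_perm (t.trans lam.initial.symm) fun x y ↦ ?_).trans hA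
    rw [lam.setPartition_eq, sameBlock_kerPartition]
    simp only [Equiv.trans_apply, Equiv.apply_symm_apply]
    exact hce x y
  · intro i j hij
    obtain ⟨x, rfl⟩ := hc i
    obtain ⟨y, rfl⟩ := hc j
    rw [hcomp, hcomp]
    refine hρ _ (Finset.mem_image_of_mem sh (Finset.mem_univ x)) _ ?_
    have := (hcf x y).1 hij
    rcases Prod.Lex.toLex_le_toLex.1 this with h | h
    · exact h.le
    · exact h.1.le
  · intro i j hij
    obtain ⟨x, rfl⟩ := hc i
    obtain ⟨y, rfl⟩ := hc j
    rw [hcomp, hcomp] at hij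
    rw [hmin, hmin, ← not_le, hcf, not_le, Prod.Lex.toLex_lt_toLex, hij]
    simp
  · obtain ⟨x, rfl⟩ := hc k
    exact ⟨x, ht x⟩

end Multipartition

open Multipartition

/-! ### Encoding a set partition and a permutation by a triple -/

section Coding

variable {n : ℕ}

/-- The set partition `A` and the permutation `w` are encoded by two tableaux `s`, `t` of the same
shape and a permutation `π` of the components. -/
structure BlockCoding {r : ℕ} (A : SetPartition n) (w : Equiv.Perm (Fin n))
    (lam : Multipartition r n) (s t : lam.Tab) (π : Equiv.Perm (Fin r)) : Prop where
  left_iff : ∀ x y, (s x).1 = (s y).1 ↔ SameBlock A x y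
  right_iff : ∀ x y, (t x).1 = (t y).1 ↔ SameBlock (permute w A) x y
  perm : ∀ x, (t (w x)).1 = π (s x).1
  shape : ∀ x, lam.comp (s x).1 = rsShape (A.part x) ((permute w A).part (w x)) w
  left : ∀ x, ((s x).2.1 : ℕ × ℕ) = rsLeft (A.part x) ((permute w A).part (w x)) w x
  right : ∀ y, ((t y).2.1 : ℕ × ℕ) = rsRight (A.part (w.symm y)) ((permute w A).part y) w y

theorem mapsOnto_part (w : Equiv.Perm (Fin n)) (A : SetPartition n) (x : Fin n) :
    MapsOnto w (A.part x) ((permute w A).part (w x)) := fun z ↦ by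
  rw [mem_part_iff, mem_part_iff, sameBlock_permute, Equiv.symm_apply_apply,
    Equiv.symm_apply_apply]

/-- `s` determines `A`, `t` determines the image partition, and `π` matches their blocks; on each
matched pair of blocks the two tableaux determine `w`. -/
theorem BlockCoding.unique {r : ℕ} {A A' : SetPartition n} {w w' : Equiv.Perm (Fin n)}
    {lam : Multipartition r n} {s t : lam.Tab} {π : Equiv.Perm (Fin r)}
    (h : BlockCoding A w lam s t π) (h' : BlockCoding A' w' lam s t π) : A = A' ∧ w = w' := by
  obtain rfl : A = A' := setPartition_ext fun x y ↦ by rw [← h.left_iff, h'.left_iff]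
  refine ⟨rfl, Equiv.ext fun x ↦ ?_⟩
  have hB : permute w A = permute w' A :=
    setPartition_ext fun x y ↦ by rw [← h.right_iff, h'.right_iff]
  have hY : ∀ x, (permute w' A).part (w' x) = (permute w A).part (w x) := fun x ↦ by
    rw [← hB]
    refine (h.right_iff _ _).1 ?_
    rw [h.perm, h'.perm]
  have hm := mapsOnto_part w A x
  have hm' := mapsOnto_part w' A x
  rw [hY] at hm'
  have hX : ∀ z ∈ A.part x, A.part z = A.part x := fun z hz ↦ (mem_part_iff A).1 hz
  have hYz : ∀ z ∈ A.part x, (permute w A).part (w z) = (permute w A).part (w x) := fun z hz ↦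
    (mem_part_iff _).1 ((hm z).1 hz)
  refine eq_of_rs_eq hm hm' ?_ (fun z hz ↦ ?_) (fun y hy ↦ ?_) x
    ((mem_part_iff A).2 ((sameBlock_equivalence A).refl x))
  · have := (h.shape x).symm.trans (h'.shape x)
    rwa [hY] at this
  · have := (h.left z).symm.trans (h'.left z)
    rwa [hY, hX z hz, hYz z hz] at this
  · have h1 : w.symm y ∈ A.part x := (hm _).2 (by rwa [Equiv.apply_symm_apply])
    have h2 : w'.symm y ∈ A.part x := (hm' _).2 (by rwa [Equiv.apply_symm_apply])
    have h3 : (permute w A).part y = (permute w A).part (w x) := (mem_part_iff _).1 hy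
    have := (h.right y).symm.trans (h'.right y)
    rwa [hX _ h1, hX _ h2, ← hB, h3] at this

/-- `w` restricts to bijections between the blocks of `A` and those of its image. The left tableaux
form a multitableau on `A`, the right ones a multitableau on the image; sorting the common shapes
gives the same `λ` twice, and `π` records the matching of components. -/
theorem exists_blockCoding {α : n.Partition} (le : YoungDiagram → YoungDiagram → Prop)
    [IsLinearOrder YoungDiagram le] {A : SetPartition n} (hA : blockSizes A = α.parts)
    (w : Equiv.Perm (Fin n)) :
    ∃ (lam : Multipartition α.parts.card n) (s t : lam.Tab) (π : Equiv.Perm (Fin α.parts.card)),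
      blockSizes lam.setPartition = α.parts ∧ (∀ i j, i ≤ j → le (lam.comp i) (lam.comp j)) ∧
      (lam.IsStd s ∧ lam.IsIncreasing s) ∧ (lam.IsStd t ∧ lam.IsIncreasing t) ∧
      (∀ k, lam.comp (π k) = lam.comp k) ∧ BlockCoding A w lam s t π := by
  set B := permute w A with hBdef
  have hB : blockSizes B = α.parts := (blockSizes_permute w A).trans hA
  have hX : ∀ x z, SameBlock A z x → A.part z = A.part x := fun x z hz ↦ hz
  have hw : ∀ x z, SameBlock A z x ↔ SameBlock B (w z) (w x) := fun x z ↦ by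
    rw [hBdef, sameBlock_permute, Equiv.symm_apply_apply, Equiv.symm_apply_apply]
  have hw' : ∀ x z, SameBlock B z x ↔ SameBlock A (w.symm z) (w.symm x) := fun x z ↦ by
    rw [hBdef, sameBlock_permute]
  have hY : ∀ x z, SameBlock A z x → B.part (w z) = B.part (w x) := fun x z hz ↦ (hw x z).1 hz
  obtain ⟨lam, s, h1, h2, h3, h4, h5, h6, h7, h8⟩ := exists_multitableau le hA
    (fun x ↦ rsShape (A.part x) (B.part (w x)) w) (fun x ↦ rsLeft (A.part x) (B.part (w x)) w x)
    (fun x ↦ (tabOn_rsLeft (mapsOnto_part w A x)).congr fun z hz ↦ by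
      rw [hX x z ((mem_part_iff A).1 hz), hY x z ((mem_part_iff A).1 hz)])
    (fun x y hxy ↦ by rw [hX y x hxy, hY y x hxy])
  obtain ⟨lam', t, h1', h2', h3', h4', h5', h6', h7', h8'⟩ := exists_multitableau le hB
    (fun y ↦ rsShape (A.part (w.symm y)) (B.part y) w)
    (fun y ↦ rsRight (A.part (w.symm y)) (B.part y) w y)
    (fun y ↦ by
      have hm := mapsOnto_part w A (w.symm y)
      rw [Equiv.apply_symm_apply] at hm
      refine (tabOn_rsRight hm).congr fun z hz ↦ ?_
      have hz' := (mem_part_iff B).1 hz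
      rw [hX _ _ ((hw' y z).1 hz'), show B.part z = B.part y from hz'])
    (fun x y hxy ↦ by rw [hX _ _ ((hw' y x).1 hxy), show B.part x = B.part y from hxy])
  choose σ hσ using h5
  have hp : ∀ x, (t (w x)).1 = (t (w (σ (s x).1))).1 := fun x ↦ by
    rw [h8', ← hw, ← h8, hσ]
  have hinj : Function.Injective fun k ↦ (t (w (σ k))).1 := fun k l hkl ↦ by
    have := (h8' _ _).1 hkl
    rw [← hw, ← h8, hσ, hσ] at this
    exact this
  let π : Equiv.Perm (Fin α.parts.card) :=
    Equiv.ofBijective _ (Finite.injective_iff_bijective.1 hinj)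
  have hπ : ∀ x, (t (w x)).1 = π (s x).1 := hp
  have hc : ∀ k, lam'.comp (π k) = lam.comp k := fun k ↦ by
    rw [← hσ k, ← hπ, h6, h6', Equiv.symm_apply_apply]
  obtain rfl : lam' = lam := Multipartition.ext (eq_of_sorted (le := le) h2' h2 π hc)
  exact ⟨lam', s, t, π, h1, h2, ⟨h3, h4⟩, ⟨h3', h4'⟩, hc, h8, h8', hπ, h6, h7, h7'⟩

open Classical in
/-- The indices of the components with the same shape as the `j`-th one. -/
def kindSet {r : ℕ} (lam : Multipartition r n) (j : Fin r) : Finset (Fin r) :=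
  {i | lam.comp i = lam.comp j}

theorem mem_kindSet {r : ℕ} {lam : Multipartition r n} {i j : Fin r} :
    i ∈ kindSet lam j ↔ lam.comp i = lam.comp j := by
  simp [kindSet]

theorem kindSet_eq {r : ℕ} {lam : Multipartition r n} {i j : Fin r} (h : i ∈ kindSet lam j) :
    kindSet lam i = kindSet lam j := by
  ext k
  rw [mem_kindSet, mem_kindSet, mem_kindSet.1 h]

/-- The permutation `π` of the components of `λ` is encoded by two tableaux `u`, `v` of the same
shape. -/
structure KindCoding {r s : ℕ} (lam : Multipartition r n) (mu : Multipartition s r) (u v : mu.Tab)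
    (π : Equiv.Perm (Fin r)) : Prop where
  mapsOnto : ∀ k, lam.comp (π k) = lam.comp k
  shape : ∀ j, mu.comp (u j).1 = rsShape (kindSet lam j) (kindSet lam j) π
  left : ∀ j, ((u j).2.1 : ℕ × ℕ) = rsLeft (kindSet lam j) (kindSet lam j) π j
  right : ∀ j, ((v j).2.1 : ℕ × ℕ) = rsRight (kindSet lam j) (kindSet lam j) π j

theorem mapsOnto_kindSet {r : ℕ} {lam : Multipartition r n} {π : Equiv.Perm (Fin r)}
    (h : ∀ k, lam.comp (π k) = lam.comp k) (j : Fin r) :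
    MapsOnto π (kindSet lam j) (kindSet lam j) := fun x ↦ by
  rw [mem_kindSet, mem_kindSet, h]

theorem KindCoding.unique {r s : ℕ} {lam : Multipartition r n} {mu : Multipartition s r}
    {u v : mu.Tab} {π π' : Equiv.Perm (Fin r)} (h : KindCoding lam mu u v π)
    (h' : KindCoding lam mu u v π') : π = π' := by
  refine Equiv.ext fun j ↦ ?_
  refine eq_of_rs_eq (mapsOnto_kindSet h.mapsOnto j) (mapsOnto_kindSet h'.mapsOnto j)
    ((h.shape j).symm.trans (h'.shape j)) (fun z hz ↦ ?_) (fun z hz ↦ ?_) j (mem_kindSet.2 rfl)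
  · have := (h.left z).symm.trans (h'.left z)
    rwa [kindSet_eq hz] at this
  · have := (h.right z).symm.trans (h'.right z)
    rwa [kindSet_eq hz] at this

/-- `π` preserves each set of components of equal shape, and the shapes that encode its restrictions
form `μ`. By `Label.shapes_get_initial` these sets are the components of `t^μ`, so both tableaux are
of the initial kind. -/
theorem exists_kindCoding {α : n.Partition} {le : YoungDiagram → YoungDiagram → Prop}
    [IsLinearOrder YoungDiagram le] (lam : Multipartition α.parts.card n)
    (h1 : blockSizes lam.setPartition = α.parts) (h2 : ∀ i j, i ≤ j → le (lam.comp i) (lam.comp j))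
    (π : Equiv.Perm (Fin α.parts.card)) (hπ : ∀ k, lam.comp (π k) = lam.comp k) :
    ∃ (mu : Multipartition lam.shapes.length α.parts.card) (u v : mu.Tab),
      (∀ j, (mu.comp j).card = lam.mult j) ∧ (mu.IsStd u ∧ mu.IsInitialKind u) ∧
      (mu.IsStd v ∧ mu.IsInitialKind v) ∧ KindCoding lam mu u v π := by
  classical
  have hnd : Function.Injective lam.shapes.get := List.nodup_iff_injective_get.1 (List.nodup_dedup _)
  have hcls : ∀ j, ∃ k, lam.shapes.get k = lam.comp j := fun j ↦
    List.mem_iff_get.1 (List.mem_dedup.2 (List.mem_ofFn.2 ⟨j, rfl⟩))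
  choose cls hcls using hcls
  have hclsk : ∀ i k, cls i = k ↔ lam.comp i = lam.shapes.get k := fun i k ↦ by
    rw [← hcls, hnd.eq_iff]
  let X (k : Fin lam.shapes.length) : Finset (Fin α.parts.card) := {i | cls i = k}
  have hX : ∀ j, X (cls j) = kindSet lam j := fun j ↦ by
    ext i
    rw [mem_kindSet, Finset.mem_filter_univ, hclsk, hcls]
  have hm : ∀ k, MapsOnto π (X k) (X k) := fun k i ↦ by
    rw [Finset.mem_filter_univ, Finset.mem_filter_univ, hclsk, hclsk, hπ]
  have hcard : ∀ k, (rsShape (X k) (X k) π).card = (X k).card := fun k ↦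
    (tabOn_rsLeft (hm k)).card_eq
  have hsum : ∑ k, (rsShape (X k) (X k) π).card = α.parts.card := by
    rw [Finset.sum_congr rfl fun k _ ↦ hcard k,
      ← Finset.card_eq_sum_card_fiberwise fun x _ ↦ Finset.mem_coe.2 (Finset.mem_univ (cls x))]
    simp
  let mu : Multipartition lam.shapes.length α.parts.card := ⟨fun k ↦ rsShape (X k) (X k) π, hsum⟩
  have hT : ∀ k, TabOn {i | cls i = k} (mu.comp k)
      (fun i ↦ rsLeft (X (cls i)) (X (cls i)) π i) := fun k ↦
    (tabOn_rsLeft (hm k)).congr fun i hi ↦ by rw [(Finset.mem_filter_univ _).1 hi]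
  have hT' : ∀ k, TabOn {i | cls i = k} (mu.comp k)
      (fun i ↦ rsRight (X (cls i)) (X (cls i)) π i) := fun k ↦
    (tabOn_rsRight (hm k)).congr fun i hi ↦ by rw [(Finset.mem_filter_univ _).1 hi]
  have hmu : ∀ j, (mu.comp j).card = lam.mult j := fun j ↦ by
    rw [Multipartition.mult, count_ofFn]
    refine (hcard j).trans ?_
    congr 1
    ext i
    rw [Finset.mem_filter_univ, Finset.mem_filter_univ, hclsk]
  have hinit : ∀ j, cls j = (mu.initial j).1 := fun j ↦
    (hclsk _ _).2 (Label.shapes_get_initial (⟨lam, h1, h2, mu, hmu⟩ : Label le α) j).symm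
  refine ⟨mu, ofTabOn cls _ hT, ofTabOn cls _ hT', hmu, ⟨isStd_ofTabOn hT, hinit⟩,
    ⟨isStd_ofTabOn hT', hinit⟩, hπ, fun j ↦ ?_, fun j ↦ ?_, fun j ↦ ?_⟩
  · rw [ofTabOn_fst, ← hX]
  · rw [ofTabOn_snd, hX]
  · rw [ofTabOn_snd, hX]

/-- The two codings combine into an injection; the bound `n` on the columns is automatic, since a
row has at most `n` nodes. -/
theorem card_le_card_basisIndex (le : YoungDiagram → YoungDiagram → Prop)
    [IsLinearOrder YoungDiagram le] (α : n.Partition) :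
    Nat.card ({A : SetPartition n // blockSizes A = α.parts} × Equiv.Perm (Fin n)) ≤
      Nat.card (BasisIndex le α n) := by
  have key : ∀ p : {A : SetPartition n // blockSizes A = α.parts} × Equiv.Perm (Fin n),
      ∃ x : BasisIndex le α n, ∃ π,
        BlockCoding p.1.1 p.2 x.1.1.lam x.2.1.t x.2.2.t π ∧
        KindCoding x.1.1.lam x.1.1.mu x.2.1.u x.2.2.u π := by
    rintro ⟨⟨A, hA⟩, w⟩
    obtain ⟨lam, s, t, π, h1, h2, hs, ht, hπ, hc⟩ := exists_blockCoding le hA w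
    obtain ⟨mu, u, v, hmu, hu, hv, hk⟩ := exists_kindCoding lam h1 h2 π hπ
    refine ⟨⟨⟨⟨lam, h1, h2, mu, hmu⟩, fun k ↦ ?_⟩, ⟨s, hs.1, hs.2, u, hu.1, hu.2⟩,
      ⟨t, ht.1, ht.2, v, hv.1, hv.2⟩⟩, π, hc, hk⟩
    by_contra hlt
    rw [not_le, ← YoungDiagram.mem_iff_lt_rowLen] at hlt
    exact (Multipartition.col_lt (lam := lam) ⟨k, (0, n), hlt⟩).ne rfl
  choose F π hF using key
  refine Nat.card_le_card_of_injective F fun p p' h ↦ ?_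
  have h1 := hF p
  have h2 := hF p'
  rw [h] at h1
  have hπ := h1.2.unique h2.2
  rw [hπ] at h1
  obtain ⟨h3, h4⟩ := h1.1.unique h2.1
  exact Prod.ext (Subtype.ext h3) h4

end Coding

/-! ### The `n_{𝔰𝔱}` span -/

/-- A family of at least as many elements of a span that has a unit as Gram determinant with
respect to some functionals is a generating family. -/
theorem span_le_span_of_isUnit_det {R M ι J : Type*} [CommRing R] [AddCommGroup M] [Module R M]
    [Fintype ι] [DecidableEq ι] [Finite J] (hc : Nat.card J ≤ Nat.card ι) {gen : J → M} {b : ι → M}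
    (hb : ∀ i, b i ∈ Submodule.span R (Set.range gen)) (φ : ι → M →ₗ[R] R)
    (hdet : IsUnit (Matrix.of fun i j ↦ φ i (b j)).det) :
    Submodule.span R (Set.range gen) ≤ Submodule.span R (Set.range b) := by
  have : Fintype J := Fintype.ofFinite J
  rw [Nat.card_eq_fintype_card, Nat.card_eq_fintype_card] at hc
  obtain ⟨e⟩ := Function.Embedding.nonempty_of_card_le hc
  -- Padding the generators with zeros makes the coefficient matrix `C'` square.
  let gen' : ι → M := Function.extend e gen 0
  have hgen' : ∀ j, gen' (e j) = gen j := fun j ↦ e.injective.extend_apply gen 0 j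
  have hle : Submodule.span R (Set.range gen) ≤ Submodule.span R (Set.range gen') := by
    refine Submodule.span_mono ?_
    rintro _ ⟨j, rfl⟩
    exact ⟨e j, hgen' j⟩
  choose C hC using fun j ↦ (Submodule.mem_span_range_iff_exists_fun R).1 (hle (hb j))
  let C' : Matrix ι ι R := Matrix.of fun i j ↦ C j i
  have hmul : (Matrix.of fun i j ↦ φ i (b j)) = (Matrix.of fun i j ↦ φ i (gen' j)) * C' := by
    ext i j
    rw [Matrix.mul_apply, Matrix.of_apply, ← hC j, map_sum]
    exact Finset.sum_congr rfl fun k _ ↦ by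
      rw [map_smul, smul_eq_mul, mul_comm]; rfl
  -- The Gram matrix factors through `C'`, so `C'` is invertible over `R`, and its inverse expresses
  -- the generators in terms of the `b i`.
  rw [hmul, Matrix.det_mul] at hdet
  have hdC : IsUnit C'.det := isUnit_of_mul_isUnit_right hdet
  rw [Submodule.span_le]
  rintro _ ⟨j, rfl⟩
  have : gen j = ∑ i, C'⁻¹ i (e j) • b i := by
    have h1 : ∀ i, C'⁻¹ i (e j) • b i = ∑ k, (C' k i * C'⁻¹ i (e j)) • gen' k := fun i ↦ by
      rw [← hC i, Finset.smul_sum]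
      exact Finset.sum_congr rfl fun k _ ↦ by
        rw [smul_smul, mul_comm]; rfl
    rw [Finset.sum_congr rfl fun i _ ↦ h1 i, Finset.sum_comm]
    simp_rw [← Finset.sum_smul, ← Matrix.mul_apply, Matrix.mul_nonsing_inv C' hdC,
      Matrix.one_apply, ite_smul, one_smul, zero_smul]
    rw [Finset.sum_ite_eq' Finset.univ (e j) gen', if_pos (Finset.mem_univ _), hgen']
  rw [this]
  exact Submodule.sum_mem _ fun i _ ↦
    Submodule.smul_mem _ _ (Submodule.subset_span (Set.mem_range_self i))

/-! ### Rows that are too long act by zero -/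

section Kill

variable {r n N : ℕ} (R : Type*) [CommRing R] [Algebra GroundRing R]

/-- A row with more than `N` nodes kills the words in `N` letters. -/
theorem act_idem_mul_yElt_eq_zero {lam : Multipartition r n} {k : Fin r}
    (hk : N < (lam.comp k).rowLen 0) :
    (act R (idem lam.setPartition * lam.yElt) : Module.End R (VTensor R N r n)) = 0 := by
  classical
  refine (vBasis R N r n).ext fun f ↦ ?_
  rw [act_mul, act_idem, LinearMap.zero_apply]
  split_ifs with h
  swap
  · rw [map_zero]
  have hmem : ∀ b : Fin (N + 1), (0, (b : ℕ)) ∈ lam.comp k := fun b ↦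
    YoungDiagram.mem_iff_lt_rowLen.2 (by have := b.2; omega)
  let i (b : Fin (N + 1)) : Fin n := lam.initial.symm ⟨k, (0, b), hmem b⟩
  have hi : ∀ b, lam.initial (i b) = ⟨k, (0, b), hmem b⟩ := fun b ↦ Equiv.apply_symm_apply _ _
  have hkey : ∀ b b', lam.rowKey (i b) = lam.rowKey (i b') := fun b b' ↦ by
    rw [Multipartition.rowKey_eq_iff, hi, hi]
    exact ⟨rfl, rfl⟩
  have hcol : ∀ x y, lam.rowKey x = lam.rowKey y → (f x).2 = (f y).2 := fun x y hxy ↦ by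
    rw [Multipartition.setPartition_eq, kerPartition_eq_iff] at h
    exact (h x y).1 (Multipartition.rowKey_eq_iff.1 hxy).1
  -- Only `N` letters are available for the first `N + 1` nodes of the row.
  obtain ⟨b, b', hne, hb⟩ := Fintype.exists_ne_map_eq_of_card_lt (fun b ↦ (f (i b)).1)
    (by simp : Fintype.card (Fin N) < Fintype.card (Fin (N + 1)))
  have hf : f (i b) = f (i b') := Prod.ext hb (hcol _ _ (hkey b b'))
  have hine : i b ≠ i b' := fun he ↦ hne (by
    have h1 := (hi b).symm.trans ((congrArg lam.initial he).trans (hi b'))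
    exact Fin.ext (congrArg (fun x : lam.Node ↦ x.2.1.2) h1))
  rw [Multipartition.yElt_eq]
  rcases hine.lt_or_gt with hlt | hlt
  · exact act_antisymmetrizer_eq_zero R Multipartition.monotone_rowKey hcol hlt (hkey b b') hf
  · exact act_antisymmetrizer_eq_zero R Multipartition.monotone_rowKey hcol hlt (hkey b' b) hf.symm

end Kill

/-! ### The `n_{𝔰𝔱}` generate `𝓔_n^α(q)` -/

section Elt

variable {le : YoungDiagram → YoungDiagram → Prop} {n : ℕ} {α : n.Partition}

theorem Label.nElt_mem (L : Label le α) (s t : L.StdTab) : L.nElt s t ∈ BTType α := by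
  have := mul_idem_mul_mem L.type_eq (star (gPerm (L.lam.dPerm s.t)))
    (L.lam.yElt * (star (L.lam.bPerm (L.mu.dPerm s.u)) * (L.cElt * (L.lam.bPerm (L.mu.dPerm t.u) *
      gPerm (L.lam.dPerm t.t)))))
  simpa only [Label.nElt, mul_assoc] using this

theorem Label.act_nElt_eq_zero {L : Label le α} {N : ℕ} (h : ¬L.ColumnsLE N) (s t : L.StdTab)
    (R : Type*) [CommRing R] [Algebra GroundRing R] :
    (act R (L.nElt s t) : Module.End R (VTensor R N α.parts.card n)) = 0 := by
  rw [Label.ColumnsLE, not_forall] at h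
  obtain ⟨k, hk⟩ := h
  have h0 := act_idem_mul_yElt_eq_zero R (not_le.1 hk)
  refine LinearMap.ext fun v ↦ ?_
  have h1 : L.nElt s t = star (gPerm (L.lam.dPerm s.t)) * ((idem L.lam.setPartition * L.lam.yElt) *
      (star (L.lam.bPerm (L.mu.dPerm s.u)) * (L.cElt * (L.lam.bPerm (L.mu.dPerm t.u) *
      gPerm (L.lam.dPerm t.t))))) := by
    simp only [Label.nElt, mul_assoc]
  rw [h1, act_mul, act_mul, h0, LinearMap.zero_apply, LinearMap.zero_apply, map_zero]

/-- For `N = n` there are at least as many triples as generators `𝔼_A g_w`, and the test matrix has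
unit determinant over `S`. Linear independence of the generators is not required. -/
theorem BTType_le_span [IsLinearOrder YoungDiagram le] {y : BT n} (hy : y ∈ BTType α) :
    y ∈ Submodule.span GroundRing (Set.range fun x : BasisIndex le α n ↦ x.elt) := by
  classical
  have : Fintype (BasisIndex le α n) := Fintype.ofFinite _
  have h1 : ∀ y ∈ BTType α, y ∈ Submodule.span GroundRing (Set.range
      fun p : {A : SetPartition n // blockSizes A = α.parts} × Equiv.Perm (Fin n) ↦
        idem p.1.1 * gPerm p.2) := by
    rintro _ ⟨y, rfl⟩
    exact mem_span_idem_mul_gPerm α y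
  refine span_le_span_of_isUnit_det (card_le_card_basisIndex le α)
    (fun x ↦ h1 _ (x.1.1.nElt_mem _ _))
    (fun x ↦ x.test GroundRing ∘ₗ actLin GroundRing n α.parts.card n) ?_ (h1 y hy)
  exact BasisIndex.isUnit_det_testMatrix GroundRing

theorem eq_top_of_elt_mem [IsLinearOrder YoungDiagram le] {N : ℕ}
    {W : Submodule GroundRing (BTType α)}
    (h1 : ∀ x : BasisIndex le α N, (⟨x.elt, x.1.1.nElt_mem _ _⟩ : BTType α) ∈ W)
    (h2 : ∀ (L : Label le α), ¬L.ColumnsLE N → ∀ s t,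
      (⟨L.nElt s t, L.nElt_mem s t⟩ : BTType α) ∈ W) (z : BTType α) : z ∈ W := by
  have h3 : Submodule.span GroundRing (Set.range fun x : BasisIndex le α n ↦ x.elt) ≤
      W.map (BTType α).toSubmodule.subtype := by
    rw [Submodule.span_le]
    rintro _ ⟨x, rfl⟩
    refine ⟨⟨x.elt, x.1.1.nElt_mem _ _⟩, ?_, rfl⟩
    by_cases hx : x.1.1.ColumnsLE N
    · exact h1 ⟨⟨x.1.1, hx⟩, x.2⟩
    · exact h2 x.1.1 hx _ _
  obtain ⟨z', hz', h⟩ := h3 (BTType_le_span (le := le) z.2)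
  obtain rfl : z' = z := Subtype.ext h
  exact hz'

end Elt

/-! ### Annihilators as kernels of the action -/

section Annihilators

variable {n : ℕ} {α : n.Partition} {N : ℕ}

theorem idemType_mul_self (α : n.Partition) : idemType α * idemType α = idemType α := by
  classical
  conv_lhs => rw [idemType.eq_1 (α := α), Finset.mul_sum]
  rw [idemType]
  refine Finset.sum_congr rfl fun A hA ↦ ?_
  exact idemType_mul_idem (by simpa using hA)

theorem idemType_mul_coe (z : BTType α) : idemType α * (z : BT n) = z := by
  obtain ⟨_, y, rfl⟩ := z
  rw [← mul_assoc, idemType_mul_self]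

/-- Every `z` in `𝓔_n^α(q)` equals `𝔼_α z`, so it acts on a vector through the projection of that
vector to `𝔼_α V^{⊗ n}`. -/
theorem mem_annIdeal_iff {z : BTType α} : z ∈ annIdeal α N ↔
    (act GroundRing (z : BT n) : Module.End GroundRing (VTensor GroundRing N α.parts.card n)) = 0 := by
  constructor
  · intro h
    refine LinearMap.ext fun v ↦ ?_
    rw [← idemType_mul_coe, act_mul]
    exact h _ ⟨v, rfl⟩
  · intro h v _
    exact LinearMap.congr_fun h v

theorem annIdeal_mul_mem {x : BTType α} (hx : x ∈ annIdeal α N) (y : BTType α) :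
    x * y ∈ annIdeal α N ∧ y * x ∈ annIdeal α N := by
  rw [mem_annIdeal_iff] at hx
  constructor <;> rw [mem_annIdeal_iff] <;> refine LinearMap.ext fun v ↦ ?_ <;>
    rw [NonUnitalSubalgebra.coe_mul, act_mul, hx] <;> simp

variable {K : Type*} [CommRing K] [Algebra GroundRing K]

theorem actK_tmul (c : K) (z : BTType α) : actK α N K (c ⊗ₜ[GroundRing] z) = c • act K (z : BT n) := by
  rw [actK, LinearMap.liftBaseChange_tmul]
  rfl

theorem actK_mul (x y : BTTypeK α K) (v : VTensor K N α.parts.card n) :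
    actK α N K (x * y) v = actK α N K y (actK α N K x v) := by
  induction x using TensorProduct.induction_on with
  | zero => simp
  | add x x' hx hx' => rw [add_mul, map_add, map_add, LinearMap.add_apply, LinearMap.add_apply,
      hx, hx', map_add]
  | tmul c x =>
    induction y using TensorProduct.induction_on with
    | zero => simp
    | add y y' hy hy' => rw [mul_add, map_add, map_add, LinearMap.add_apply, LinearMap.add_apply,
        hy, hy']
    | tmul d y =>
      rw [Algebra.TensorProduct.tmul_mul_tmul, actK_tmul, actK_tmul, actK_tmul,
        NonUnitalSubalgebra.coe_mul, LinearMap.smul_apply, LinearMap.smul_apply,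
        LinearMap.smul_apply, act_mul, map_smul, smul_smul, mul_comm]

theorem actK_act_idemType (z : BTTypeK α K) (v : VTensor K N α.parts.card n) :
    actK α N K z (act K (idemType α) v) = actK α N K z v := by
  induction z using TensorProduct.induction_on with
  | zero => simp
  | add x x' hx hx' => rw [map_add, LinearMap.add_apply, LinearMap.add_apply, hx, hx']
  | tmul c x => rw [actK_tmul, LinearMap.smul_apply, LinearMap.smul_apply, ← act_mul,
      idemType_mul_coe]

theorem mem_annIdealK_iff {z : BTTypeK α K} : z ∈ annIdealK α N K ↔ actK α N K z = 0 := by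
  constructor
  · intro h
    refine LinearMap.ext fun v ↦ ?_
    rw [← actK_act_idemType]
    exact h _ ⟨v, rfl⟩
  · intro h v _
    exact LinearMap.congr_fun h v

theorem annIdealK_mul_mem {x : BTTypeK α K} (hx : x ∈ annIdealK α N K) (y : BTTypeK α K) :
    x * y ∈ annIdealK α N K ∧ y * x ∈ annIdealK α N K := by
  rw [mem_annIdealK_iff] at hx
  constructor <;> rw [mem_annIdealK_iff] <;> refine LinearMap.ext fun v ↦ ?_ <;>
    rw [actK_mul, hx] <;> simp

end Annihilators

/-! ### The bases of the quotients -/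

section Bases

variable {le : YoungDiagram → YoungDiagram → Prop} {n : ℕ} {α : n.Partition} {N : ℕ}

/-- The element `n_{𝔰𝔱}` of `𝓔_n^α(q)`. -/
def BasisIndex.typeElt (x : BasisIndex le α N) : BTType α := ⟨x.elt, x.1.1.nElt_mem _ _⟩

variable (le α N) [IsLinearOrder YoungDiagram le]

theorem exists_basis_ETL : ∃ b : Module.Basis (BasisIndex le α N) GroundRing (ETL α N),
    ∀ x, b x = Submodule.Quotient.mk x.typeElt := by
  have : Fintype (BasisIndex le α N) := Fintype.ofFinite _
  have hli : LinearIndependent GroundRing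
      fun x : BasisIndex le α N ↦ (annIdeal α N).mkQ x.typeElt := by
    refine Fintype.linearIndependent_iff.2 fun c hc ↦ congrFun ?_
    refine BasisIndex.eq_zero_of_sum_smul_act_elt (N := N) GroundRing ?_
    simp_rw [← map_smul] at hc
    rw [← map_sum, Submodule.mkQ_apply, Submodule.Quotient.mk_eq_zero, mem_annIdeal_iff] at hc
    rw [← hc]
    have := map_sum (actLin GroundRing N α.parts.card n ∘ₗ (BTType α).toSubmodule.subtype)
      (fun x : BasisIndex le α N ↦ c x • x.typeElt) Finset.univ
    refine Eq.trans ?_ this.symm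
    exact Finset.sum_congr rfl fun x _ ↦ (LinearMap.map_smul _ _ _).symm
  refine ⟨Module.Basis.mk hli ?_, fun x ↦ Module.Basis.mk_apply hli _ x⟩
  rintro z -
  obtain ⟨z, rfl⟩ := Submodule.mkQ_surjective _ z
  refine eq_top_of_elt_mem (le := le) (N := N) (W := Submodule.comap (annIdeal α N).mkQ
    (Submodule.span GroundRing (Set.range
      fun x : BasisIndex le α N ↦ (annIdeal α N).mkQ x.typeElt)))
    (fun x ↦ Submodule.subset_span ⟨x, rfl⟩) (fun L hL s t ↦ ?_) z
  have : (annIdeal α N).mkQ (⟨L.nElt s t, L.nElt_mem s t⟩ : BTType α) = 0 :=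
    (Submodule.Quotient.mk_eq_zero _).2 (mem_annIdeal_iff.2 (Label.act_nElt_eq_zero hL s t _))
  rw [Submodule.mem_comap, this]
  exact Submodule.zero_mem _

/-- Independence is tested over `K` itself, where the determinant is again a unit; generation is
inherited from `S` through the tensors `1 ⊗ z`. So the formation of the annihilator need not be
compared with base change. -/
theorem exists_basis_ETLK (K : Type*) [CommRing K] [Algebra GroundRing K] :
    ∃ b : Module.Basis (BasisIndex le α N) K (ETLK α N K),
      ∀ x, b x = Submodule.Quotient.mk ((1 : K) ⊗ₜ[GroundRing] x.typeElt) := by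
  have : Fintype (BasisIndex le α N) := Fintype.ofFinite _
  have hli : LinearIndependent K
      fun x : BasisIndex le α N ↦ (annIdealK α N K).mkQ ((1 : K) ⊗ₜ[GroundRing] x.typeElt) := by
    refine Fintype.linearIndependent_iff.2 fun c hc ↦ congrFun ?_
    refine BasisIndex.eq_zero_of_sum_smul_act_elt (N := N) K ?_
    simp_rw [← map_smul] at hc
    rw [← map_sum, Submodule.mkQ_apply, Submodule.Quotient.mk_eq_zero, mem_annIdealK_iff,
      map_sum] at hc
    rw [← hc]
    exact Finset.sum_congr rfl fun x _ ↦ by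
      rw [map_smul, actK_tmul, one_smul]; rfl
  refine ⟨Module.Basis.mk hli ?_, fun x ↦ Module.Basis.mk_apply hli _ x⟩
  rintro z -
  obtain ⟨z, rfl⟩ := Submodule.mkQ_surjective _ z
  set S := Submodule.span K (Set.range
    fun x : BasisIndex le α N ↦ (annIdealK α N K).mkQ ((1 : K) ⊗ₜ[GroundRing] x.typeElt))
  have key : ∀ z : BTType α, (1 : K) ⊗ₜ[GroundRing] z ∈ S.comap (annIdealK α N K).mkQ := by
    refine eq_top_of_elt_mem (le := le) (N := N) (W := Submodule.comap
      (TensorProduct.mk GroundRing K (BTType α) 1)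
        ((S.comap (annIdealK α N K).mkQ).restrictScalars GroundRing))
      (fun x ↦ Submodule.subset_span ⟨x, rfl⟩) (fun L hL s t ↦ ?_)
    have : (annIdealK α N K).mkQ
        ((1 : K) ⊗ₜ[GroundRing] (⟨L.nElt s t, L.nElt_mem s t⟩ : BTType α)) = 0 := by
      refine (Submodule.Quotient.mk_eq_zero _).2 (mem_annIdealK_iff.2 ?_)
      rw [actK_tmul, Label.act_nElt_eq_zero hL s t, smul_zero]
    change (annIdealK α N K).mkQ _ ∈ S
    rw [TensorProduct.mk_apply, this]
    exact Submodule.zero_mem _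
  change z ∈ S.comap (annIdealK α N K).mkQ
  induction z using TensorProduct.induction_on with
  | zero => exact Submodule.zero_mem _
  | add x y hx hy => exact Submodule.add_mem _ hx hy
  | tmul c x =>
    have := Submodule.smul_mem _ c (key x)
    rwa [TensorProduct.smul_tmul', smul_eq_mul, mul_one] at this

end Bases

end BraidsTies

open BraidsTies in
theorem corollary5p4 (n : ℕ) (hn : 0 < n) (α : n.Partition) (N : ℕ) (hN : 0 < N)
    (le : YoungDiagram → YoungDiagram → Prop) (hle : IsDominanceExtension le) :
    ((∀ x ∈ annIdeal α N, ∀ y : BTType α, x * y ∈ annIdeal α N ∧ y * x ∈ annIdeal α N) ∧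
      ∃ b : Module.Basis (BasisIndex le α N) GroundRing (ETL α N),
        ∀ x : BasisIndex le α N, ∃ h : x.elt ∈ BTType α,
          b x = Submodule.Quotient.mk ⟨x.elt, h⟩) ∧
    ∀ (K : Type*) [Field K] [Algebra GroundRing K],
      (∀ x ∈ annIdealK α N K, ∀ y : BTTypeK α K,
        x * y ∈ annIdealK α N K ∧ y * x ∈ annIdealK α N K) ∧
      (∃ b : Module.Basis (BasisIndex le α N) K (ETLK α N K),
        ∀ x : BasisIndex le α N, ∃ h : x.elt ∈ BTType α,
          b x = Submodule.Quotient.mk ((1 : K) ⊗ₜ[GroundRing] (⟨x.elt, h⟩ : BTType α))) ∧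
      Finite (BasisIndex le α N) ∧
      Module.finrank K (ETLK α N K) = Nat.card (BasisIndex le α N) := by
  have := hle.linear
  obtain ⟨b, hb⟩ := exists_basis_ETL le α N
  refine ⟨⟨fun x hx y ↦ annIdeal_mul_mem hx y, b, fun x ↦ ⟨x.1.1.nElt_mem _ _, hb x⟩⟩,
    fun K _ _ ↦ ?_⟩
  obtain ⟨b, hb⟩ := exists_basis_ETLK le α N K
  exact ⟨fun x hx y ↦ annIdealK_mul_mem hx y, ⟨b, fun x ↦ ⟨x.1.1.nElt_mem _ _, hb x⟩⟩,
    finite_basisIndex N, Module.finrank_eq_nat_card_basis b⟩
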